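/- Let $n\ge 3$, $X=\{1,\dots,n\}$, and let $X'=\{x' : x\in X\}$ be a disjoint copy of $X$. **The monoid $\mathcal{PIP}_n$.** For a set $Y$ with disjoint copy $Y'$, a *line* is a subset of $Y\cup Y'$ meeting both $Y$ and $Y'$, and a *point* is a one-element subset. $\mathcal{IP}_Y$ is the monoid of all decompositions of $Y\cup Y'$ into lines; the product $a\cdot b$ is obtained by superposition of diagrams: place $b$ to the right of $a$, identify the right vertices of $a$ with the left vertices of $b$, and declare two vertices of the outer columns to be in the same block of $a\cdot b$ iff they are joined by a finite chain of blocks of $a$ and $b$. $\mathcal{PIP}_n$ is the set of all decompositions of $X\cup X'$ into lines and points. Let $Y=X\cup\{*\}$ with $*\notin X$. For $a\in\mathcal{PIP}_n$ let $\hat a\in\mathcal{IP}_Y$ consist of all lines of $a$ and one further block containing $*$, $*'$ and all points of $a$. The map $a\mapsto\hat a$ is a bijection onto the submonoid of those elements of $\mathcal{IP}_Y$ in which $*$ and $*'$ lie in the same block, and the product of $\mathcal{PIP}_n$ is defined by $\widehat{ab}=\hat a\,\hat b$. This is the *partial dual inverse symmetric monoid*. For $1\le i\le n-1$ let $s_i,r_i,l_i\in\mathcal{PIP}_n$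 have the blocks $\{t,t'\}$ for $t\ne i,i+1$ together with, respectively, - $s_i$: $\{i,(i+1)'\}$, $\{i+1,i'\}$; - $r_i$: $\{i,i+1,i'\}$, $\{(i+1)'\}$; - $l_i$: $\{i,i',(i+1)'\}$, $\{i+1\}$; and for $1\le i\le n$ let $\varepsilon_i$ have the blocks $\{i\}$, $\{i'\}$ and $\{t,t'\}$ for $t\neq i$. **The monoid $S$.** Let $S$ be the monoid with identity $e$, generated by $\sigma_1,\dots,\sigma_{n-1}$, $\lambda_1,\dots,\lambda_{n-1}$, $\rho_1,\dots,\rho_{n-1}$, $e_1,\dots,e_n$ subject to the following relations, each imposed for all indices for which all its letters are defined: - $\sigma_i^2=e$; $\ \sigma_i\sigma_j=\sigma_j\sigma_i$ for $|i-j|>1$; $\ \sigma_i\sigma_j\sigma_i=\sigma_j\sigma_i\sigma_j$ for $|i-j|=1$; - $\lambda_i\lambda_j=\lambda_j\lambda_i$, $\rho_i\rho_j=\rho_j\rho_i$, $\rho_i\lambda_j=\lambda_j\rho_i$ for $|i-j|>1$; - $\lambda_i\rho_{i+1}=\sigma_{i+1}\rho_i\lambda_ie_{i+2}=\sigma_i\rho_{i+1}\sigma_i\lambda_i$;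 $\ \lambda_{i+1}\rho_i=e_{i+2}\rho_i\lambda_i\sigma_{i+1}=\rho_i\sigma_i\lambda_{i+1}\sigma_i$; - $\rho_i\lambda_{i+1}=\rho_ie_{i+2}$; $\ \rho_{i+1}\lambda_i=e_{i+2}\lambda_i$; - $\lambda_i\rho_i\lambda_i=\lambda_i$; $\ \rho_i\lambda_i\rho_i=\rho_i$; - $\sigma_i\lambda_j\sigma_i=\sigma_j\lambda_i\sigma_j$, $\sigma_i\rho_j\sigma_i=\sigma_j\rho_i\sigma_j$ for $|i-j|=1$; - $\lambda_i\sigma_i=\lambda_i$; $\ \sigma_i\rho_i=\rho_i$; $\ \sigma_i\lambda_j=\lambda_j\sigma_i$, $\sigma_i\rho_j=\rho_j\sigma_i$ for $|i-j|>1$; - $\lambda_i\lambda_{i+1}=\lambda_i\lambda_{i+1}\sigma_i=\sigma_{i+1}\lambda_i\lambda_{i+1}$; $\ \rho_{i+1}\rho_i=\sigma_i\rho_{i+1}\rho_i=\rho_{i+1}\rho_i\sigma_{i+1}$; - $\sigma_{i+1}\lambda_{i+1}\lambda_i=\lambda_{i+1}\lambda_i=\lambda_ie_{i+2}$; $\ \rho_i\rho_{i+1}\sigma_{i+1}=\rho_i\rho_{i+1}=e_{i+2}\rho_i$;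 - $e_i=\lambda_{i-1}\rho_{i-1}$ for $i\ge2$; $\ e_1=\sigma_1e_2\sigma_1$; - $e_i^2=e_i$; $\ e_ie_{i+1}=e_{i+1}e_i=\lambda_i^2=\rho_i^2=\rho_i\sigma_i\lambda_i$; - $e_i\sigma_j=\sigma_je_i$ for $j\ne i,i-1$; $\ e_i\sigma_i=\sigma_ie_{i+1}$; $\ \sigma_ie_i=e_{i+1}\sigma_i$; - $e_i\lambda_j=\lambda_je_i$ for $j\neq i,i-1$; $\ e_{i+1}\lambda_i=\lambda_i$; $\ e_i\lambda_i=\lambda_ie_{i+1}=\lambda_ie_i=e_ie_{i+1}$; - $e_i\rho_j=\rho_je_i$ for $j\ne i,i-1$; $\ \rho_ie_{i+1}=\rho_i$; $\ \rho_ie_i=e_{i+1}\rho_i=e_i\rho_i=e_ie_{i+1}$. **Theorem.** The map $\sigma_i\mapsto s_i$, $\lambda_i\mapsto l_i$, $\rho_i\mapsto r_i$ $(1\le i\le n-1)$ extends uniquely to a monoid homomorphism $\varphi:S\to\mathcal{PIP}_n$; it satisfies $\varphi(e_i)=\varepsilon_i$ for $1\le i\le n$, and $\varphi$ is an isomorphism.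 Thus the relations above form a monoid presentation of $\mathcal{PIP}_n$. -/

import Mathlib

/-- An element of the dual inverse symmetric monoid `IP_Y`: a decomposition of `Y ⊔ Y'` into lines,
given by its equivalence relation. `Sum.inl` is the copy `Y`, `Sum.inr` is the copy `Y'`; a line is
a block that meets both copies. -/
@[ext]
structure IP (Y : Type*) where
  rel : Setoid (Y ⊕ Y)
  line : ∀ u, (∃ x, rel u (Sum.inl x)) ∧ (∃ y, rel u (Sum.inr y))

namespace IP

variable {Y : Type*}

/-- The left and middle columns of the superposition of two diagrams, whose vertex set is
`Y ⊕ (Y ⊕ Y)` (left, middle and right column). -/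
def leftMid : Y ⊕ Y → Y ⊕ (Y ⊕ Y)
  | Sum.inl x => Sum.inl x
  | Sum.inr y => Sum.inr (Sum.inl y)

/-- The middle and right columns. -/
def midRight : Y ⊕ Y → Y ⊕ (Y ⊕ Y)
  | Sum.inl x => Sum.inr (Sum.inl x)
  | Sum.inr y => Sum.inr (Sum.inr y)

/-- The left and right columns. -/
def leftRight : Y ⊕ Y → Y ⊕ (Y ⊕ Y)
  | Sum.inl x => Sum.inl x
  | Sum.inr y => Sum.inr (Sum.inr y)

/-- Being connected by one block of `a` (placed to the left) or one block of `b` (placed to the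
right), where the right vertices of `a` are identified with the left vertices of `b`. -/
inductive Step (a b : IP Y) : Y ⊕ (Y ⊕ Y) → Y ⊕ (Y ⊕ Y) → Prop
  | left {u v : Y ⊕ Y} (h : a.rel u v) : Step a b (leftMid u) (leftMid v)
  | right {u v : Y ⊕ Y} (h : b.rel u v) : Step a b (midRight u) (midRight v)

/-- The equivalence relation on the superposed diagram: being joined by a finite sequence of
steps along blocks of `a` and blocks of `b`. -/
def joint (a b : IP Y) : Setoid (Y ⊕ (Y ⊕ Y)) := Relation.EqvGen.setoid (Step a b)

theorem joint_left (a b : IP Y) {u v : Y ⊕ Y} (h : a.rel u v) :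
    joint a b (leftMid u) (leftMid v) := Relation.EqvGen.rel _ _ (Step.left h)

theorem joint_right (a b : IP Y) {u v : Y ⊕ Y} (h : b.rel u v) :
    joint a b (midRight u) (midRight v) := Relation.EqvGen.rel _ _ (Step.right h)

theorem joint_le (a b : IP Y) (s : Setoid (Y ⊕ (Y ⊕ Y)))
    (hl : ∀ u v, a.rel u v → s (leftMid u) (leftMid v))
    (hr : ∀ u v, b.rel u v → s (midRight u) (midRight v))
    {p q : Y ⊕ (Y ⊕ Y)} (h : joint a b p q) : s p q := by
  refine Setoid.eqvGen_le (s := s) ?_ h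
  rintro _ _ (h | h)
  · exact hl _ _ h
  · exact hr _ _ h

/-- The product `a · b`: two vertices of the outer columns are in the same block iff they are
connected in the superposition. -/
instance : Mul (IP Y) where
  mul a b :=
    { rel := Setoid.comap leftRight (joint a b)
      line := by
        have key1 : ∀ x : Y, ∃ y : Y, joint a b (leftRight (Sum.inl x)) (leftRight (Sum.inr y)) := by
          intro x
          obtain ⟨m, hm⟩ := (a.line (Sum.inl x)).2
          obtain ⟨y, hy⟩ := (b.line (Sum.inl m)).2
          exact ⟨y, (joint a b).trans' (joint_left a b hm) (joint_right a b hy)⟩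
        have key2 : ∀ y : Y, ∃ x : Y, joint a b (leftRight (Sum.inr y)) (leftRight (Sum.inl x)) := by
          intro y
          obtain ⟨m, hm⟩ := (b.line (Sum.inr y)).1
          obtain ⟨x, hx⟩ := (a.line (Sum.inr m)).1
          exact ⟨x, (joint a b).trans' (joint_right a b hm) (joint_left a b hx)⟩
        rintro (x | y)
        · exact ⟨⟨x, (joint a b).refl' _⟩, key1 x⟩
        · exact ⟨key2 y, ⟨y, (joint a b).refl' _⟩⟩ }

/-- The identity: the blocks are `{t, t'}`. -/
instance : One (IP Y) where
  one :=
    { rel := Setoid.ker (Sum.elim id id)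
      line := by
        rintro (x | x)
        · exact ⟨⟨x, rfl⟩, ⟨x, rfl⟩⟩
        · exact ⟨⟨x, rfl⟩, ⟨x, rfl⟩⟩ }

theorem mul_rel (a b : IP Y) (u v : Y ⊕ Y) :
    (a * b).rel u v ↔ joint a b (leftRight u) (leftRight v) := Iff.rfl

theorem one_rel (u v : Y ⊕ Y) :
    (1 : IP Y).rel u v ↔ Sum.elim id id u = Sum.elim id id v := Iff.rfl

theorem mul_assoc_le (a b c : IP Y) {u v : Y ⊕ Y} (h : (a * b * c).rel u v) :
    (a * (b * c)).rel u v := by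
  choose k hk using fun m : Y => (c.line (Sum.inl m)).2
  let f : Y ⊕ (Y ⊕ Y) → Y ⊕ (Y ⊕ Y) :=
    Sum.elim Sum.inl (Sum.elim (fun m => Sum.inr (Sum.inr (k m))) (fun z => Sum.inr (Sum.inr z)))
  let g : Y ⊕ (Y ⊕ Y) → Y ⊕ (Y ⊕ Y) :=
    Sum.elim Sum.inl (Sum.elim (fun m => Sum.inr (Sum.inl m)) (fun m => Sum.inr (Sum.inr (k m))))
  have hbc : ∀ p q : Y ⊕ Y, joint b c (leftRight p) (leftRight q) →
      joint a (b * c) (midRight p) (midRight q) := fun p q hpq => joint_right a (b * c) hpq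
  have hcc : ∀ p q, c.rel p q → joint b c (midRight p) (midRight q) :=
    fun p q hpq => joint_right b c hpq
  have hbb : ∀ p q, b.rel p q → joint b c (leftMid p) (leftMid q) :=
    fun p q hpq => joint_left b c hpq
  have hg : ∀ p q, joint a b p q → joint a (b * c) (g p) (g q) := by
    intro p q hpq
    refine joint_le a b (Setoid.comap g (joint a (b * c))) ?_ ?_ hpq
    · rintro (x | x) (y | y) hxy <;> exact joint_left a (b * c) hxy
    · rintro (x | x) (y | y) hxy
      · exact hbc (Sum.inl x) (Sum.inl y) (hbb _ _ hxy)
      · exact hbc (Sum.inl x) (Sum.inr (k y))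
          ((joint b c).trans' (hbb _ _ hxy) (hcc _ _ (hk y)))
      · exact hbc (Sum.inr (k x)) (Sum.inl y)
          ((joint b c).trans' ((joint b c).symm' (hcc _ _ (hk x))) (hbb _ _ hxy))
      · exact hbc (Sum.inr (k x)) (Sum.inr (k y))
          ((joint b c).trans' ((joint b c).symm' (hcc _ _ (hk x)))
            ((joint b c).trans' (hbb _ _ hxy) (hcc _ _ (hk y))))
  have hf : ∀ p q, joint (a * b) c p q → joint a (b * c) (f p) (f q) := by
    intro p q hpq
    refine joint_le (a * b) c (Setoid.comap f (joint a (b * c))) ?_ ?_ hpq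
    · rintro (x | x) (y | y) hxy <;> exact hg _ _ hxy
    · rintro (x | x) (y | y) hxy
      · exact hbc (Sum.inr (k x)) (Sum.inr (k y)) (hcc (Sum.inr _) (Sum.inr _)
          (c.rel.trans' (c.rel.symm' (hk x)) (c.rel.trans' hxy (hk y))))
      · exact hbc (Sum.inr (k x)) (Sum.inr y) (hcc (Sum.inr _) (Sum.inr _)
          (c.rel.trans' (c.rel.symm' (hk x)) hxy))
      · exact hbc (Sum.inr x) (Sum.inr (k y)) (hcc (Sum.inr _) (Sum.inr _)
          (c.rel.trans' hxy (hk y)))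
      · exact hbc (Sum.inr x) (Sum.inr y) (hcc (Sum.inr _) (Sum.inr _) hxy)
  have := hf _ _ h
  rcases u with u | u <;> rcases v with v | v <;> exact this

theorem mul_assoc_ge (a b c : IP Y) {u v : Y ⊕ Y} (h : (a * (b * c)).rel u v) :
    (a * b * c).rel u v := by
  choose k hk using fun m : Y => (a.line (Sum.inr m)).1
  let f : Y ⊕ (Y ⊕ Y) → Y ⊕ (Y ⊕ Y) :=
    Sum.elim Sum.inl (Sum.elim (fun m => Sum.inl (k m)) (fun z => Sum.inr (Sum.inr z)))
  let g : Y ⊕ (Y ⊕ Y) → Y ⊕ (Y ⊕ Y) :=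
    Sum.elim (fun m => Sum.inl (k m)) Sum.inr
  have hab : ∀ p q : Y ⊕ Y, joint a b (leftRight p) (leftRight q) →
      joint (a * b) c (leftMid p) (leftMid q) := fun p q hpq => joint_left (a * b) c hpq
  have hbb : ∀ p q, b.rel p q → joint a b (midRight p) (midRight q) :=
    fun p q hpq => joint_right a b hpq
  have haa : ∀ p q, a.rel p q → joint a b (leftMid p) (leftMid q) :=
    fun p q hpq => joint_left a b hpq
  have hg : ∀ p q, joint b c p q → joint (a * b) c (g p) (g q) := by
    intro p q hpq
    refine joint_le b c (Setoid.comap g (joint (a * b) c)) ?_ ?_ hpq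
    · rintro (x | x) (y | y) hxy
      · exact hab (Sum.inl (k x)) (Sum.inl (k y))
          ((joint a b).trans' ((joint a b).symm' (haa _ _ (hk x)))
            ((joint a b).trans' (hbb _ _ hxy) (haa _ _ (hk y))))
      · exact hab (Sum.inl (k x)) (Sum.inr y)
          ((joint a b).trans' ((joint a b).symm' (haa _ _ (hk x))) (hbb _ _ hxy))
      · exact hab (Sum.inr x) (Sum.inl (k y))
          ((joint a b).trans' (hbb _ _ hxy) (haa _ _ (hk y)))
      · exact hab (Sum.inr x) (Sum.inr y) (hbb _ _ hxy)
    · rintro (x | x) (y | y) hxy <;> exact joint_right (a * b) c hxy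
  have hf : ∀ p q, joint a (b * c) p q → joint (a * b) c (f p) (f q) := by
    intro p q hpq
    refine joint_le a (b * c) (Setoid.comap f (joint (a * b) c)) ?_ ?_ hpq
    · rintro (x | x) (y | y) hxy
      · exact hab (Sum.inl x) (Sum.inl y) (haa (Sum.inl _) (Sum.inl _) hxy)
      · exact hab (Sum.inl x) (Sum.inl (k y)) (haa (Sum.inl _) (Sum.inl _)
          (a.rel.trans' hxy (hk y)))
      · exact hab (Sum.inl (k x)) (Sum.inl y) (haa (Sum.inl _) (Sum.inl _)
          (a.rel.trans' (a.rel.symm' (hk x)) hxy))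
      · exact hab (Sum.inl (k x)) (Sum.inl (k y)) (haa (Sum.inl _) (Sum.inl _)
          (a.rel.trans' (a.rel.symm' (hk x)) (a.rel.trans' hxy (hk y))))
    · rintro (x | x) (y | y) hxy <;> exact hg _ _ hxy
  have := hf _ _ h
  rcases u with u | u <;> rcases v with v | v <;> exact this

theorem one_mul_rel (a : IP Y) (u v : Y ⊕ Y) : (1 * a).rel u v ↔ a.rel u v := by
  constructor
  · intro h
    have := joint_le 1 a (Setoid.comap (Sum.elim Sum.inl id) a.rel)
      (by
        rintro (x | x) (y | y) (hxy : x = y) <;> subst hxy <;> exact a.rel.refl' _)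
      (by rintro (x | x) (y | y) hxy <;> exact hxy) h
    rcases u with u | u <;> rcases v with v | v <;> exact this
  · intro h
    have e : ∀ w : Y ⊕ Y, joint 1 a (leftRight w) (midRight w) := by
      rintro (x | x)
      · exact joint_left 1 a (u := Sum.inl x) (v := Sum.inr x) rfl
      · exact (joint 1 a).refl' _
    exact (joint 1 a).trans' (e u) ((joint 1 a).trans' (joint_right 1 a h)
      ((joint 1 a).symm' (e v)))

theorem mul_one_rel (a : IP Y) (u v : Y ⊕ Y) : (a * 1).rel u v ↔ a.rel u v := by
  constructor
  · intro h
    have := joint_le a 1 (Setoid.comap (Sum.elim Sum.inl (Sum.elim Sum.inr Sum.inr)) a.rel)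
      (by rintro (x | x) (y | y) hxy <;> exact hxy)
      (by
        rintro (x | x) (y | y) (hxy : x = y) <;> subst hxy <;> exact a.rel.refl' _) h
    rcases u with u | u <;> rcases v with v | v <;> exact this
  · intro h
    have e : ∀ w : Y ⊕ Y, joint a 1 (leftRight w) (leftMid w) := by
      rintro (x | x)
      · exact (joint a 1).refl' _
      · exact joint_right a 1 (u := Sum.inr x) (v := Sum.inl x) rfl
    exact (joint a 1).trans' (e u) ((joint a 1).trans' (joint_left a 1 h)
      ((joint a 1).symm' (e v)))

instance : Monoid (IP Y) where
  mul_assoc a b c := IP.ext (Setoid.ext fun _ _ => ⟨mul_assoc_le a b c, mul_assoc_ge a b c⟩)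
  one_mul a := IP.ext (Setoid.ext fun u v => one_mul_rel a u v)
  mul_one a := IP.ext (Setoid.ext fun u v => mul_one_rel a u v)

end IP

/-- The submonoid of `IP_Y`, `Y = X ∪ {none}`, of those decompositions into lines in which the
additional element `none` and its copy `none'` belong to the same line. -/
def IPTilde (X : Type*) : Submonoid (IP (Option X)) where
  carrier := {b | b.rel (Sum.inl none) (Sum.inr none)}
  one_mem' := rfl
  mul_mem' {a b} ha hb :=
    (IP.joint a b).trans' (IP.joint_left a b ha) (IP.joint_right a b hb)

/-- An element of the partial dual inverse symmetric monoid `PIP_X`: a decomposition of `X ⊔ X'`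
into points (one-element blocks) and lines (blocks that meet both `X` and `X'`). -/
@[ext]
structure PIP (X : Type*) where
  rel : Setoid (X ⊕ X)
  point_or_line : ∀ u, (∀ v, rel v u → v = u) ∨
    ((∃ x, rel u (Sum.inl x)) ∧ (∃ y, rel u (Sum.inr y)))

namespace PIP

variable {X : Type*}

/-- `{u}` is a block of `a`. -/
def IsPoint (a : PIP X) (u : X ⊕ X) : Prop := ∀ v, a.rel v u → v = u

open Classical in
/-- The block of `a` containing `u` if that block is a line, and `none` if it is a point. -/
noncomputable def lineOf (a : PIP X) (u : X ⊕ X) : Option (Quotient a.rel) :=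
  if a.IsPoint u then none else some (Quotient.mk a.rel u)

/-- The block of the enlarged decomposition that contains a given element; `none` stands for the
additional block, which consists of the two additional elements and all points of `a`. -/
noncomputable def blockOf (a : PIP X) : Option X ⊕ Option X → Option (Quotient a.rel)
  | Sum.inl (some x) => a.lineOf (Sum.inl x)
  | Sum.inr (some x) => a.lineOf (Sum.inr x)
  | Sum.inl none => none
  | Sum.inr none => none

theorem lineOf_eq_of_rel (a : PIP X) {u v : X ⊕ X} (h : a.rel u v) : a.lineOf u = a.lineOf v := by
  have hp : a.IsPoint u ↔ a.IsPoint v := by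
    constructor
    · intro hu
      have := hu v (a.rel.symm' h)
      rwa [this]
    · intro hv
      have := hv u h
      rwa [this]
  have hq : Quotient.mk a.rel u = Quotient.mk a.rel v := Quotient.sound h
  by_cases hv : a.IsPoint v
  · simp [lineOf, hv, hp.2 hv]
  · have hu : ¬ a.IsPoint u := mt hp.1 hv
    simp [lineOf, hv, hu, hq]

theorem lineOf_eq_iff (a : PIP X) (u v : X ⊕ X) :
    a.lineOf u = a.lineOf v ↔ (a.IsPoint u ∧ a.IsPoint v) ∨ a.rel u v := by
  constructor
  · intro h
    unfold lineOf at h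
    split_ifs at h with h1 h2 h2
    · exact Or.inl ⟨h1, h2⟩
    · exact Or.inr (Quotient.exact (Option.some.inj h))
  · rintro (⟨h1, h2⟩ | h)
    · simp [lineOf, h1, h2]
    · exact a.lineOf_eq_of_rel h

theorem lineOf_eq_none (a : PIP X) (u : X ⊕ X) : a.lineOf u = none ↔ a.IsPoint u := by
  unfold lineOf
  split_ifs with h <;> simp [h]

/-- The decomposition of `Y ⊔ Y'`, `Y = X ∪ {none}`, consisting of all lines of `a` and of one
additional block, whose elements are `none`, `none'` and all points of `a`. -/
noncomputable def extend (a : PIP X) : IPTilde X where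
  val :=
    { rel := Setoid.ker a.blockOf
      line := by
        have key : ∀ (w : Option X ⊕ Option X) (u : X ⊕ X), a.blockOf w = a.lineOf u →
            (∃ x, a.blockOf w = a.blockOf (Sum.inl x)) ∧
              (∃ y, a.blockOf w = a.blockOf (Sum.inr y)) := by
          intro w u hw
          rcases a.point_or_line u with hu | ⟨⟨x, hx⟩, ⟨y, hy⟩⟩
          · have hn : a.blockOf w = none := hw.trans ((a.lineOf_eq_none u).2 hu)
            exact ⟨⟨none, hn⟩, ⟨none, hn⟩⟩
          · exact ⟨⟨some x, hw.trans (a.lineOf_eq_of_rel hx)⟩,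
              ⟨some y, hw.trans (a.lineOf_eq_of_rel hy)⟩⟩
        rintro ((_ | x) | (_ | x))
        · exact ⟨⟨none, rfl⟩, ⟨none, rfl⟩⟩
        · exact key _ (Sum.inl x) rfl
        · exact ⟨⟨none, rfl⟩, ⟨none, rfl⟩⟩
        · exact key _ (Sum.inr x) rfl }
  property := rfl

/-- The inverse construction: remove the two additional elements from their block, and cut what
is left of this block into points. -/
def restrict (b : IPTilde X) : PIP X where
  rel :=
    { r := fun u v => u = v ∨ (b.1.rel (Sum.map some some u) (Sum.map some some v) ∧
        ¬ b.1.rel (Sum.map some some u) (Sum.inl none))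
      iseqv :=
        { refl := fun u => Or.inl rfl
          symm := by
            rintro u v (h | ⟨h, h'⟩)
            · exact Or.inl h.symm
            · exact Or.inr ⟨b.1.rel.symm' h, fun h2 => h' (b.1.rel.trans' h h2)⟩
          trans := by
            rintro u v w (rfl | ⟨h, h'⟩) h2
            · exact h2
            · rcases h2 with rfl | ⟨h3, _⟩
              · exact Or.inr ⟨h, h'⟩
              · exact Or.inr ⟨b.1.rel.trans' h h3, h'⟩ } }
  point_or_line := by
    intro u
    by_cases hu : b.1.rel (Sum.map some some u) (Sum.inl none)
    · left
      rintro v (h | ⟨h, h'⟩)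
      · exact h
      · exact absurd (b.1.rel.trans' h hu) h'
    · right
      obtain ⟨⟨x, hx⟩, ⟨y, hy⟩⟩ := b.1.line (Sum.map some some u)
      refine ⟨?_, ?_⟩
      · rcases x with _ | x
        · exact absurd hx hu
        · exact ⟨x, Or.inr ⟨hx, hu⟩⟩
      · rcases y with _ | y
        · exact absurd (b.1.rel.trans' hy (b.1.rel.symm' b.2)) hu
        · exact ⟨y, Or.inr ⟨hy, hu⟩⟩

theorem blockOf_map (a : PIP X) (u : X ⊕ X) : a.blockOf (Sum.map some some u) = a.lineOf u := by
  rcases u with u | u <;> rfl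

theorem restrict_extend (a : PIP X) : restrict (extend a) = a := by
  refine PIP.ext (Setoid.ext fun u v => ?_)
  change (u = v ∨ (a.blockOf (Sum.map some some u) = a.blockOf (Sum.map some some v) ∧
    ¬ a.blockOf (Sum.map some some u) = none)) ↔ a.rel u v
  rw [blockOf_map, blockOf_map, lineOf_eq_iff, lineOf_eq_none]
  constructor
  · rintro (rfl | ⟨⟨h, _⟩ | h, h'⟩)
    · exact a.rel.refl' _
    · exact absurd h h'
    · exact h
  · intro h
    by_cases hu : a.IsPoint u
    · exact Or.inl (hu v (a.rel.symm' h)).symm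
    · exact Or.inr ⟨Or.inr h, hu⟩

theorem restrict_isPoint (b : IPTilde X) (u : X ⊕ X) :
    (restrict b).IsPoint u ↔ b.1.rel (Sum.map some some u) (Sum.inl none) := by
  constructor
  · intro h
    by_contra hu
    obtain ⟨⟨x, hx⟩, ⟨y, hy⟩⟩ := b.1.line (Sum.map some some u)
    rcases x with _ | x
    · exact hu hx
    rcases y with _ | y
    · exact hu (b.1.rel.trans' hy (b.1.rel.symm' b.2))
    have h1 := h (Sum.inl x) ((restrict b).rel.symm' (Or.inr ⟨hx, hu⟩))
    have h2 := h (Sum.inr y) ((restrict b).rel.symm' (Or.inr ⟨hy, hu⟩))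
    rw [← h1] at h2
    cases h2
  · rintro hu v (h | ⟨h, h'⟩)
    · exact h
    · exact absurd (b.1.rel.trans' h hu) h'

theorem extend_restrict (b : IPTilde X) : extend (restrict b) = b := by
  refine Subtype.ext (IP.ext (Setoid.ext ?_))
  have hN : ∀ u : X ⊕ X, (restrict b).blockOf (Sum.map some some u) = none ↔
      b.1.rel (Sum.map some some u) (Sum.inl none) := by
    intro u
    rw [blockOf_map, lineOf_eq_none, restrict_isPoint]
  have hR : ∀ u v : X ⊕ X, (restrict b).blockOf (Sum.map some some u) =
      (restrict b).blockOf (Sum.map some some v) ↔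
      b.1.rel (Sum.map some some u) (Sum.map some some v) := by
    intro u v
    rw [blockOf_map, blockOf_map, lineOf_eq_iff, restrict_isPoint, restrict_isPoint]
    constructor
    · rintro (⟨h1, h2⟩ | (rfl | ⟨h, _⟩))
      · exact b.1.rel.trans' h1 (b.1.rel.symm' h2)
      · exact b.1.rel.refl' _
      · exact h
    · intro h
      by_cases hu : b.1.rel (Sum.map some some u) (Sum.inl none)
      · exact Or.inl ⟨hu, b.1.rel.trans' (b.1.rel.symm' h) hu⟩
      · exact Or.inr (Or.inr ⟨h, hu⟩)
  have hs : ∀ w : Option X ⊕ Option X, (∃ u : X ⊕ X, w = Sum.map some some u) ∨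
      ((restrict b).blockOf w = none ∧ b.1.rel w (Sum.inl none)) := by
    rintro ((_ | x) | (_ | x))
    · exact Or.inr ⟨rfl, b.1.rel.refl' _⟩
    · exact Or.inl ⟨Sum.inl x, rfl⟩
    · exact Or.inr ⟨rfl, b.1.rel.symm' b.2⟩
    · exact Or.inl ⟨Sum.inr x, rfl⟩
  intro p q
  change (restrict b).blockOf p = (restrict b).blockOf q ↔ b.1.rel p q
  rcases hs p with ⟨u, rfl⟩ | ⟨hp, hp'⟩ <;> rcases hs q with ⟨v, rfl⟩ | ⟨hq, hq'⟩
  · exact hR u v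
  · rw [hq, hN]
    exact ⟨fun h => b.1.rel.trans' h (b.1.rel.symm' hq'), fun h => b.1.rel.trans' h hq'⟩
  · rw [hp, eq_comm, hN]
    exact ⟨fun h => b.1.rel.trans' hp' (b.1.rel.symm' h),
      fun h => b.1.rel.trans' (b.1.rel.symm' h) hp'⟩
  · rw [hp, hq]
    exact ⟨fun _ => b.1.rel.trans' hp' (b.1.rel.symm' hq'), fun _ => rfl⟩

/-- The bijection between `PIP_X` and the submonoid of `IP_Y`. -/
noncomputable def equivTilde (X : Type*) : PIP X ≃ IPTilde X where
  toFun := extend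
  invFun := restrict
  left_inv := restrict_extend
  right_inv := extend_restrict

/-- The multiplication of `PIP_X` is transported along the bijection with the submonoid of
`IP_Y`: `a * b = restrict (extend a * extend b)`. -/
noncomputable instance : Monoid (PIP X) := (equivTilde X).monoid

variable [DecidableEq X]

/-- `s_{x,y}`, with blocks `{x, y'}`, `{y, x'}` and `{t, t'}` for `t ≠ x, y`. -/
def s (x y : X) : PIP X where
  rel := Setoid.ker (Sum.elim id (Equiv.swap x y))
  point_or_line := by
    rintro (t | t)
    · exact Or.inr ⟨⟨t, rfl⟩, ⟨Equiv.swap x y t, (Equiv.swap_apply_self x y t).symm⟩⟩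
    · exact Or.inr ⟨⟨Equiv.swap x y t, rfl⟩, ⟨t, rfl⟩⟩

/-- `r_{x,y}` for `x ≠ y`, with blocks `{x, y, x'}`, `{y'}` and `{t, t'}` for `t ≠ x, y`. -/
def r (x y : X) : PIP X where
  rel := Setoid.ker (Sum.elim (fun t => if t = y then some x else some t)
    (fun t => if t = y then none else some t))
  point_or_line := by
    by_cases hxy : x = y
    · subst hxy
      rintro (t | t) <;> by_cases ht : t = x
      · left
        rintro (v | v) hv <;> by_cases hvx : v = x <;> simp_all [Setoid.ker_def]
      · right
        exact ⟨⟨t, rfl⟩, ⟨t, by simp [Setoid.ker_def, ht]⟩⟩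
      · left
        rintro (v | v) hv <;> by_cases hvx : v = x <;> simp_all [Setoid.ker_def]
      · right
        exact ⟨⟨t, by simp [Setoid.ker_def, ht]⟩, ⟨t, rfl⟩⟩
    · rintro (t | t) <;> by_cases ht : t = y
      · right
        exact ⟨⟨t, rfl⟩, ⟨x, by simp [Setoid.ker_def, ht, hxy]⟩⟩
      · right
        exact ⟨⟨t, rfl⟩, ⟨t, by simp [Setoid.ker_def, ht]⟩⟩
      · left
        rintro (v | v) hv <;> by_cases hvx : v = y <;> simp_all [Setoid.ker_def]
      · right
        exact ⟨⟨t, by simp [Setoid.ker_def, ht]⟩, ⟨t, rfl⟩⟩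

/-- `l_{x,y}` for `x ≠ y`, with blocks `{x, x', y'}`, `{y}` and `{t, t'}` for `t ≠ x, y`. -/
def l (x y : X) : PIP X where
  rel := Setoid.ker (Sum.elim (fun t => if t = y then none else some t)
    (fun t => if t = y then some x else some t))
  point_or_line := by
    by_cases hxy : x = y
    · subst hxy
      rintro (t | t) <;> by_cases ht : t = x
      · left
        rintro (v | v) hv <;> by_cases hvx : v = x <;> simp_all [Setoid.ker_def]
      · right
        exact ⟨⟨t, rfl⟩, ⟨t, by simp [Setoid.ker_def, ht]⟩⟩
      · left
        rintro (v | v) hv <;> by_cases hvx : v = x <;> simp_all [Setoid.ker_def]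
      · right
        exact ⟨⟨t, by simp [Setoid.ker_def, ht]⟩, ⟨t, rfl⟩⟩
    · rintro (t | t) <;> by_cases ht : t = y
      · left
        rintro (v | v) hv <;> by_cases hvx : v = y <;> simp_all [Setoid.ker_def]
      · right
        exact ⟨⟨t, rfl⟩, ⟨t, by simp [Setoid.ker_def, ht]⟩⟩
      · right
        exact ⟨⟨x, by simp [Setoid.ker_def, ht, hxy]⟩, ⟨t, rfl⟩⟩
      · right
        exact ⟨⟨t, by simp [Setoid.ker_def, ht]⟩, ⟨t, rfl⟩⟩

/-- `ε_x`, with blocks `{x}`, `{x'}` and `{t, t'}` for `t ≠ x`. -/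
def eps (x : X) : PIP X where
  rel :=
    { r := fun u v => u = v ∨ (Sum.elim id id u = Sum.elim id id v ∧ Sum.elim id id u ≠ x)
      iseqv :=
        { refl := fun u => Or.inl rfl
          symm := by
            rintro u v (h | ⟨h, h'⟩)
            · exact Or.inl h.symm
            · exact Or.inr ⟨h.symm, h ▸ h'⟩
          trans := by
            rintro u v w (rfl | ⟨h, h'⟩) h2
            · exact h2
            · rcases h2 with rfl | ⟨h3, _⟩
              · exact Or.inr ⟨h, h'⟩
              · exact Or.inr ⟨h.trans h3, h'⟩ } }
  point_or_line := by
    intro u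
    by_cases hu : Sum.elim id id u = x
    · left
      rintro v (h | ⟨h, h'⟩)
      · exact h
      · exact absurd (h.trans hu) h'
    · right
      exact ⟨⟨Sum.elim id id u, Or.inr ⟨rfl, hu⟩⟩, ⟨Sum.elim id id u, Or.inr ⟨rfl, hu⟩⟩⟩

end PIP

namespace PIPPresentation

/-- The generators `σ_i, λ_i, ρ_i` (`n - 1` of each kind) and `e_i` (`n` of them). Indices start
at `0`: the index `i` here corresponds to the index `i + 1` in the enumeration by `1, 2, …`. -/
inductive Gen (n : ℕ)
  | sigma (i : ℕ) (h : i + 1 < n)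
  | lam (i : ℕ) (h : i + 1 < n)
  | rho (i : ℕ) (h : i + 1 < n)
  | e (i : ℕ) (h : i < n)

variable {n : ℕ}

/-- The word `σ_i`. -/
def σ (i : ℕ) (h : i + 1 < n := by omega) : FreeMonoid (Gen n) := FreeMonoid.of (Gen.sigma i h)

/-- The word `λ_i`. -/
def lm (i : ℕ) (h : i + 1 < n := by omega) : FreeMonoid (Gen n) := FreeMonoid.of (Gen.lam i h)

/-- The word `ρ_i`. -/
def ρ (i : ℕ) (h : i + 1 < n := by omega) : FreeMonoid (Gen n) := FreeMonoid.of (Gen.rho i h)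

/-- The word `e_i`. -/
def e (i : ℕ) (h : i < n := by omega) : FreeMonoid (Gen n) := FreeMonoid.of (Gen.e i h)

/-- The defining relations, each for all indices for which all its letters are defined. A chain of
equalities `u = v = w` is listed as `u = v` and `v = w`. The condition `|i - j| > 1` is written
`i + 1 < j ∨ j + 1 < i`, and `|i - j| = 1` is written `i + 1 = j ∨ j + 1 = i`. -/
inductive Relations (n : ℕ) : FreeMonoid (Gen n) → FreeMonoid (Gen n) → Prop
  | sigma_sq (i : ℕ) (hi : i + 1 < n) : Relations n (σ i * σ i) 1
  | sigma_comm (i j : ℕ) (hi : i + 1 < n) (hj : j + 1 < n) (hij : i + 1 < j ∨ j + 1 < i) :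
      Relations n (σ i * σ j) (σ j * σ i)
  | sigma_braid (i j : ℕ) (hi : i + 1 < n) (hj : j + 1 < n) (hij : i + 1 = j ∨ j + 1 = i) :
      Relations n (σ i * σ j * σ i) (σ j * σ i * σ j)
  | lam_lam_comm (i j : ℕ) (hi : i + 1 < n) (hj : j + 1 < n) (hij : i + 1 < j ∨ j + 1 < i) :
      Relations n (lm i * lm j) (lm j * lm i)
  | rho_rho_comm (i j : ℕ) (hi : i + 1 < n) (hj : j + 1 < n) (hij : i + 1 < j ∨ j + 1 < i) :
      Relations n (ρ i * ρ j) (ρ j * ρ i)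
  | rho_lam_comm (i j : ℕ) (hi : i + 1 < n) (hj : j + 1 < n) (hij : i + 1 < j ∨ j + 1 < i) :
      Relations n (ρ i * lm j) (lm j * ρ i)
  | lam_rho_succ₁ (i : ℕ) (hi : i + 2 < n) :
      Relations n (lm i * ρ (i + 1)) (σ (i + 1) * ρ i * lm i * e (i + 2))
  | lam_rho_succ₂ (i : ℕ) (hi : i + 2 < n) :
      Relations n (σ (i + 1) * ρ i * lm i * e (i + 2)) (σ i * ρ (i + 1) * σ i * lm i)
  | lam_succ_rho₁ (i : ℕ) (hi : i + 2 < n) :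
      Relations n (lm (i + 1) * ρ i) (e (i + 2) * ρ i * lm i * σ (i + 1))
  | lam_succ_rho₂ (i : ℕ) (hi : i + 2 < n) :
      Relations n (e (i + 2) * ρ i * lm i * σ (i + 1)) (ρ i * σ i * lm (i + 1) * σ i)
  | rho_lam_succ (i : ℕ) (hi : i + 2 < n) :
      Relations n (ρ i * lm (i + 1)) (ρ i * e (i + 2))
  | rho_succ_lam (i : ℕ) (hi : i + 2 < n) :
      Relations n (ρ (i + 1) * lm i) (e (i + 2) * lm i)
  | lam_inverse (i : ℕ) (hi : i + 1 < n) : Relations n (lm i * ρ i * lm i) (lm i)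
  | rho_inverse (i : ℕ) (hi : i + 1 < n) : Relations n (ρ i * lm i * ρ i) (ρ i)
  | sigma_lam_sigma (i j : ℕ) (hi : i + 1 < n) (hj : j + 1 < n) (hij : i + 1 = j ∨ j + 1 = i) :
      Relations n (σ i * lm j * σ i) (σ j * lm i * σ j)
  | sigma_rho_sigma (i j : ℕ) (hi : i + 1 < n) (hj : j + 1 < n) (hij : i + 1 = j ∨ j + 1 = i) :
      Relations n (σ i * ρ j * σ i) (σ j * ρ i * σ j)
  | lam_sigma (i : ℕ) (hi : i + 1 < n) : Relations n (lm i * σ i) (lm i)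
  | sigma_rho (i : ℕ) (hi : i + 1 < n) : Relations n (σ i * ρ i) (ρ i)
  | sigma_lam_comm (i j : ℕ) (hi : i + 1 < n) (hj : j + 1 < n) (hij : i + 1 < j ∨ j + 1 < i) :
      Relations n (σ i * lm j) (lm j * σ i)
  | sigma_rho_comm (i j : ℕ) (hi : i + 1 < n) (hj : j + 1 < n) (hij : i + 1 < j ∨ j + 1 < i) :
      Relations n (σ i * ρ j) (ρ j * σ i)
  | lam_lam_succ₁ (i : ℕ) (hi : i + 2 < n) :
      Relations n (lm i * lm (i + 1)) (lm i * lm (i + 1) * σ i)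
  | lam_lam_succ₂ (i : ℕ) (hi : i + 2 < n) :
      Relations n (lm i * lm (i + 1) * σ i) (σ (i + 1) * lm i * lm (i + 1))
  | rho_succ_rho₁ (i : ℕ) (hi : i + 2 < n) :
      Relations n (ρ (i + 1) * ρ i) (σ i * ρ (i + 1) * ρ i)
  | rho_succ_rho₂ (i : ℕ) (hi : i + 2 < n) :
      Relations n (σ i * ρ (i + 1) * ρ i) (ρ (i + 1) * ρ i * σ (i + 1))
  | lam_succ_lam₁ (i : ℕ) (hi : i + 2 < n) :
      Relations n (σ (i + 1) * lm (i + 1) * lm i) (lm (i + 1) * lm i)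
  | lam_succ_lam₂ (i : ℕ) (hi : i + 2 < n) :
      Relations n (lm (i + 1) * lm i) (lm i * e (i + 2))
  | rho_rho_succ₁ (i : ℕ) (hi : i + 2 < n) :
      Relations n (ρ i * ρ (i + 1) * σ (i + 1)) (ρ i * ρ (i + 1))
  | rho_rho_succ₂ (i : ℕ) (hi : i + 2 < n) :
      Relations n (ρ i * ρ (i + 1)) (e (i + 2) * ρ i)
  | e_succ (i : ℕ) (hi : i + 1 < n) : Relations n (e (i + 1)) (lm i * ρ i)
  | e_zero (hn : 1 < n) : Relations n (e 0) (σ 0 * e 1 * σ 0)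
  | e_sq (i : ℕ) (hi : i < n) : Relations n (e i * e i) (e i)
  | e_e_succ (i : ℕ) (hi : i + 1 < n) : Relations n (e i * e (i + 1)) (e (i + 1) * e i)
  | lam_sq (i : ℕ) (hi : i + 1 < n) : Relations n (e (i + 1) * e i) (lm i * lm i)
  | lam_sq_rho_sq (i : ℕ) (hi : i + 1 < n) : Relations n (lm i * lm i) (ρ i * ρ i)
  | rho_sigma_lam (i : ℕ) (hi : i + 1 < n) : Relations n (ρ i * ρ i) (ρ i * σ i * lm i)
  | e_sigma_comm (i j : ℕ) (hi : i < n) (hj : j + 1 < n) (hij : i ≠ j) (hij' : i ≠ j + 1) :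
      Relations n (e i * σ j) (σ j * e i)
  | e_sigma (i : ℕ) (hi : i + 1 < n) : Relations n (e i * σ i) (σ i * e (i + 1))
  | sigma_e (i : ℕ) (hi : i + 1 < n) : Relations n (σ i * e i) (e (i + 1) * σ i)
  | e_lam_comm (i j : ℕ) (hi : i < n) (hj : j + 1 < n) (hij : i ≠ j) (hij' : i ≠ j + 1) :
      Relations n (e i * lm j) (lm j * e i)
  | e_succ_lam (i : ℕ) (hi : i + 1 < n) : Relations n (e (i + 1) * lm i) (lm i)
  | e_lam₁ (i : ℕ) (hi : i + 1 < n) : Relations n (e i * lm i) (lm i * e (i + 1))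
  | e_lam₂ (i : ℕ) (hi : i + 1 < n) : Relations n (lm i * e (i + 1)) (lm i * e i)
  | e_lam₃ (i : ℕ) (hi : i + 1 < n) : Relations n (lm i * e i) (e i * e (i + 1))
  | e_rho_comm (i j : ℕ) (hi : i < n) (hj : j + 1 < n) (hij : i ≠ j) (hij' : i ≠ j + 1) :
      Relations n (e i * ρ j) (ρ j * e i)
  | rho_e_succ (i : ℕ) (hi : i + 1 < n) : Relations n (ρ i * e (i + 1)) (ρ i)
  | e_rho₁ (i : ℕ) (hi : i + 1 < n) : Relations n (ρ i * e i) (e (i + 1) * ρ i)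
  | e_rho₂ (i : ℕ) (hi : i + 1 < n) : Relations n (e (i + 1) * ρ i) (e i * ρ i)
  | e_rho₃ (i : ℕ) (hi : i + 1 < n) : Relations n (e i * ρ i) (e i * e (i + 1))

/-- The abstract monoid given by the generators and the defining relations. -/
abbrev S (n : ℕ) : Type := PresentedMonoid (Relations n)

/-- The class in `S n` of a generator. -/
def gen (g : Gen n) : S n := PresentedMonoid.of (Relations n) g

end PIPPresentation

/-! A diagram is faithfully encoded by the pairs (u, v) of Boolean functions on its two columns that
are constant on its lines and vanish on its points (`PIP.ext_sat`). Under this encoding the product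
becomes composition of relations (`PIP.sat_mul`). Each generator becomes a partial function u ↦ v,
so the defining relations are checked by comparing domains and values; this gives the homomorphism
`toPIP`.

Injectivity rests on a normal form in the presented monoid. The σ_i satisfy the Coxeter relations,
so the symmetric group maps into `S n`. Conjugating ρ_0 and e_0 gives elements ρ_{x,y} and e_x for
arbitrary points, and a relation stated for small indices spreads to all tuples of distinct points.
Reversing words and exchanging λ with ρ is an anti-automorphism `star`, which supplies λ_{x,y} =
star ρ_{x,y}. The interface obtained this way is `Frame`.

Every λ_{x,y} can be moved to the right past permutations, e's and ρ's, unless it disappears on the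
way. Hence each element is r · star l, with r and l words in permutations, e's and ρ's
(`isProduct`). Such a word collapses to R f · π g, where the partial retraction f records a
partition of part of the left column together with class representatives. So every element is R f ·
π g · star (R h), and classes that have no partner across g can be killed until g matches the
representatives of h with those of f (`Frame.exists_normalForm`).

The diagram of a normal form determines the classes of f and h and the bijection between them. What
is left free is the choice of representatives, which permutations compensate (`Frame.exists_R_eq`),
and the values of g away from representatives, which R f absorbs (`Frame.R_mul_π_of_fix`). Hence
`normalForm_eq`, and with it injectivity. Conversely, the traces of the lines of any diagram on the
two columns provide f, h and g, which gives surjectivity. -/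

namespace IP

/-! ### Diagrams as relations between Boolean functions. -/

variable {Y : Type*}

/-- The function `U` on the left column and `V` on the right column together are constant on the
blocks of `a`. -/
def Sat (a : IP Y) (U V : Y → Bool) : Prop :=
  ∀ p q, a.rel p q → Sum.elim U V p = Sum.elim U V q

/-- Every middle vertex m lies on a line of `a` and so is joined to some left vertex k m. This
forces the middle function to be U ∘ k, and constancy on the blocks of the product makes that choice
consistent. -/
theorem sat_mul (a b : IP Y) (U W : Y → Bool) :
    (a * b).Sat U W ↔ ∃ V, a.Sat U V ∧ b.Sat V W := by
  constructor
  · intro h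
    choose k hk using fun m : Y => (a.line (Sum.inr m)).1
    have e : ∀ m, joint a b (Sum.inr (Sum.inl m)) (Sum.inl (k m)) := fun m =>
      joint_left a b (hk m)
    have key : ∀ p q, joint a b p q → Sum.elim U (Sum.elim (fun m => U (k m)) W) p =
        Sum.elim U (Sum.elim (fun m => U (k m)) W) q := by
      have h' : ∀ u v, joint a b (leftRight u) (leftRight v) → Sum.elim U W u = Sum.elim U W v := h
      have c : ∀ p, ∃ u, joint a b p (leftRight u) ∧
          Sum.elim U (Sum.elim (fun m => U (k m)) W) p = Sum.elim U W u := by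
        rintro (x | x | x)
        · exact ⟨Sum.inl x, (joint a b).refl' _, rfl⟩
        · exact ⟨Sum.inl (k x), e x, rfl⟩
        · exact ⟨Sum.inr x, (joint a b).refl' _, rfl⟩
      intro p q hpq
      obtain ⟨u, hu, hu'⟩ := c p
      obtain ⟨v, hv, hv'⟩ := c q
      rw [hu', hv']
      exact h' _ _ ((joint a b).trans' ((joint a b).symm' hu) ((joint a b).trans' hpq hv))
    refine ⟨fun m => U (k m), ?_, ?_⟩
    · rintro (x | x) (y | y) hxy <;> exact key _ _ (joint_left a b hxy)
    · rintro (x | x) (y | y) hxy <;> exact key _ _ (joint_right a b hxy)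
  · rintro ⟨V, ha, hb⟩ p q hpq
    have := joint_le a b (Setoid.ker (Sum.elim U (Sum.elim V W)))
      (by rintro (x | x) (y | y) hxy <;> exact ha _ _ hxy)
      (by rintro (x | x) (y | y) hxy <;> exact hb _ _ hxy) hpq
    rcases p with p | p <;> rcases q with q | q <;> exact this

end IP

namespace PIP

variable {X : Type*}

/-- The function `u` on the left column and `v` on the right column together are constant on the
lines of `a` and vanish on the points of `a`. -/
def Sat (a : PIP X) (u v : X → Bool) : Prop :=
  (∀ p q, a.rel p q → Sum.elim u v p = Sum.elim u v q) ∧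
    ∀ p, a.IsPoint p → Sum.elim u v p = false

/-- Extension by `false` to the additional element. -/
def extFalse (u : X → Bool) : Option X → Bool := fun x => x.elim false u

/-- The additional block carries the value `false`, and it swallows exactly the points; hence
vanishing on points becomes constancy on that block. -/
theorem sat_iff_extend (a : PIP X) (u v : X → Bool) :
    a.Sat u v ↔ a.extend.1.Sat (extFalse u) (extFalse v) := by
  have hm : ∀ p : X ⊕ X, Sum.elim (extFalse u) (extFalse v) (Sum.map some some p) =
      Sum.elim u v p := by rintro (p | p) <;> rfl
  have hs : ∀ w : Option X ⊕ Option X, (∃ p : X ⊕ X, w = Sum.map some some p) ∨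
      (a.blockOf w = none ∧ Sum.elim (extFalse u) (extFalse v) w = false) := by
    rintro ((_ | x) | (_ | x))
    · exact Or.inr ⟨rfl, rfl⟩
    · exact Or.inl ⟨Sum.inl x, rfl⟩
    · exact Or.inr ⟨rfl, rfl⟩
    · exact Or.inl ⟨Sum.inr x, rfl⟩
  constructor
  · rintro ⟨h1, h2⟩ p q hpq
    change a.blockOf p = a.blockOf q at hpq
    rcases hs p with ⟨p, rfl⟩ | ⟨hp, hp'⟩ <;> rcases hs q with ⟨q, rfl⟩ | ⟨hq, hq'⟩
    · rw [blockOf_map, blockOf_map, lineOf_eq_iff] at hpq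
      rw [hm, hm]
      rcases hpq with ⟨hp, hq⟩ | h
      · rw [h2 p hp, h2 q hq]
      · exact h1 p q h
    · rw [hq, blockOf_map, lineOf_eq_none] at hpq
      rw [hm, hq', h2 p hpq]
    · rw [hp, eq_comm, blockOf_map, lineOf_eq_none] at hpq
      rw [hm, hp', h2 q hpq]
    · rw [hp', hq']
  · intro h
    refine ⟨fun p q hpq => ?_, fun p hp => ?_⟩
    · rw [← hm, ← hm]
      apply h
      change a.blockOf _ = a.blockOf _
      rw [blockOf_map, blockOf_map]
      exact a.lineOf_eq_of_rel hpq
    · rw [← hm]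
      refine h (Sum.map some some p) (Sum.inl none) ?_
      change a.blockOf _ = a.blockOf _
      rw [blockOf_map, (a.lineOf_eq_none p).2 hp]
      rfl

theorem extend_mul (a b : PIP X) : extend (a * b) = extend a * extend b :=
  extend_restrict _

theorem extend_one : extend (1 : PIP X) = 1 := extend_restrict _

theorem sat_mul (a b : PIP X) (u w : X → Bool) :
    (a * b).Sat u w ↔ ∃ v, a.Sat u v ∧ b.Sat v w := by
  simp only [sat_iff_extend, extend_mul, Submonoid.coe_mul, IP.sat_mul]
  constructor
  · rintro ⟨V, h1, h2⟩
    -- The middle function vanishes at `none`, since `none` and `none'` share a block of `extend a`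
    -- and the left function is `false` there.
    have : extFalse (fun x => V (some x)) = V := by
      funext x
      rcases x with _ | x
      · exact h1 (Sum.inl none) (Sum.inr none) a.extend.2
      · rfl
    exact ⟨fun x => V (some x), by rwa [this], by rwa [this]⟩
  · rintro ⟨v, h1, h2⟩
    exact ⟨_, h1, h2⟩

theorem sat_one (u v : X → Bool) : (1 : PIP X).Sat u v ↔ v = u := by
  rw [sat_iff_extend, extend_one]
  constructor
  · intro h
    funext x
    exact (h (Sum.inl (some x)) (Sum.inr (some x)) rfl).symm
  · rintro rfl
    rintro (x | x) (y | y) (h : x = y) <;> subst h <;> rfl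

/-- The witness is the indicator function of the line through p. These test functions separate
diagrams. -/
theorem exists_sat_of_not_isPoint (a : PIP X) (p : X ⊕ X) (hp : ¬ a.IsPoint p) :
    ∃ u v, a.Sat u v ∧ ∀ q, Sum.elim u v q = true ↔ a.rel p q := by
  classical
  have e : ∀ r, Sum.elim (fun x => decide (a.rel p (Sum.inl x)))
      (fun x => decide (a.rel p (Sum.inr x))) r = decide (a.rel p r) := by
    rintro (r | r) <;> rfl
  refine ⟨fun x => decide (a.rel p (Sum.inl x)), fun x => decide (a.rel p (Sum.inr x)),
    ⟨fun r s hrs => ?_, fun r hr => ?_⟩, fun q => ?_⟩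
  · rw [e, e, decide_eq_decide]
    exact ⟨fun h => a.rel.trans' h hrs, fun h => a.rel.trans' h (a.rel.symm' hrs)⟩
  · rw [e, decide_eq_false_iff_not]
    exact fun hpr => hp (by rwa [hr p hpr])
  · rw [e, decide_eq_true_iff]

/-- A decomposition is determined by the functions that are constant on its lines and vanish on its
points. -/
theorem ext_sat {a b : PIP X} (h : ∀ u v, a.Sat u v ↔ b.Sat u v) : a = b := by
  have key : ∀ {a b : PIP X}, (∀ u v, a.Sat u v ↔ b.Sat u v) → ∀ p q,
      b.rel p q → a.rel p q := by
    intro a b h p q hb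
    by_cases hp : a.IsPoint p
    · by_cases hp' : b.IsPoint p
      · rw [hp' q (b.rel.symm' hb)]
      -- The indicator of the line of `b` through p is nonzero at p, which is impossible for a point
      -- of `a`.
      · obtain ⟨u, v, hs, huv⟩ := b.exists_sat_of_not_isPoint p hp'
        have h1 := (huv p).2 (b.rel.refl' p)
        rw [((h u v).2 hs).2 p hp] at h1
        cases h1
    · obtain ⟨u, v, hs, huv⟩ := a.exists_sat_of_not_isPoint p hp
      rw [← huv, ← ((h u v).1 hs).1 p q hb, huv]
  exact PIP.ext (Setoid.ext fun p q => ⟨key (fun u v => (h u v).symm) p q, key h p q⟩)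

/-- For a decomposition given by a labelling of the vertices, where `none` labels the points. -/
theorem sat_iff_of_label (a : PIP X) (F G : X → Option X)
    (hpt : ∀ p, a.IsPoint p ↔ Sum.elim F G p = none)
    (hr : ∀ p q, Sum.elim F G p ≠ none → (a.rel p q ↔ Sum.elim F G p = Sum.elim F G q))
    (u v : X → Bool) :
    a.Sat u v ↔ ∃ k : X → Bool,
      (∀ x, u x = (F x).elim false k) ∧ ∀ x, v x = (G x).elim false k := by
  classical
  constructor
  · rintro ⟨h1, h2⟩
    -- The value attached to a label is the common value on the vertices that carry it, and `false`
    -- for a label that does not occur.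
    refine ⟨fun y => decide (∃ p, Sum.elim F G p = some y ∧ Sum.elim u v p = true), ?_⟩
    have key : ∀ p, Sum.elim u v p = (Sum.elim F G p).elim false
        (fun y => decide (∃ p, Sum.elim F G p = some y ∧ Sum.elim u v p = true)) := by
      intro p
      rcases hp : Sum.elim F G p with _ | y
      · exact h2 p ((hpt p).2 hp)
      · change _ = decide _
        rw [eq_comm, Bool.eq_iff_iff, decide_eq_true_iff]
        constructor
        · rintro ⟨q, hq, hq'⟩
          rwa [h1 p q ((hr p q (by simp [hp])).2 (hp.trans hq.symm))]
        · exact fun h => ⟨p, hp, h⟩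
    exact ⟨fun x => key (Sum.inl x), fun x => key (Sum.inr x)⟩
  · rintro ⟨k, h1, h2⟩
    have key : ∀ p, Sum.elim u v p = (Sum.elim F G p).elim false k := by
      rintro (x | x)
      · exact h1 x
      · exact h2 x
    refine ⟨fun p q hpq => ?_, fun p hp => ?_⟩
    · by_cases hp : Sum.elim F G p = none
      · rw [(hpt p).2 hp q (a.rel.symm' hpq)]
      · rw [key, key, (hr p q hp).1 hpq]
    · rw [key, (hpt p).1 hp]
      rfl

variable [DecidableEq X]

/-- For each kind of generator the relation is the graph of a partial function: a condition on u,
and v determined by u. Composition of words then reduces to substitution. -/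
theorem sat_s (x y : X) (u v : X → Bool) :
    (s x y).Sat u v ↔ v = fun t => u (Equiv.swap x y t) := by
  constructor
  · intro h
    funext t
    exact h.1 (Sum.inr t) (Sum.inl (Equiv.swap x y t)) rfl
  · rintro rfl
    refine ⟨?_, ?_⟩
    · rintro (p | p) (q | q) h <;> exact congrArg u h
    · rintro (p | p) hp
      · exact absurd (hp (Sum.inr (Equiv.swap x y p)) (Equiv.swap_apply_self x y p)) (by simp)
      · exact absurd (hp (Sum.inl (Equiv.swap x y p)) rfl) (by simp)

theorem sat_eps (x : X) (u v : X → Bool) : (eps x).Sat u v ↔ u x = false ∧ v = u := by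
  have hp : ∀ p : X ⊕ X, Sum.elim id id p = x → (eps x).IsPoint p := by
    rintro p hp v (h | ⟨h, h'⟩)
    · exact h
    · exact absurd (h.trans hp) h'
  constructor
  · intro h
    have hx : u x = false := h.2 (Sum.inl x) (hp _ rfl)
    refine ⟨hx, funext fun t => ?_⟩
    by_cases ht : t = x
    · subst ht
      exact (h.2 (Sum.inr t) (hp _ rfl)).trans hx.symm
    · exact h.1 (Sum.inr t) (Sum.inl t) (Or.inr ⟨rfl, ht⟩)
  · rintro ⟨hx, rfl⟩
    have e : ∀ p : X ⊕ X, Sum.elim v v p = v (Sum.elim id id p) := by rintro (p | p) <;> rfl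
    refine ⟨?_, fun p hpt => ?_⟩
    · rintro p q (rfl | ⟨h, -⟩)
      · rfl
      · rw [e, e, h]
    · by_cases hpx : Sum.elim id id p = x
      · rw [e, hpx, hx]
      · exfalso
        rcases p with p | p
        · exact absurd (hpt (Sum.inr p) (Or.inr ⟨rfl, hpx⟩)) (by simp)
        · exact absurd (hpt (Sum.inl p) (Or.inr ⟨rfl, hpx⟩)) (by simp)

theorem sat_r {x y : X} (hxy : x ≠ y) (u v : X → Bool) :
    (r x y).Sat u v ↔ u x = u y ∧ v = Function.update u y false := by
  rw [sat_iff_of_label (r x y) (fun t => if t = y then some x else some t)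
    (fun t => if t = y then none else some t)]
  · constructor
    · rintro ⟨k, h1, h2⟩
      have hx := h1 x
      have hy := h1 y
      simp only [hxy, if_false, if_true, Option.elim_some] at hx hy
      refine ⟨hx.trans hy.symm, funext fun t => ?_⟩
      have := h1 t
      by_cases ht : t = y <;> simp_all
    · rintro ⟨h, rfl⟩
      refine ⟨u, fun t => ?_, fun t => ?_⟩ <;> by_cases ht : t = y <;> simp_all
  · intro p
    constructor
    · intro hp
      by_contra hn
      rcases p with p | p
      · have := hp (Sum.inr (if p = y then x else p)) (by
          change Sum.elim _ _ _ = Sum.elim _ _ _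
          by_cases h : p = y <;> simp [h, hxy])
        simp at this
      · have hpy : p ≠ y := fun h => hn (by simp [h])
        have := hp (Sum.inl p) (by
          change Sum.elim _ _ _ = Sum.elim _ _ _
          simp [hpy])
        simp at this
    · intro hp v hv
      change Sum.elim _ _ _ = Sum.elim _ _ _ at hv
      rw [hp] at hv
      rcases p with p | p <;> rcases v with v | v <;>
        by_cases hpy : p = y <;> by_cases hvy : v = y <;> simp_all
  · intro p q _
    rfl

theorem sat_l {x y : X} (hxy : x ≠ y) (u v : X → Bool) :
    (l x y).Sat u v ↔ u y = false ∧ v = Function.update u y (u x) := by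
  rw [sat_iff_of_label (l x y) (fun t => if t = y then none else some t)
    (fun t => if t = y then some x else some t)]
  · constructor
    · rintro ⟨k, h1, h2⟩
      have hx := h1 x
      have hy := h1 y
      simp only [hxy, if_false, if_true, Option.elim_some, Option.elim_none] at hx hy
      refine ⟨hy, funext fun t => ?_⟩
      have := h1 t
      by_cases ht : t = y <;> simp_all
    · rintro ⟨h, rfl⟩
      refine ⟨u, fun t => ?_, fun t => ?_⟩ <;> by_cases ht : t = y <;> simp_all
  · intro p
    constructor
    · intro hp
      by_contra hn
      rcases p with p | p
      · have hpy : p ≠ y := fun h => hn (by simp [h])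
        have := hp (Sum.inr p) (by
          change Sum.elim _ _ _ = Sum.elim _ _ _
          simp [hpy])
        simp at this
      · have := hp (Sum.inl (if p = y then x else p)) (by
          change Sum.elim _ _ _ = Sum.elim _ _ _
          by_cases h : p = y <;> simp [h, hxy])
        simp at this
    · intro hp v hv
      change Sum.elim _ _ _ = Sum.elim _ _ _ at hv
      rw [hp] at hv
      rcases p with p | p <;> rcases v with v | v <;>
        by_cases hpy : p = y <;> by_cases hvy : v = y <;> simp_all
  · intro p q _
    rfl

end PIP

/-! ### The defining relations hold for the diagrams. -/

namespace PIPPresentation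

variable {n : ℕ}

/-- The decomposition assigned to a generator. -/
def genImage : Gen n → PIP (Fin n)
  | Gen.sigma i h => PIP.s ⟨i, by omega⟩ ⟨i + 1, h⟩
  | Gen.lam i h => PIP.l ⟨i, by omega⟩ ⟨i + 1, h⟩
  | Gen.rho i h => PIP.r ⟨i, by omega⟩ ⟨i + 1, h⟩
  | Gen.e i h => PIP.eps ⟨i, h⟩

open PIP in
theorem sat_genImage_sigma (i : ℕ) (h : i + 1 < n) (u v : Fin n → Bool) :
    (FreeMonoid.lift genImage (σ i h)).Sat u v ↔
      v = fun t =>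
        if t.1 = i then u ⟨i+1, h⟩ else if t.1 = i + 1 then u ⟨i, by omega⟩ else u t := by
  rw [σ, FreeMonoid.lift_eval_of, genImage, sat_s]
  have : (fun t => u (Equiv.swap (⟨i, by omega⟩ : Fin n) ⟨i + 1, h⟩ t)) =
      fun t => if t.1 = i then u ⟨i+1, h⟩ else if t.1 = i + 1 then u ⟨i, by omega⟩ else u t := by
    funext t
    simp only [Equiv.swap_apply_def, Fin.ext_iff]
    split_ifs <;> rfl
  rw [this]

open PIP in
theorem sat_genImage_lam (i : ℕ) (h : i + 1 < n) (u v : Fin n → Bool) :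
    (FreeMonoid.lift genImage (lm i h)).Sat u v ↔ u ⟨i+1, h⟩ = false ∧ v =
        fun t => if t.1 = i + 1 then u ⟨i, by omega⟩ else u t := by
  rw [lm, FreeMonoid.lift_eval_of, genImage, sat_l (by simp)]
  refine and_congr_right fun _ => ?_
  have : Function.update u ⟨i + 1, h⟩ (u ⟨i, by omega⟩) =
      fun t => if t.1 = i + 1 then u ⟨i, by omega⟩ else u t := by
    funext t
    simp only [Function.update_apply, Fin.ext_iff]
  rw [this]

open PIP in
theorem sat_genImage_rho (i : ℕ) (h : i + 1 < n) (u v : Fin n → Bool) :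
    (FreeMonoid.lift genImage (ρ i h)).Sat u v ↔ u ⟨i, by omega⟩ = u ⟨i + 1, h⟩ ∧ v =
        fun t => if t.1 = i + 1 then false else u t := by
  rw [ρ, FreeMonoid.lift_eval_of, genImage, sat_r (by simp)]
  refine and_congr_right fun _ => ?_
  have : Function.update u ⟨i + 1, h⟩ false = fun t => if t.1 = i + 1 then false else u t := by
    funext t
    simp only [Function.update_apply, Fin.ext_iff]
  rw [this]

open PIP in
theorem sat_genImage_e (i : ℕ) (h : i < n) (u v : Fin n → Bool) :
    (FreeMonoid.lift genImage (e i h)).Sat u v ↔ u ⟨i, h⟩ = false ∧ v = u := by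
  rw [e, FreeMonoid.lift_eval_of, genImage, sat_eps]

theorem sat_map_mul (a b : FreeMonoid (Gen n)) (u w : Fin n → Bool) :
    (FreeMonoid.lift genImage (a * b)).Sat u w ↔
        ∃ v, (FreeMonoid.lift genImage a).Sat u v ∧ (FreeMonoid.lift genImage b).Sat v w := by
  rw [map_mul, PIP.sat_mul]

/-- Two partial functions agree if their domains agree and their values agree on the domain; outside
it f and g may differ. -/
theorem and_eq_iff_and_eq {α : Type*} {β : Type*} {P Q : Prop} {f g v : α → β} (h : P ↔ Q)
    (hfg : P → ∀ t, f t = g t) : (P ∧ v = f) ↔ (Q ∧ v = g) :=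
  ⟨fun ⟨hP, hv⟩ => ⟨h.1 hP, hv.trans (funext (hfg hP))⟩,
    fun ⟨hQ, hv⟩ => ⟨h.2 hQ, hv.trans (funext (hfg (h.2 hQ))).symm⟩⟩

theorem eq_iff_eq {α : Type*} {β : Type*} {f g v : α → β} (hfg : ∀ t, f t = g t) :
    v = f ↔ v = g := by rw [funext hfg]

theorem genImage_relations (a b : FreeMonoid (Gen n)) (h : Relations n a b) :
    FreeMonoid.lift genImage a = FreeMonoid.lift genImage b := by
  refine PIP.ext_sat fun u v => ?_
  -- Replacing u by a function on ℕ removes the bounds on indices from the case analysis; its values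
  -- beyond n play no role.
  obtain ⟨u, rfl⟩ : ∃ U : ℕ → Bool, u = fun t => U t.1 :=
    ⟨fun k => if h : k < n then u ⟨k, h⟩ else false, by simp⟩
  cases h
  all_goals
    simp only [sat_map_mul, map_one, PIP.sat_one, sat_genImage_sigma, sat_genImage_lam,
      sat_genImage_rho, sat_genImage_e, exists_eq_left, and_assoc, exists_and_left]
  all_goals first
    | (((try simp only [← and_assoc]); apply and_eq_iff_and_eq) <;> grind)
    | (apply eq_iff_eq; grind)

end PIPPresentation

/-! ### The Coxeter presentation of the symmetric group. -/

namespace SymmetricPresentation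

open Equiv

variable {M : Type*} [Monoid M]

/-- The product `t_{m-1} t_{m-2} ⋯ t_{m-k}`. -/
def descending (t : ℕ → M) (m : ℕ) : ℕ → M
  | 0 => 1
  | k + 1 => descending t m k * t (m - (k + 1))

/-- The descending products serve as coset representatives of ⟨t_0, …, t_{m-1}⟩ in ⟨t_0, …, t_m⟩. It
suffices that right multiplication by a generator preserves the form w · (descending product). -/
theorem exists_mul_descending (t : ℕ → M) (m : ℕ) (h1 : ∀ i < m + 1, t i * t i = 1)
    (h2 : ∀ i j, i < m + 1 → j < m + 1 → i + 1 < j → t i * t j = t j * t i)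
    (h3 : ∀ i, i + 1 < m + 1 → t i * t (i + 1) * t i = t (i + 1) * t i * t (i + 1))
    (a : M) (ha : a ∈ Submonoid.closure (t '' Set.Iio (m + 1))) :
    ∃ k ≤ m + 1, ∃ w ∈ Submonoid.closure (t '' Set.Iio m), a = w * descending t (m + 1) k := by
  have comm : ∀ i k, k ≤ m + 1 → i + 1 + k < m + 1 →
      descending t (m + 1) k * t i = t i * descending t (m + 1) k := by
    intro i k hk hi
    induction k with
    | zero => simp [descending]
    | succ k ih =>
      rw [descending, mul_assoc, ← h2 i (m + 1 - (k + 1)) (by omega) (by omega) (by omega),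
        ← mul_assoc, ih (by omega) (by omega), mul_assoc]
  have shift : ∀ i k, k ≤ m + 1 → i < m + 1 → m + 1 < i + k →
      descending t (m + 1) k * t i = t (i - 1) * descending t (m + 1) k := by
    intro i k hk hi hik
    induction k with
    | zero => omega
    | succ k ih =>
      by_cases h : m + 1 < i + k
      · rw [descending, mul_assoc, h2 (m + 1 - (k + 1)) i (by omega) (by omega) (by omega),
          ← mul_assoc, ih (by omega) h, mul_assoc]
      -- Here the descending product ends in t_i t_{i-1}. The braid relation turns t_i t_{i-1} t_i
      -- into t_{i-1} t_i t_{i-1}, and the first t_{i-1} commutes with everything before it.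
      · obtain ⟨k, rfl⟩ : ∃ l, k = l + 1 := ⟨k - 1, by omega⟩
        have e1 : m + 1 - (k + 1) = i := by omega
        have e2 : m + 1 - (k + 1 + 1) = i - 1 := by omega
        have b := h3 (i - 1) (by omega)
        rw [show i - 1 + 1 = i by omega] at b
        rw [descending, descending, e1, e2, mul_assoc, mul_assoc, ← mul_assoc (t i), ← b,
          ← mul_assoc, ← mul_assoc, comm (i - 1) k (by omega) (by omega)]
        simp only [mul_assoc]
  induction ha using Submonoid.closure_induction_right with
  | one => exact ⟨0, by omega, 1, one_mem _, by simp [descending]⟩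
  | mul_right x hx y hy ih =>
    obtain ⟨k, hk, w, hw, rfl⟩ := ih
    obtain ⟨i, hi, rfl⟩ := hy
    rw [Set.mem_Iio] at hi
    have mem : ∀ j < m, t j ∈ Submonoid.closure (t '' Set.Iio m) := fun j hj =>
      Submonoid.subset_closure ⟨j, hj, rfl⟩
    -- The last factor of the product has index m + 1 - k. A smaller t_i passes through unchanged if
    -- i < m - k and lengthens the product if i = m - k; equal index cancels; a larger t_i passes
    -- through as t_{i-1}.
    rcases lt_trichotomy (i + k) m with h | h | h
    · exact ⟨k, hk, w * t i, mul_mem hw (mem i (by omega)), by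
        rw [mul_assoc, comm i k hk (by omega), mul_assoc]⟩
    · refine ⟨k + 1, by omega, w, hw, ?_⟩
      rw [descending, mul_assoc, show m + 1 - (k + 1) = i by omega]
    · by_cases h' : i + k = m + 1
      · obtain ⟨k, rfl⟩ : ∃ l, k = l + 1 := ⟨k - 1, by omega⟩
        refine ⟨k, by omega, w, hw, ?_⟩
        rw [descending, show m + 1 - (k + 1) = i by omega, mul_assoc, mul_assoc, h1 i hi, mul_one]
      · exact ⟨k, hk, w * t (i - 1), mul_mem hw (mem _ (by omega)), by
          rw [mul_assoc, shift i k hk (by omega) (by omega), mul_assoc]⟩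

/-- The adjacent transposition of `i` and `i + 1`. -/
def adj (N i : ℕ) : Perm (Fin (N + 1)) :=
  if h : i < N then swap ⟨i, by omega⟩ ⟨i + 1, by omega⟩ else 1

theorem adj_apply {N i : ℕ} (hi : i < N) (x : Fin (N + 1)) :
    (adj N i x : ℕ) = if x.1 = i then i + 1 else if x.1 = i + 1 then i else x.1 := by
  rw [adj, dif_pos hi, swap_apply_def]
  simp only [Fin.ext_iff]
  split_ifs <;> rfl

theorem adj_sq {N i : ℕ} (hi : i < N) : adj N i * adj N i = 1 := by
  ext x
  simp only [Perm.mul_apply, adj_apply hi, Perm.one_apply]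
  grind

theorem adj_comm {N i j : ℕ} (hi : i < N) (hj : j < N) (hij : i + 1 < j) :
    adj N i * adj N j = adj N j * adj N i := by
  ext x
  simp only [Perm.mul_apply, adj_apply hi, adj_apply hj]
  grind

theorem adj_braid {N i : ℕ} (hi : i + 1 < N) :
    adj N i * adj N (i + 1) * adj N i = adj N (i + 1) * adj N i * adj N (i + 1) := by
  have hi' : i < N := by omega
  ext x
  simp only [Perm.mul_apply, adj_apply hi, adj_apply hi']
  grind

/-- Write the element as w times a descending product of length k. Its permutation part sends m + 1
- k to m + 1, which w fixes, so a trivial permutation forces k = 0 and the element already lies in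
the smaller closure. -/
theorem eq_one_of_mem_closure {N : ℕ} (s : ℕ → M) (h1 : ∀ i < N, s i * s i = 1)
    (h2 : ∀ i j, i < N → j < N → i + 1 < j → s i * s j = s j * s i)
    (h3 : ∀ i, i + 1 < N → s i * s (i + 1) * s i = s (i + 1) * s i * s (i + 1))
    (m : ℕ) (hm : m ≤ N) (a : M)
    (ha : ((1, a) : Perm (Fin (N + 1)) × M) ∈
      Submonoid.closure ((fun i => (adj N i, s i)) '' Set.Iio m)) : a = 1 := by
  induction m with
  | zero =>
    simp at ha
    exact ha
  | succ m ih =>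
    set t : ℕ → Perm (Fin (N + 1)) × M := fun i => (adj N i, s i) with ht
    obtain ⟨k, hk, w, hw, e⟩ := exists_mul_descending t m
      (fun i hi => Prod.ext (adj_sq (by omega)) (h1 i (by omega)))
      (fun i j hi hj hij => Prod.ext (adj_comm (by omega) (by omega) hij)
        (h2 i j (by omega) (by omega) hij))
      (fun i hi => Prod.ext (adj_braid (by omega)) (h3 i (by omega))) _ ha
    have fix : ∀ x : Fin (N + 1), m < x.1 → w.1 x = x := by
      intro x hx
      clear e
      induction hw using Submonoid.closure_induction with
      | mem y hy =>
        obtain ⟨i, hi, rfl⟩ := hy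
        rw [Set.mem_Iio] at hi
        ext
        rw [adj_apply (by omega)]
        grind
      | one => rfl
      | mul y z _ _ hy hz => rw [Prod.fst_mul, Perm.mul_apply, hz, hy]
    have top : ∀ l ≤ m + 1, ∀ x : Fin (N + 1), x.1 = m + 1 - l →
        ((descending t (m + 1) l).1 x : ℕ) = m + 1 := by
      intro l hl
      induction l with
      | zero => intro x hx; simpa [descending] using hx
      | succ l ihl =>
        intro x hx
        rw [descending, Prod.fst_mul, Perm.mul_apply]
        apply ihl (by omega)
        rw [adj_apply (by omega)]
        grind
    have hk0 : k = 0 := by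
      have e1 := congrArg (fun p => p.1 (⟨m + 1 - k, by omega⟩ : Fin (N + 1))) e
      simp only [Prod.fst_mul, Perm.mul_apply, Perm.one_apply] at e1
      have e2 := top k hk ⟨m + 1 - k, by omega⟩ rfl
      rw [fix _ (by omega)] at e1
      rw [← e1] at e2
      simp at e2
      omega
    subst hk0
    rw [descending, mul_one] at e
    exact ih (by omega) (e ▸ hw)

/-- The submonoid T generated by the pairs (adjacent transposition, s i) is the graph of the
homomorphism. It is total because adjacent transpositions generate, and single-valued by
`eq_one_of_mem_closure`. -/
theorem exists_monoidHom (N : ℕ) (s : ℕ → M) (h1 : ∀ i < N, s i * s i = 1)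
    (h2 : ∀ i j, i < N → j < N → i + 1 < j → s i * s j = s j * s i)
    (h3 : ∀ i, i + 1 < N → s i * s (i + 1) * s i = s (i + 1) * s i * s (i + 1)) :
    ∃ π : Perm (Fin (N + 1)) →* M, ∀ (i : ℕ) (hi : i < N),
      π (swap ⟨i, by omega⟩ ⟨i + 1, by omega⟩) = s i := by
  set T := Submonoid.closure ((fun i => ((adj N i, s i) : Perm (Fin (N + 1)) × M)) '' Set.Iio N)
    with hT
  have mem : ∀ i < N, ((adj N i, s i) : Perm (Fin (N + 1)) × M) ∈ T := fun i hi =>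
    Submonoid.subset_closure ⟨i, hi, rfl⟩
  have inv : ∀ p ∈ T, ∃ q ∈ T, p * q = 1 ∧ q * p = 1 := by
    intro p hp
    induction hp using Submonoid.closure_induction with
    | mem y hy =>
      obtain ⟨i, hi, rfl⟩ := hy
      exact ⟨_, mem i hi, Prod.ext (adj_sq hi) (h1 i hi), Prod.ext (adj_sq hi) (h1 i hi)⟩
    | one => exact ⟨1, one_mem _, one_mul _, one_mul _⟩
    | mul y z _ _ hy hz =>
      obtain ⟨y', hy', e1, e2⟩ := hy
      obtain ⟨z', hz', e3, e4⟩ := hz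
      exact ⟨z' * y', mul_mem hz' hy', by rw [mul_assoc, ← mul_assoc z, e3, one_mul, e1],
        by rw [mul_assoc, ← mul_assoc y', e2, one_mul, e4]⟩
  -- The generators are involutions, so elements of T are invertible in T; dividing one pair by the
  -- other leaves a pair over the identity permutation.
  have uniq : ∀ g a b, (g, a) ∈ T → (g, b) ∈ T → a = b := by
    intro g a b ha hb
    obtain ⟨⟨g', b'⟩, hq, e1, e2⟩ := inv _ hb
    have e3 : g * g' = 1 := congrArg Prod.fst e1
    have e4 : b' * b = 1 := congrArg Prod.snd e2
    have := mul_mem ha hq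
    rw [Prod.mk_mul_mk, e3] at this
    have e5 := eq_one_of_mem_closure s h1 h2 h3 N le_rfl _ this
    rw [← mul_one a, ← e4, ← mul_assoc, e5, one_mul]
  have ex : ∀ g : Perm (Fin (N + 1)), ∃ a, (g, a) ∈ T := by
    intro g
    have hg : g ∈ Submonoid.closure (Set.range fun i : Fin N => swap i.castSucc i.succ) := by
      rw [Perm.mclosure_swap_castSucc_succ]
      trivial
    induction hg using Submonoid.closure_induction with
    | mem y hy =>
      obtain ⟨i, rfl⟩ := hy
      have := mem i i.2
      rw [adj, dif_pos i.2] at this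
      exact ⟨_, this⟩
    | one => exact ⟨1, one_mem _⟩
    | mul y z _ _ hy hz =>
      obtain ⟨a, ha⟩ := hy
      obtain ⟨b, hb⟩ := hz
      exact ⟨_, mul_mem ha hb⟩
  choose π hπ using ex
  refine ⟨⟨⟨π, uniq _ _ _ (hπ 1) (one_mem _)⟩, fun g h =>
    uniq _ _ _ (hπ _) (mul_mem (hπ g) (hπ h))⟩, fun i hi => ?_⟩
  have := mem i hi
  rw [adj, dif_pos hi] at this
  exact uniq _ _ _ (hπ _) this

end SymmetricPresentation

/-! ### The homomorphism to diagrams and the anti-automorphism of the presented monoid. -/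

namespace PIPPresentation

variable {n : ℕ}

theorem rel {a b : FreeMonoid (Gen n)} (h : Relations n a b) :
    PresentedMonoid.mk (Relations n) a = PresentedMonoid.mk (Relations n) b :=
  PresentedMonoid.mk_eq_mk_of_rel h

/-- The homomorphism `S n → PIP_n` on generators extends to the presented monoid. -/
noncomputable def toPIP (n : ℕ) : S n →* PIP (Fin n) :=
  PresentedMonoid.lift genImage genImage_relations

/-- The generators of the opposite monoid assigned to generators by the anti-automorphism. -/
def genStar : Gen n → (S n)ᵐᵒᵖ
  | Gen.sigma i h => MulOpposite.op (gen (Gen.sigma i h))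
  | Gen.lam i h => MulOpposite.op (gen (Gen.rho i h))
  | Gen.rho i h => MulOpposite.op (gen (Gen.lam i h))
  | Gen.e i h => MulOpposite.op (gen (Gen.e i h))

/-- The list of relations is closed, up to consequences, under reversing words and exchanging λ with
ρ. Each case names the mirror image of the relation. -/
theorem genStar_relations (a b : FreeMonoid (Gen n)) (h : Relations n a b) :
    FreeMonoid.lift genStar a = FreeMonoid.lift genStar b := by
  have hσ : ∀ i h, MulOpposite.unop (FreeMonoid.lift genStar (σ i h)) =
      PresentedMonoid.mk (Relations n) (σ i h) := fun i h => rfl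
  have hl : ∀ i h, MulOpposite.unop (FreeMonoid.lift genStar (lm i h)) =
      PresentedMonoid.mk (Relations n) (ρ i h) := fun i h => rfl
  have hr : ∀ i h, MulOpposite.unop (FreeMonoid.lift genStar (ρ i h)) =
      PresentedMonoid.mk (Relations n) (lm i h) := fun i h => rfl
  have he : ∀ i h, MulOpposite.unop (FreeMonoid.lift genStar (e i h)) =
      PresentedMonoid.mk (Relations n) (e i h) := fun i h => rfl
  apply MulOpposite.unop_injective
  cases h
  all_goals simp only [map_mul, map_one, MulOpposite.unop_mul, MulOpposite.unop_one, hσ, hl, hr, he]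
  case sigma_sq i hi =>
    simpa only [map_mul, map_one, mul_assoc] using rel (.sigma_sq i hi)
  case sigma_comm i j hi hj hij =>
    simpa only [map_mul, map_one, mul_assoc] using (rel (.sigma_comm i j hi hj hij)).symm
  case sigma_braid i j hi hj hij =>
    simpa only [map_mul, map_one, mul_assoc] using rel (.sigma_braid i j hi hj hij)
  case lam_lam_comm i j hi hj hij =>
    simpa only [map_mul, map_one, mul_assoc] using (rel (.rho_rho_comm i j hi hj hij)).symm
  case rho_rho_comm i j hi hj hij =>
    simpa only [map_mul, map_one, mul_assoc] using (rel (.lam_lam_comm i j hi hj hij)).symm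
  case rho_lam_comm i j hi hj hij =>
    simpa only [map_mul, map_one, mul_assoc] using rel (.rho_lam_comm j i hj hi hij.symm)
  case lam_rho_succ₁ i hi =>
    simpa only [map_mul, map_one, mul_assoc] using rel (.lam_succ_rho₁ i hi)
  case lam_rho_succ₂ i hi =>
    simpa only [map_mul, map_one, mul_assoc] using rel (.lam_succ_rho₂ i hi)
  case lam_succ_rho₁ i hi =>
    simpa only [map_mul, map_one, mul_assoc] using rel (.lam_rho_succ₁ i hi)
  case lam_succ_rho₂ i hi =>
    simpa only [map_mul, map_one, mul_assoc] using rel (.lam_rho_succ₂ i hi)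
  case rho_lam_succ i hi =>
    simpa only [map_mul, map_one, mul_assoc] using rel (.rho_succ_lam i hi)
  case rho_succ_lam i hi =>
    simpa only [map_mul, map_one, mul_assoc] using rel (.rho_lam_succ i hi)
  case lam_inverse i hi =>
    simpa only [map_mul, map_one, mul_assoc] using rel (.rho_inverse i hi)
  case rho_inverse i hi =>
    simpa only [map_mul, map_one, mul_assoc] using rel (.lam_inverse i hi)
  case sigma_lam_sigma i j hi hj hij =>
    simpa only [map_mul, map_one, mul_assoc] using rel (.sigma_rho_sigma i j hi hj hij)
  case sigma_rho_sigma i j hi hj hij =>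
    simpa only [map_mul, map_one, mul_assoc] using rel (.sigma_lam_sigma i j hi hj hij)
  case lam_sigma i hi =>
    simpa only [map_mul, map_one, mul_assoc] using rel (.sigma_rho i hi)
  case sigma_rho i hi =>
    simpa only [map_mul, map_one, mul_assoc] using rel (.lam_sigma i hi)
  case sigma_lam_comm i j hi hj hij =>
    simpa only [map_mul, map_one, mul_assoc] using (rel (.sigma_rho_comm i j hi hj hij)).symm
  case sigma_rho_comm i j hi hj hij =>
    simpa only [map_mul, map_one, mul_assoc] using (rel (.sigma_lam_comm i j hi hj hij)).symm
  case lam_lam_succ₁ i hi =>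
    simpa only [map_mul, map_one, mul_assoc] using rel (.rho_succ_rho₁ i hi)
  case lam_lam_succ₂ i hi =>
    simpa only [map_mul, map_one, mul_assoc] using rel (.rho_succ_rho₂ i hi)
  case rho_succ_rho₁ i hi =>
    simpa only [map_mul, map_one, mul_assoc] using rel (.lam_lam_succ₁ i hi)
  case rho_succ_rho₂ i hi =>
    simpa only [map_mul, map_one, mul_assoc] using rel (.lam_lam_succ₂ i hi)
  case lam_succ_lam₁ i hi =>
    simpa only [map_mul, map_one, mul_assoc] using rel (.rho_rho_succ₁ i hi)
  case lam_succ_lam₂ i hi =>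
    simpa only [map_mul, map_one, mul_assoc] using rel (.rho_rho_succ₂ i hi)
  case rho_rho_succ₁ i hi =>
    simpa only [map_mul, map_one, mul_assoc] using rel (.lam_succ_lam₁ i hi)
  case rho_rho_succ₂ i hi =>
    simpa only [map_mul, map_one, mul_assoc] using rel (.lam_succ_lam₂ i hi)
  case e_succ i hi =>
    simpa only [map_mul, map_one, mul_assoc] using rel (.e_succ i hi)
  case e_zero hn =>
    simpa only [map_mul, map_one, mul_assoc] using rel (.e_zero hn)
  case e_sq i hi =>
    simpa only [map_mul, map_one, mul_assoc] using rel (.e_sq i hi)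
  case e_e_succ i hi =>
    simpa only [map_mul, map_one, mul_assoc] using (rel (.e_e_succ i hi)).symm
  -- The mirror image e_i e_{i+1} = ρ_i² is not in the list; it follows by a chain through λ_i².
  case lam_sq i hi =>
    simpa only [map_mul, map_one, mul_assoc] using
        (rel (.e_e_succ i hi)).trans ((rel (.lam_sq i hi)).trans (rel (.lam_sq_rho_sq i hi)))
  case lam_sq_rho_sq i hi =>
    simpa only [map_mul, map_one, mul_assoc] using (rel (.lam_sq_rho_sq i hi)).symm
  case rho_sigma_lam i hi =>
    simpa only [map_mul, map_one, mul_assoc] using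
        (rel (.lam_sq_rho_sq i hi)).trans (rel (.rho_sigma_lam i hi))
  case e_sigma_comm i j hi hj h h' =>
    simpa only [map_mul, map_one, mul_assoc] using (rel (.e_sigma_comm i j hi hj h h')).symm
  case e_sigma i hi =>
    simpa only [map_mul, map_one, mul_assoc] using rel (.sigma_e i hi)
  case sigma_e i hi =>
    simpa only [map_mul, map_one, mul_assoc] using rel (.e_sigma i hi)
  case e_lam_comm i j hi hj h h' =>
    simpa only [map_mul, map_one, mul_assoc] using (rel (.e_rho_comm i j hi hj h h')).symm
  case e_succ_lam i hi =>
    simpa only [map_mul, map_one, mul_assoc] using rel (.rho_e_succ i hi)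
  case e_lam₁ i hi =>
    simpa only [map_mul, map_one, mul_assoc] using rel (.e_rho₁ i hi)
  case e_lam₂ i hi =>
    simpa only [map_mul, map_one, mul_assoc] using rel (.e_rho₂ i hi)
  case e_lam₃ i hi =>
    simpa only [map_mul, map_one, mul_assoc] using (rel (.e_rho₃ i hi)).trans (rel (.e_e_succ i hi))
  case e_rho_comm i j hi hj h h' =>
    simpa only [map_mul, map_one, mul_assoc] using (rel (.e_lam_comm i j hi hj h h')).symm
  case rho_e_succ i hi =>
    simpa only [map_mul, map_one, mul_assoc] using rel (.e_succ_lam i hi)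
  case e_rho₁ i hi =>
    simpa only [map_mul, map_one, mul_assoc] using rel (.e_lam₁ i hi)
  case e_rho₂ i hi =>
    simpa only [map_mul, map_one, mul_assoc] using rel (.e_lam₂ i hi)
  case e_rho₃ i hi =>
    simpa only [map_mul, map_one, mul_assoc] using (rel (.e_lam₃ i hi)).trans (rel (.e_e_succ i hi))

/-- The anti-automorphism of `S n` that fixes `σ_i` and `e_i` and exchanges `λ_i` and `ρ_i`. -/
def star (a : S n) : S n := (PresentedMonoid.lift genStar genStar_relations a).unop

theorem star_mul (a b : S n) : star (a * b) = star b * star a := by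
  rw [star, map_mul, MulOpposite.unop_mul]
  rfl

theorem star_one : star (1 : S n) = 1 := by
  rw [star, map_one, MulOpposite.unop_one]

/-- Induction on elements of the presented monoid. -/
theorem induction_gen {P : S n → Prop} (one : P 1) (mul : ∀ g a, P a → P (gen g * a)) (a : S n) :
    P a := by
  induction a using PresentedMonoid.inductionOn with
  | h w =>
    induction w using FreeMonoid.inductionOn' with
    | one => exact one
    | of_mul g w ih =>
      rw [map_mul]
      exact mul g _ ih

theorem star_star (a : S n) : star (star a) = a := by
  induction a using induction_gen with
  | one => rw [star_one, star_one]
  | mul g a ih =>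
    rw [star_mul, star_mul, ih]
    cases g <;> rfl

theorem star_sigma (i : ℕ) (h : i + 1 < n) : star (gen (.sigma i h)) = gen (.sigma i h) := rfl

theorem star_e (i : ℕ) (h : i < n) : star (gen (.e i h)) = gen (.e i h) := rfl

theorem star_rho (i : ℕ) (h : i + 1 < n) : star (gen (.rho i h)) = gen (.lam i h) := rfl


/-! ### Generation by transpositions and the axioms of a frame. -/

open Equiv

/-- Multiplying g by the transposition of x and g x shrinks the support, and both points lie in D.
Together with `swap_mem_of_adjacent` this reduces statements about permutations to transpositions.
-/
theorem mem_of_forall_swap_mem {X : Type*} [Fintype X] [DecidableEq X] (P : Submonoid (Perm X))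
    (D : X → Prop) (h : ∀ x y, D x → D y → x ≠ y → swap x y ∈ P) (g : Perm X)
    (hg : ∀ x, ¬ D x → g x = x) : g ∈ P := by
  induction hk : g.support.card using Nat.strong_induction_on generalizing g with
  | _ k ih =>
    by_cases h1 : g = 1
    · rw [h1]
      exact one_mem _
    · obtain ⟨x, hx⟩ : ∃ x, g x ≠ x := by
        by_contra hn
        push Not at hn
        exact h1 (Equiv.ext hn)
      have hDx : D x := by
        by_contra hD
        exact hx (hg x hD)
      have hDgx : D (g x) := by
        by_contra hD
        exact hx (g.injective (hg _ hD))
      have e : g = swap x (g x) * (swap x (g x) * g) := by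
        rw [← mul_assoc, swap_mul_self, one_mul]
      rw [e]
      refine mul_mem (h _ _ hDx hDgx hx.symm)
        (ih _ (hk ▸ Perm.card_support_swap_mul hx) _ (fun y hy => ?_) rfl)
      rw [Perm.mul_apply, hg y hy]
      exact swap_apply_of_ne_of_ne (fun h => hy (h ▸ hDx)) (fun h => hy (h ▸ hDgx))

/-- Conjugating (x j) by (j j+1) gives (x j+1), so distant transpositions are reached one step at a
time without leaving the points ≥ k. -/
theorem swap_mem_of_adjacent {n : ℕ} (P : Submonoid (Perm (Fin n))) (k : ℕ)
    (h : ∀ (i : ℕ) (hi : i + 1 < n), k ≤ i → swap (⟨i, by omega⟩ : Fin n) ⟨i + 1, hi⟩ ∈ P)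
    (x y : Fin n) (hx : k ≤ x.1) (hy : k ≤ y.1) (hxy : x ≠ y) : swap x y ∈ P := by
  wlog lt : x < y generalizing x y
  · rw [swap_comm]
    exact this _ _ hy hx hxy.symm (hxy.lt_or_gt.resolve_left lt)
  obtain ⟨j, hj⟩ := y
  induction j with
  | zero => exact absurd lt (by simp [Fin.lt_def])
  | succ j ih =>
    have lt' : x.1 < j + 1 := lt
    have hm := h j hj (by omega)
    by_cases e : x.1 = j
    · have : x = ⟨j, by omega⟩ := Fin.ext e
      rwa [this]
    · have hxj : x ≠ ⟨j, by omega⟩ := fun h => e (congrArg Fin.val h)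
      have hm' := ih (by omega) (by simp; omega) hxj (by simp [Fin.lt_def]; omega)
      have : swap (⟨j, by omega⟩ : Fin n) ⟨j + 1, hj⟩ * swap x ⟨j, by omega⟩ *
          swap (⟨j, by omega⟩ : Fin n) ⟨j + 1, hj⟩ = swap x ⟨j + 1, hj⟩ := by
        rw [swap_mul_swap_mul_swap hxj hxy, swap_comm]
      rw [← this]
      exact mul_mem (mul_mem hm hm') hm

theorem exists_perm_extending {X ι : Type*} [Finite X] (p q : ι → X) (hp : p.Injective)
    (hq : q.Injective) : ∃ g : Perm X, ∀ i, g (p i) = q i := by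
  classical
  have := Fintype.ofFinite X
  let e := (Equiv.ofInjective p hp).symm.trans (Equiv.ofInjective q hq)
  refine ⟨e.extendSubtype, fun i => ?_⟩
  rw [Equiv.extendSubtype_apply_of_mem _ _ ⟨i, rfl⟩]
  change ((Equiv.ofInjective q hq) ((Equiv.ofInjective p hp).symm (Equiv.ofInjective p hp i))).1 =
      q i
  rw [Equiv.symm_apply_apply]
  rfl

/-- The structure used to bring elements to normal form: a monoid with an action of the symmetric
group on `X`, merging elements `ρ x y` and idempotents `e x` permuted by it, and an
anti-automorphism. -/
structure Frame (X M : Type*) [DecidableEq X] [Monoid M] where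
  π : Perm X →* M
  ρ : X → X → M
  e : X → M
  star : M → M
  star_mul : ∀ a b, star (a * b) = star b * star a
  star_star : ∀ a, star (star a) = a
  star_π : ∀ g, star (π g) = π g⁻¹
  star_e : ∀ x, star (e x) = e x
  π_ρ : ∀ g x y, π g * ρ x y = ρ (g x) (g y) * π g
  π_e : ∀ g x, π g * e x = e (g x) * π g
  swap_ρ : ∀ x y, x ≠ y → π (swap x y) * ρ x y = ρ x y
  ρ_comm : ∀ x y z w, x ≠ y → x ≠ z → x ≠ w → y ≠ z → y ≠ w → z ≠ w →
    ρ x y * ρ z w = ρ z w * ρ x y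
  ρ_comm_same : ∀ x y z, x ≠ y → x ≠ z → y ≠ z → ρ x y * ρ x z = ρ x z * ρ x y
  -- Merging z into y and then y into x has the same effect as merging both into x directly.
  ρ_chain : ∀ x y z, x ≠ y → x ≠ z → y ≠ z → ρ y z * ρ x y = ρ x z * ρ x y
  e_mul_self : ∀ x, e x * e x = e x
  e_comm : ∀ x y, e x * e y = e y * e x
  e_e_swap : ∀ x y, x ≠ y → e x * e y * π (swap x y) = e x * e y
  ρ_e : ∀ x y, x ≠ y → ρ x y * e y = ρ x y
  ρ_e_left : ∀ x y, x ≠ y → ρ x y * e x = e x * e y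
  e_ρ_left : ∀ x y, x ≠ y → e x * ρ x y = e x * e y
  e_ρ : ∀ x y, x ≠ y → e y * ρ x y = e x * e y
  e_ρ_comm : ∀ x y z, x ≠ y → x ≠ z → y ≠ z → e z * ρ x y = ρ x y * e z
  lam_ρ : ∀ x y, x ≠ y → star (ρ x y) * ρ x y = e y
  lam_ρ_same : ∀ x y z, x ≠ y → x ≠ z → y ≠ z → star (ρ x y) * ρ x z = ρ x z * star (ρ x y)
  lam_ρ_comm : ∀ x y z w, x ≠ y → x ≠ z → x ≠ w → y ≠ z → y ≠ w → z ≠ w →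
    star (ρ x y) * ρ z w = ρ z w * star (ρ x y)

/-! ### Conjugation by permutations and transport of an element along tuples. -/

section Conjugation

variable {X M : Type*} [Monoid M] (π : Perm X →* M)

/-- Conjugation by the image of a permutation. -/
def conj (g : Perm X) : M →* M where
  toFun a := π g * a * π g⁻¹
  map_one' := by rw [mul_one, ← map_mul, mul_inv_cancel, map_one]
  map_mul' a b := by
    have : π g⁻¹ * π g = 1 := by rw [← map_mul, inv_mul_cancel, map_one]
    simp only [mul_assoc]
    rw [← mul_assoc (π g⁻¹) (π g), this, one_mul]

theorem conj_mul (g h : Perm X) (a : M) : conj π (g * h) a = conj π g (conj π h a) := by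
  change π (g * h) * a * π (g * h)⁻¹ = π g * (π h * a * π h⁻¹) * π g⁻¹
  rw [mul_inv_rev, map_mul, map_mul]
  simp only [mul_assoc]

theorem conj_perm (g h : Perm X) : conj π g (π h) = π (g * h * g⁻¹) := by
  simp only [conj, MonoidHom.coe_mk, OneHom.coe_mk, map_mul]

theorem mul_eq_conj_mul (g : Perm X) (a : M) : π g * a = conj π g a * π g := by
  have : π g⁻¹ * π g = 1 := by rw [← map_mul, inv_mul_cancel, map_one]
  simp only [conj, MonoidHom.coe_mk, OneHom.coe_mk, mul_assoc, this, mul_one]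

theorem conj_eq_self_iff (g : Perm X) (a : M) : conj π g a = a ↔ π g * a = a * π g := by
  have h1 : π g⁻¹ * π g = 1 := by rw [← map_mul, inv_mul_cancel, map_one]
  have h2 : π g * π g⁻¹ = 1 := by rw [← map_mul, mul_inv_cancel, map_one]
  constructor
  · intro h
    rw [mul_eq_conj_mul, h]
  · intro h
    change π g * a * π g⁻¹ = a
    rw [h, mul_assoc, h2, mul_one]

/-- The permutations whose images commute with `a`. -/
def conjStabilizer (a : M) : Submonoid (Perm X) where
  carrier := {g | conj π g a = a}
  one_mem' := by simp [conj]
  mul_mem' {g h} hg hh := by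
    change conj π (g * h) a = a
    rw [conj_mul, show conj π h a = a from hh, show conj π g a = a from hg]

/-- The conjugate of `a` by a permutation that takes the tuple `p` to the tuple `q`. -/
noncomputable def transport {ι : Type*} (p : ι → X) (a : M) (q : ι → X) : M :=
  open Classical in if h : ∃ g : Perm X, ∀ i, g (p i) = q i then conj π h.choose a else 1

/-- Two permutations that take p to q differ by one fixing p, and conjugation by the latter fixes a;
so the choice does not matter. -/
theorem transport_eq {ι : Type*} {p : ι → X} {a : M}
    (ha : ∀ g : Perm X, (∀ i, g (p i) = p i) → conj π g a = a) (g : Perm X) {q : ι → X}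
    (hg : ∀ i, g (p i) = q i) : transport π p a q = conj π g a := by
  have h : ∃ g : Perm X, ∀ i, g (p i) = q i := ⟨g, hg⟩
  rw [transport, dif_pos h]
  have e : h.choose = g * (g⁻¹ * h.choose) := by rw [mul_inv_cancel_left]
  rw [e, conj_mul, ha (g⁻¹ * h.choose)]
  intro i
  rw [Perm.mul_apply, h.choose_spec i, ← hg i]
  exact g.symm_apply_apply _

/-- Equivariance needs no condition on q: if no permutation reaches q, the default value 1 is fixed
by conjugation. -/
theorem conj_transport {ι : Type*} {p : ι → X} {a : M}
    (ha : ∀ g : Perm X, (∀ i, g (p i) = p i) → conj π g a = a) (g : Perm X) (q : ι → X) :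
    conj π g (transport π p a q) = transport π p a (fun i => g (q i)) := by
  by_cases h : ∃ k : Perm X, ∀ i, k (p i) = q i
  · obtain ⟨k, hk⟩ := h
    rw [transport_eq π ha k hk, transport_eq π ha (g * k) (by simp [hk]), conj_mul]
  · have h' : ¬ ∃ k : Perm X, ∀ i, k (p i) = g (q i) := by
      rintro ⟨k, hk⟩
      exact h ⟨g⁻¹ * k, fun i => by
        rw [Perm.mul_apply, hk]
        exact g.symm_apply_apply _⟩
    rw [transport, transport, dif_neg h, dif_neg h', map_one]

end Conjugation


/-! ### The elements ρ_{x,y} and e_x, and the relations for arbitrary distinct points. -/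

theorem exists_perm_hom (hn : 0 < n) : ∃ π : Perm (Fin n) →* S n, ∀ (i : ℕ) (h : i + 1 < n),
    π (swap ⟨i, by omega⟩ ⟨i + 1, h⟩) = gen (.sigma i h) := by
  obtain ⟨N, rfl⟩ : ∃ N, n = N + 1 := ⟨n - 1, by omega⟩
  obtain ⟨π, hπ⟩ := SymmetricPresentation.exists_monoidHom (M := S (N + 1)) N
    (fun i => if h : i + 1 < N + 1 then gen (.sigma i h) else 1)
    (fun i hi => by
      rw [dif_pos (by omega)]
      exact rel (.sigma_sq i (by omega)))
    (fun i j hi hj hij => by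
      rw [dif_pos (by omega), dif_pos (by omega)]
      exact rel (.sigma_comm i j (by omega) (by omega) (.inl hij)))
    (fun i hi => by
      rw [dif_pos (by omega), dif_pos (by omega)]
      exact rel (.sigma_braid i (i + 1) (by omega) (by omega) (.inl rfl)))
  refine ⟨π, fun i h => ?_⟩
  rw [hπ i (by omega), dif_pos h]

/-- The homomorphism from the symmetric group that takes adjacent transpositions to the `σ_i`. -/
noncomputable def perm (hn : 3 ≤ n) : Perm (Fin n) →* S n :=
  (exists_perm_hom (by omega : 0 < n)).choose

theorem perm_swap (hn : 3 ≤ n) (i : ℕ) (h : i + 1 < n) :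
    perm hn (swap ⟨i, by omega⟩ ⟨i + 1, h⟩) = gen (.sigma i h) :=
  (exists_perm_hom (by omega : 0 < n)).choose_spec i h

theorem conj_swap (hn : 3 ≤ n) (i : ℕ) (h : i + 1 < n) (a : S n) :
    conj (perm hn) (swap ⟨i, by omega⟩ ⟨i + 1, h⟩) a = gen (.sigma i h) * a * gen (.sigma i h) := by
  change perm hn _ * a * perm hn _ = _
  rw [swap_inv, perm_swap]

/-- The σ_i with i ≥ k generate the image of all permutations that fix the first k points. This is
the hypothesis required by `transport_eq`. -/
theorem conj_eq_self_of_sigma_comm (hn : 3 ≤ n) (k : ℕ) (a : S n)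
    (ha : ∀ (i : ℕ) (h : i + 1 < n), k ≤ i → gen (.sigma i h) * a = a * gen (.sigma i h))
    (g : Perm (Fin n)) (hg : ∀ x : Fin n, x.1 < k → g x = x) : conj (perm hn) g a = a := by
  refine mem_of_forall_swap_mem (conjStabilizer (perm hn) a) (fun x : Fin n => k ≤ x.1)
    (swap_mem_of_adjacent _ k fun i hi hk => ?_) g (fun x hx => hg x (by simpa using hx))
  change conj _ _ _ = _
  rw [conj_eq_self_iff, perm_swap]
  exact ha i hi hk

theorem star_perm (hn : 3 ≤ n) (g : Perm (Fin n)) : star (perm hn g) = perm hn g⁻¹ := by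
  have : g ∈ ({ carrier := {g | star (perm hn g) = perm hn g⁻¹}
                one_mem' := by simp [star_one]
                mul_mem' := fun {g h} hg hh => by
                  simp only [Set.mem_ofPred_eq] at *
                  rw [map_mul, star_mul, hg, hh, mul_inv_rev, map_mul] } :
      Submonoid (Perm (Fin n))) := by
    refine mem_of_forall_swap_mem _ (fun _ => True) (fun x y _ _ hxy =>
      swap_mem_of_adjacent _ 0 (fun i hi _ => ?_) x y (Nat.zero_le _) (Nat.zero_le _) hxy) g
      (fun x hx => absurd trivial hx)
    change star (perm hn _) = perm hn _
    rw [swap_inv, perm_swap, star_sigma]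
  exact this

theorem star_conj (hn : 3 ≤ n) (g : Perm (Fin n)) (a : S n) :
    star (conj (perm hn) g a) = conj (perm hn) g (star a) := by
  change star (perm hn g * a * perm hn g⁻¹) = perm hn g * star a * perm hn g⁻¹
  rw [star_mul, star_mul, star_perm, star_perm, inv_inv, mul_assoc]

/-- The element `ρ_{x,y}`, conjugate to `ρ_0`. -/
noncomputable def rhoAt (hn : 3 ≤ n) (x y : Fin n) : S n :=
  transport (perm hn) ![(⟨0, by omega⟩ : Fin n), ⟨1, by omega⟩]
    (gen (.rho 0 (by omega))) ![x, y]

/-- The element `e_x`, conjugate to `e_0`. -/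
noncomputable def eAt (hn : 3 ≤ n) (x : Fin n) : S n :=
  transport (perm hn) ![(⟨0, by omega⟩ : Fin n)] (gen (.e 0 (by omega))) ![x]

theorem conj_rho_zero (hn : 3 ≤ n) (g : Perm (Fin n))
    (hg : ∀ i, g (![(⟨0, by omega⟩ : Fin n), ⟨1, by omega⟩] i) =
      ![(⟨0, by omega⟩ : Fin n), ⟨1, by omega⟩] i) :
    conj (perm hn) g (gen (.rho 0 (by omega))) = gen (.rho 0 (by omega)) := by
  refine conj_eq_self_of_sigma_comm hn 2 _ (fun i h hi =>
    rel (.sigma_rho_comm i 0 h (by omega) (.inr (by omega)))) g (fun x hx => ?_)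
  obtain ⟨x, hx'⟩ := x
  interval_cases x
  · exact hg 0
  · exact hg 1

theorem conj_e_zero (hn : 3 ≤ n) (g : Perm (Fin n))
    (hg : ∀ i, g (![(⟨0, by omega⟩ : Fin n)] i) = ![(⟨0, by omega⟩ : Fin n)] i) :
    conj (perm hn) g (gen (.e 0 (by omega))) = gen (.e 0 (by omega)) := by
  refine conj_eq_self_of_sigma_comm hn 1 _ (fun i h hi =>
    (rel (.e_sigma_comm 0 i (by omega) h (by omega) (by omega))).symm) g (fun x hx => ?_)
  obtain ⟨x, hx'⟩ := x
  interval_cases x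
  exact hg 0

theorem conj_rhoAt (hn : 3 ≤ n) (g : Perm (Fin n)) (x y : Fin n) :
    conj (perm hn) g (rhoAt hn x y) = rhoAt hn (g x) (g y) := by
  rw [rhoAt, conj_transport _ (conj_rho_zero hn)]
  congr 1
  funext i
  fin_cases i <;> rfl

theorem conj_eAt (hn : 3 ≤ n) (g : Perm (Fin n)) (x : Fin n) :
    conj (perm hn) g (eAt hn x) = eAt hn (g x) := by
  rw [eAt, conj_transport _ (conj_e_zero hn)]
  congr 1
  funext i
  fin_cases i
  rfl

theorem rhoAt_zero_one (hn : 3 ≤ n) :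
    rhoAt hn ⟨0, by omega⟩ ⟨1, by omega⟩ = gen (.rho 0 (by omega)) := by
  refine (transport_eq _ (conj_rho_zero hn) 1 (fun _ => rfl)).trans ?_
  simp [conj]

theorem eAt_zero (hn : 3 ≤ n) : eAt hn ⟨0, by omega⟩ = gen (.e 0 (by omega)) := by
  refine (transport_eq _ (conj_e_zero hn) 1 (fun _ => rfl)).trans ?_
  simp [conj]

theorem sigma_mul_sigma_mul (i : ℕ) (h : i + 1 < n) (a : S n) :
    gen (.sigma i h) * (gen (.sigma i h) * a) = a := by
  have : gen (.sigma i h) * gen (.sigma i h) = (1 : S n) := rel (.sigma_sq i h)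
  rw [← mul_assoc, this, one_mul]

/-- The relation σ_i ρ_{i+1} σ_i = σ_{i+1} ρ_i σ_{i+1} exhibits ρ_{i+1} as a conjugate of ρ_i, by a
permutation taking (i, i+1) to (i+1, i+2). -/
theorem rhoAt_succ (hn : 3 ≤ n) (i : ℕ) (h : i + 1 < n) :
    rhoAt hn ⟨i, by omega⟩ ⟨i + 1, h⟩ = gen (.rho i h) := by
  induction i with
  | zero => exact rhoAt_zero_one hn
  | succ i ih =>
    have r : gen (.sigma i (by omega)) * gen (.rho (i + 1) h) * gen (.sigma i (by omega)) =
      gen (.sigma (i + 1) h) * gen (.rho i (by omega)) * (gen (.sigma (i + 1) h) : S n) :=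
      rel (.sigma_rho_sigma i (i + 1) (by omega) h (.inl rfl))
    rw [← conj_swap hn, ← conj_swap hn, ← ih (by omega), conj_rhoAt] at r
    have r' := congrArg (conj (perm hn) (swap ⟨i, by omega⟩ ⟨i + 1, by omega⟩)) r
    rw [← conj_mul, swap_mul_self, conj_rhoAt] at r'
    have e1 : swap (⟨i + 1, by omega⟩ : Fin n) ⟨i + 1 + 1, h⟩ ⟨i, by omega⟩ = ⟨i, by omega⟩ :=
      swap_apply_of_ne_of_ne (by simp) (by simp; omega)
    have e2 : swap (⟨i, by omega⟩ : Fin n) ⟨i + 1, by omega⟩ ⟨i + 1 + 1, h⟩ = ⟨i + 1 + 1, h⟩ :=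
      swap_apply_of_ne_of_ne (by simp; omega) (by simp)
    rw [swap_apply_left, e1, swap_apply_left, e2] at r'
    rw [← r']
    simp [conj]

theorem eAt_eq (hn : 3 ≤ n) (i : ℕ) (h : i < n) : eAt hn ⟨i, h⟩ = gen (.e i h) := by
  induction i with
  | zero => exact eAt_zero hn
  | succ i ih =>
    have r : gen (.e i (by omega)) * gen (.sigma i h) =
      gen (.sigma i h) * (gen (.e (i + 1) h) : S n) := rel (.e_sigma i h)
    have r' := congrArg (fun a => gen (.sigma i h) * a) r
    simp only [sigma_mul_sigma_mul] at r'
    rw [← r', ← mul_assoc, ← conj_swap hn, ← ih (by omega), conj_eAt, swap_apply_left]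

theorem exists_perm_two (hn : 3 ≤ n) (x y : Fin n) (hxy : x ≠ y) : ∃ g : Perm (Fin n),
    g ⟨0, by omega⟩ = x ∧ g ⟨1, by omega⟩ = y := by
  obtain ⟨g, hg⟩ := exists_perm_extending ![(⟨0, by omega⟩ : Fin n), ⟨1, by omega⟩] ![x, y]
    (fun i j h => by fin_cases i <;> fin_cases j <;> simp_all)
    (fun i j h => by fin_cases i <;> fin_cases j <;> simp_all)
  exact ⟨g, hg 0, hg 1⟩

theorem exists_perm_three (hn : 3 ≤ n) (x y z : Fin n) (hxy : x ≠ y) (hxz : x ≠ z) (hyz : y ≠ z) :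
    ∃ g : Perm (Fin n), g ⟨0, by omega⟩ = x ∧ g ⟨1, by omega⟩ = y ∧ g ⟨2, by omega⟩ = z := by
  obtain ⟨g, hg⟩ := exists_perm_extending
    ![(⟨0, by omega⟩ : Fin n), ⟨1, by omega⟩, ⟨2, by omega⟩] ![x, y, z]
    (fun i j h => by fin_cases i <;> fin_cases j <;> simp_all)
    (fun i j h => by fin_cases i <;> fin_cases j <;> simp_all)
  exact ⟨g, hg 0, hg 1, hg 2⟩

/-- Four distinct points force n ≥ 4, so the index 3 exists although only n ≥ 3 is assumed
elsewhere. -/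
theorem exists_perm_four (x y z w : Fin n) (hxy : x ≠ y) (hxz : x ≠ z) (hxw : x ≠ w)
    (hyz : y ≠ z) (hyw : y ≠ w) (hzw : z ≠ w) : ∃ h : 4 ≤ n, ∃ g : Perm (Fin n),
    g ⟨0, by omega⟩ = x ∧ g ⟨1, by omega⟩ = y ∧ g ⟨2, by omega⟩ = z ∧ g ⟨3, by omega⟩ = w := by
  have inj : Function.Injective ![x, y, z, w] := fun i j h => by
    fin_cases i <;> fin_cases j <;> simp_all
  have h : 4 ≤ n := by simpa using Fintype.card_le_of_injective _ inj
  obtain ⟨g, hg⟩ := exists_perm_extending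
    ![(⟨0, by omega⟩ : Fin n), ⟨1, by omega⟩, ⟨2, by omega⟩, ⟨3, by omega⟩] ![x, y, z, w]
    (fun i j h => by fin_cases i <;> fin_cases j <;> simp_all) inj
  exact ⟨h, g, hg 0, hg 1, hg 2, hg 3⟩

theorem conj_perm_swap (hn : 3 ≤ n) (g : Perm (Fin n)) (x y : Fin n) :
    conj (perm hn) g (perm hn (swap x y)) = perm hn (swap (g x) (g y)) := by
  rw [conj_perm, swap_apply_apply]

theorem conj_star_rhoAt (hn : 3 ≤ n) (g : Perm (Fin n)) (x y : Fin n) :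
    conj (perm hn) g (star (rhoAt hn x y)) = star (rhoAt hn (g x) (g y)) := by
  rw [← star_conj, conj_rhoAt]

theorem star_eAt (hn : 3 ≤ n) (x : Fin n) : star (eAt hn x) = eAt hn x := by
  rw [eAt_eq, star_e]

theorem perm_mul_rhoAt (hn : 3 ≤ n) (g : Perm (Fin n)) (x y : Fin n) :
    perm hn g * rhoAt hn x y = rhoAt hn (g x) (g y) * perm hn g := by
  rw [mul_eq_conj_mul, conj_rhoAt]

theorem perm_mul_eAt (hn : 3 ≤ n) (g : Perm (Fin n)) (x : Fin n) :
    perm hn g * eAt hn x = eAt hn (g x) * perm hn g := by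
  rw [mul_eq_conj_mul, conj_eAt]

/-- The pattern used repeatedly below: a defining relation gives the identity at the points 0, 1, …,
and conjugating by a permutation carries it to arbitrary distinct points. -/
theorem swap_mul_rhoAt (hn : 3 ≤ n) (x y : Fin n) (hxy : x ≠ y) :
    perm hn (swap x y) * rhoAt hn x y = rhoAt hn x y := by
  obtain ⟨g, rfl, rfl⟩ := exists_perm_two hn x y hxy
  have b : perm hn (swap ⟨0, by omega⟩ ⟨1, by omega⟩) * rhoAt hn ⟨0, by omega⟩ ⟨1, by omega⟩ =
      rhoAt hn ⟨0, by omega⟩ ⟨1, by omega⟩ := by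
    rw [perm_swap hn 0 (by omega), rhoAt_succ hn 0 (by omega)]
    exact rel (.sigma_rho 0 (by omega))
  simpa only [map_mul, conj_rhoAt, conj_perm_swap] using congrArg (conj (perm hn) g) b

theorem rhoAt_swap (hn : 3 ≤ n) (x y : Fin n) (hxy : x ≠ y) :
    rhoAt hn x y * perm hn (swap x y) = rhoAt hn y x := by
  have := perm_mul_rhoAt hn (swap x y) y x
  rw [swap_apply_left, swap_apply_right, swap_comm, swap_mul_rhoAt hn y x hxy.symm, swap_comm]
      at this
  exact this.symm

theorem rhoAt_comm (hn : 3 ≤ n) (x y z w : Fin n) (hxy : x ≠ y) (hxz : x ≠ z) (hxw : x ≠ w)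
    (hyz : y ≠ z) (hyw : y ≠ w) (hzw : z ≠ w) :
    rhoAt hn x y * rhoAt hn z w = rhoAt hn z w * rhoAt hn x y := by
  obtain ⟨h, g, rfl, rfl, rfl, rfl⟩ := exists_perm_four x y z w hxy hxz hxw hyz hyw hzw
  have b : rhoAt hn ⟨0, by omega⟩ ⟨1, by omega⟩ * rhoAt hn ⟨2, by omega⟩ ⟨3, by omega⟩ =
      rhoAt hn ⟨2, by omega⟩ ⟨3, by omega⟩ * rhoAt hn ⟨0, by omega⟩ ⟨1, by omega⟩ := by
    rw [rhoAt_succ hn 0 (by omega), rhoAt_succ hn 2 (by omega)]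
    exact rel (.rho_rho_comm 0 2 (by omega) (by omega) (.inl (by omega)))
  simpa only [map_mul, conj_rhoAt] using congrArg (conj (perm hn) g) b

/-- In ρ_1 ρ_0 = σ_0 ρ_1 ρ_0, moving σ_0 past ρ_{1,2} turns it into ρ_{0,2}, after which ρ_{0,1}
absorbs σ_0. -/
theorem rhoAt_chain (hn : 3 ≤ n) (x y z : Fin n) (hxy : x ≠ y) (hxz : x ≠ z) (hyz : y ≠ z) :
    rhoAt hn y z * rhoAt hn x y = rhoAt hn x z * rhoAt hn x y := by
  obtain ⟨g, rfl, rfl, rfl⟩ := exists_perm_three hn x y z hxy hxz hyz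
  have b : rhoAt hn ⟨1, by omega⟩ ⟨2, by omega⟩ * rhoAt hn ⟨0, by omega⟩ ⟨1, by omega⟩ =
      perm hn (swap ⟨0, by omega⟩ ⟨1, by omega⟩) *
      (rhoAt hn ⟨1, by omega⟩ ⟨2, by omega⟩ * rhoAt hn ⟨0, by omega⟩ ⟨1, by omega⟩) := by
    rw [perm_swap hn 0 (by omega), rhoAt_succ hn 0 (by omega), rhoAt_succ hn 1 (by omega),
      ← mul_assoc]
    exact rel (.rho_succ_rho₁ 0 (by omega))
  rw [← mul_assoc, perm_mul_rhoAt, swap_apply_right, mul_assoc, swap_mul_rhoAt hn _ _ (by simp),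
    swap_apply_of_ne_of_ne (by simp) (by simp)] at b
  simpa only [map_mul, conj_rhoAt] using congrArg (conj (perm hn) g) b

/-- In ρ_1 ρ_0 = ρ_1 ρ_0 σ_1, moving σ_1 to the left yields ρ_{1,2} ρ_{0,1} = ρ_{2,1} ρ_{0,2};
`rhoAt_chain` rewrites the sides as ρ_{0,2} ρ_{0,1} and ρ_{0,1} ρ_{0,2}. -/
theorem rhoAt_comm_same (hn : 3 ≤ n) (x y z : Fin n) (hxy : x ≠ y) (hxz : x ≠ z) (hyz : y ≠ z) :
    rhoAt hn x y * rhoAt hn x z = rhoAt hn x z * rhoAt hn x y := by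
  obtain ⟨g, rfl, rfl, rfl⟩ := exists_perm_three hn x y z hxy hxz hyz
  have b : rhoAt hn ⟨1, by omega⟩ ⟨2, by omega⟩ * rhoAt hn ⟨0, by omega⟩ ⟨1, by omega⟩ =
      rhoAt hn ⟨1, by omega⟩ ⟨2, by omega⟩ * rhoAt hn ⟨0, by omega⟩ ⟨1, by omega⟩ *
      perm hn (swap ⟨1, by omega⟩ ⟨2, by omega⟩) := by
    rw [perm_swap hn 1 (by omega), rhoAt_succ hn 0 (by omega), rhoAt_succ hn 1 (by omega)]
    exact (rel (.rho_succ_rho₁ 0 (by omega))).trans (rel (.rho_succ_rho₂ 0 (by omega)))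
  have c := perm_mul_rhoAt hn (swap ⟨1, by omega⟩ ⟨2, by omega⟩) ⟨0, by omega⟩ ⟨2, by omega⟩
  rw [swap_apply_right, swap_apply_of_ne_of_ne (by simp) (by simp)] at c
  rw [mul_assoc, ← c, ← mul_assoc, rhoAt_swap hn _ _ (by simp),
    rhoAt_chain hn _ _ _ (by simp) (by simp) (by simp),
    rhoAt_chain hn _ _ _ (by simp) (by simp) (by simp)] at b
  simpa only [map_mul, conj_rhoAt] using congrArg (conj (perm hn) g) b.symm

theorem eAt_mul_self (hn : 3 ≤ n) (x : Fin n) : eAt hn x * eAt hn x = eAt hn x := by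
  rw [eAt_eq]
  exact rel (.e_sq _ _)

theorem eAt_comm (hn : 3 ≤ n) (x y : Fin n) : eAt hn x * eAt hn y = eAt hn y * eAt hn x := by
  by_cases hxy : x = y
  · rw [hxy]
  obtain ⟨g, rfl, rfl⟩ := exists_perm_two hn x y hxy
  have b : eAt hn ⟨0, by omega⟩ * eAt hn ⟨1, by omega⟩ =
      eAt hn ⟨1, by omega⟩ * eAt hn ⟨0, by omega⟩ := by
    rw [eAt_eq, eAt_eq]
    exact rel (.e_e_succ 0 (by omega))
  simpa only [map_mul, conj_eAt] using congrArg (conj (perm hn) g) b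

/-- At the points 0 and 1 this holds because e_0 e_1 = λ_0² and λ_0 absorbs σ_0 on the right. -/
theorem eAt_mul_eAt_swap (hn : 3 ≤ n) (x y : Fin n) (hxy : x ≠ y) :
    eAt hn x * eAt hn y * perm hn (swap x y) = eAt hn x * eAt hn y := by
  obtain ⟨g, rfl, rfl⟩ := exists_perm_two hn x y hxy
  have b : eAt hn ⟨0, by omega⟩ * eAt hn ⟨1, by omega⟩ *
      perm hn (swap ⟨0, by omega⟩ ⟨1, by omega⟩) =
      eAt hn ⟨0, by omega⟩ * eAt hn ⟨1, by omega⟩ := by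
    have e : (gen (.e 0 (by omega)) : S n) * gen (.e 1 (by omega)) =
        gen (.lam 0 (by omega)) * gen (.lam 0 (by omega)) :=
      (rel (.e_e_succ 0 (by omega))).trans (rel (.lam_sq 0 (by omega)))
    have l : (gen (.lam 0 (by omega)) : S n) * gen (.sigma 0 (by omega)) =
        gen (.lam 0 (by omega)) :=
      rel (.lam_sigma 0 (by omega))
    rw [eAt_eq, eAt_eq, perm_swap hn 0 (by omega), e, mul_assoc, l]
  simpa only [map_mul, conj_eAt, conj_perm_swap] using congrArg (conj (perm hn) g) b

theorem rhoAt_mul_eAt (hn : 3 ≤ n) (x y : Fin n) (hxy : x ≠ y) :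
    rhoAt hn x y * eAt hn y = rhoAt hn x y := by
  obtain ⟨g, rfl, rfl⟩ := exists_perm_two hn x y hxy
  have b : rhoAt hn ⟨0, by omega⟩ ⟨1, by omega⟩ * eAt hn ⟨1, by omega⟩ =
      rhoAt hn ⟨0, by omega⟩ ⟨1, by omega⟩ := by
    rw [rhoAt_succ hn 0 (by omega), eAt_eq]
    exact rel (.rho_e_succ 0 (by omega))
  simpa only [map_mul, conj_rhoAt, conj_eAt] using congrArg (conj (perm hn) g) b

theorem rhoAt_mul_eAt_left (hn : 3 ≤ n) (x y : Fin n) (hxy : x ≠ y) :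
    rhoAt hn x y * eAt hn x = eAt hn x * eAt hn y := by
  obtain ⟨g, rfl, rfl⟩ := exists_perm_two hn x y hxy
  have b : rhoAt hn ⟨0, by omega⟩ ⟨1, by omega⟩ * eAt hn ⟨0, by omega⟩ =
      eAt hn ⟨0, by omega⟩ * eAt hn ⟨1, by omega⟩ := by
    rw [rhoAt_succ hn 0 (by omega), eAt_eq, eAt_eq]
    exact (rel (.e_rho₁ 0 (by omega))).trans
      ((rel (.e_rho₂ 0 (by omega))).trans (rel (.e_rho₃ 0 (by omega))))
  simpa only [map_mul, conj_rhoAt, conj_eAt] using congrArg (conj (perm hn) g) b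

theorem eAt_left_mul_rhoAt (hn : 3 ≤ n) (x y : Fin n) (hxy : x ≠ y) :
    eAt hn x * rhoAt hn x y = eAt hn x * eAt hn y := by
  obtain ⟨g, rfl, rfl⟩ := exists_perm_two hn x y hxy
  have b : eAt hn ⟨0, by omega⟩ * rhoAt hn ⟨0, by omega⟩ ⟨1, by omega⟩ =
      eAt hn ⟨0, by omega⟩ * eAt hn ⟨1, by omega⟩ := by
    rw [rhoAt_succ hn 0 (by omega), eAt_eq, eAt_eq]
    exact rel (.e_rho₃ 0 (by omega))
  simpa only [map_mul, conj_rhoAt, conj_eAt] using congrArg (conj (perm hn) g) b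

theorem eAt_mul_rhoAt (hn : 3 ≤ n) (x y : Fin n) (hxy : x ≠ y) :
    eAt hn y * rhoAt hn x y = eAt hn x * eAt hn y := by
  obtain ⟨g, rfl, rfl⟩ := exists_perm_two hn x y hxy
  have b : eAt hn ⟨1, by omega⟩ * rhoAt hn ⟨0, by omega⟩ ⟨1, by omega⟩ =
      eAt hn ⟨0, by omega⟩ * eAt hn ⟨1, by omega⟩ := by
    rw [rhoAt_succ hn 0 (by omega), eAt_eq, eAt_eq]
    exact (rel (.e_rho₂ 0 (by omega))).trans (rel (.e_rho₃ 0 (by omega)))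
  simpa only [map_mul, conj_rhoAt, conj_eAt] using congrArg (conj (perm hn) g) b

theorem eAt_rhoAt_comm (hn : 3 ≤ n) (x y z : Fin n) (hxy : x ≠ y) (hxz : x ≠ z) (hyz : y ≠ z) :
    eAt hn z * rhoAt hn x y = rhoAt hn x y * eAt hn z := by
  obtain ⟨g, rfl, rfl, rfl⟩ := exists_perm_three hn x y z hxy hxz hyz
  have b : eAt hn ⟨2, by omega⟩ * rhoAt hn ⟨0, by omega⟩ ⟨1, by omega⟩ =
      rhoAt hn ⟨0, by omega⟩ ⟨1, by omega⟩ * eAt hn ⟨2, by omega⟩ := by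
    rw [rhoAt_succ hn 0 (by omega), eAt_eq]
    exact rel (.e_rho_comm 2 0 (by omega) (by omega) (by omega) (by omega))
  simpa only [map_mul, conj_rhoAt, conj_eAt] using congrArg (conj (perm hn) g) b

theorem star_rhoAt_mul_rhoAt (hn : 3 ≤ n) (x y : Fin n) (hxy : x ≠ y) :
    star (rhoAt hn x y) * rhoAt hn x y = eAt hn y := by
  obtain ⟨g, rfl, rfl⟩ := exists_perm_two hn x y hxy
  have b : star (rhoAt hn ⟨0, by omega⟩ ⟨1, by omega⟩) * rhoAt hn ⟨0, by omega⟩ ⟨1, by omega⟩ =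
      eAt hn ⟨1, by omega⟩ := by
    rw [rhoAt_succ hn 0 (by omega), eAt_eq]
    exact (rel (.e_succ 0 (by omega))).symm
  simpa only [map_mul, conj_rhoAt, conj_eAt, conj_star_rhoAt] using congrArg (conj (perm hn) g) b

theorem star_rhoAt_mul_swap (hn : 3 ≤ n) (x y : Fin n) (hxy : x ≠ y) :
    star (rhoAt hn x y) * perm hn (swap x y) = star (rhoAt hn x y) := by
  have := congrArg star (swap_mul_rhoAt hn x y hxy)
  rwa [star_mul, star_perm, swap_inv] at this

/-- The defining relation reads λ_{0,1} ρ_{1,2} = ρ_{0,2} λ_{0,1}. Writing λ_{0,1} as λ_{0,1} σ_0 on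
both sides turns ρ_{1,2} into ρ_{0,2}, and σ_0 cancels on the right. -/
theorem star_rhoAt_mul_rhoAt_same (hn : 3 ≤ n) (x y z : Fin n) (hxy : x ≠ y) (hxz : x ≠ z)
    (hyz : y ≠ z) : star (rhoAt hn x y) * rhoAt hn x z = rhoAt hn x z * star (rhoAt hn x y) := by
  obtain ⟨g, rfl, rfl, rfl⟩ := exists_perm_three hn x y z hxy hxz hyz
  have b : star (rhoAt hn ⟨0, by omega⟩ ⟨1, by omega⟩) * rhoAt hn ⟨1, by omega⟩ ⟨2, by omega⟩ =
      conj (perm hn) (swap ⟨0, by omega⟩ ⟨1, by omega⟩) (rhoAt hn ⟨1, by omega⟩ ⟨2, by omega⟩) *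
      star (rhoAt hn ⟨0, by omega⟩ ⟨1, by omega⟩) := by
    rw [conj_swap hn 0 (by omega), rhoAt_succ hn 0 (by omega), rhoAt_succ hn 1 (by omega)]
    exact (rel (.lam_rho_succ₁ 0 (by omega))).trans (rel (.lam_rho_succ₂ 0 (by omega)))
  have c := perm_mul_rhoAt hn (swap ⟨0, by omega⟩ ⟨1, by omega⟩) ⟨1, by omega⟩ ⟨2, by omega⟩
  rw [conj_rhoAt] at b
  rw [swap_apply_right, swap_apply_of_ne_of_ne (by simp) (by simp)] at b c
  rw [← star_rhoAt_mul_swap hn _ _ (by simp), mul_assoc, c, ← mul_assoc, ← mul_assoc] at b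
  have b' := congrArg (fun a => a * perm hn (swap ⟨0, by omega⟩ ⟨1, by omega⟩)) b
  simp only [mul_assoc, ← map_mul, swap_mul_self, map_one, mul_one] at b'
  simpa only [map_mul, conj_rhoAt, conj_star_rhoAt] using congrArg (conj (perm hn) g) b'

theorem star_rhoAt_rhoAt_comm (hn : 3 ≤ n) (x y z w : Fin n) (hxy : x ≠ y) (hxz : x ≠ z)
    (hxw : x ≠ w) (hyz : y ≠ z) (hyw : y ≠ w) (hzw : z ≠ w) :
    star (rhoAt hn x y) * rhoAt hn z w = rhoAt hn z w * star (rhoAt hn x y) := by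
  obtain ⟨h, g, rfl, rfl, rfl, rfl⟩ := exists_perm_four x y z w hxy hxz hxw hyz hyw hzw
  have b : star (rhoAt hn ⟨0, by omega⟩ ⟨1, by omega⟩) * rhoAt hn ⟨2, by omega⟩ ⟨3, by omega⟩ =
      rhoAt hn ⟨2, by omega⟩ ⟨3, by omega⟩ * star (rhoAt hn ⟨0, by omega⟩ ⟨1, by omega⟩) := by
    rw [rhoAt_succ hn 0 (by omega), rhoAt_succ hn 2 (by omega)]
    exact (rel (.rho_lam_comm 2 0 (by omega) (by omega) (.inr (by omega)))).symm
  simpa only [map_mul, conj_rhoAt, conj_star_rhoAt] using congrArg (conj (perm hn) g) b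

/-- The presented monoid as a frame on `Fin n`. -/
noncomputable def frame (hn : 3 ≤ n) : Frame (Fin n) (S n) where
  π := perm hn
  ρ := rhoAt hn
  e := eAt hn
  star := star
  star_mul := star_mul
  star_star := star_star
  star_π := star_perm hn
  star_e := star_eAt hn
  π_ρ := perm_mul_rhoAt hn
  π_e := perm_mul_eAt hn
  swap_ρ := swap_mul_rhoAt hn
  ρ_comm := rhoAt_comm hn
  ρ_comm_same := rhoAt_comm_same hn
  ρ_chain := rhoAt_chain hn
  e_mul_self := eAt_mul_self hn
  e_comm := eAt_comm hn
  e_e_swap := eAt_mul_eAt_swap hn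
  ρ_e := rhoAt_mul_eAt hn
  ρ_e_left := rhoAt_mul_eAt_left hn
  e_ρ_left := eAt_left_mul_rhoAt hn
  e_ρ := eAt_mul_rhoAt hn
  e_ρ_comm := eAt_rhoAt_comm hn
  lam_ρ := star_rhoAt_mul_rhoAt hn
  lam_ρ_same := star_rhoAt_mul_rhoAt_same hn
  lam_ρ_comm := star_rhoAt_rhoAt_comm hn


/-! ### Partial retractions and operations on their classes. -/

/-- A partial map whose values are fixed points; the fixed points represent the classes of a
partition of a subset of `X`. -/
structure Retr (X : Type*) where
  toFun : X → Option X
  idem : ∀ x y, toFun x = some y → toFun y = some y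

namespace Retr

variable {X : Type*}

instance : CoeFun (Retr X) (fun _ => X → Option X) := ⟨toFun⟩

theorem ext_apply {f f' : Retr X} (h : ∀ x, f x = f' x) : f = f' := by
  cases f
  cases f'
  congr
  exact funext h

variable [DecidableEq X]

/-- Make the class represented by `x` undefined. -/
def kill (x : X) (f : Retr X) : Retr X where
  toFun z := if f z = some x then none else f z
  idem := by
    intro z y h
    by_cases hz : f z = some x
    · simp [hz] at h
    · simp only [hz, if_false] at h
      have hy := f.idem _ _ h
      rw [hy, if_neg]
      rwa [← h]

/-- Merge the class represented by `y` into the class represented by `x`. -/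
def merge (x y : X) (f : Retr X) (hx : f x = some x) (hxy : x ≠ y) : Retr X where
  toFun z := if f z = some y then some x else f z
  idem := by
    intro z w h
    by_cases hz : f z = some y
    · simp only [hz, if_true, Option.some.injEq] at h
      subst h
      rw [hx, if_neg (by simpa using hxy)]
    · simp only [hz, if_false] at h
      have hy := f.idem _ _ h
      rw [hy, if_neg]
      rwa [← h]

/-- Replace the representative `x` of a class by `y`. -/
def changeRep (x y : X) (f : Retr X) (hy : f y = some x) : Retr X where
  toFun z := if f z = some x then some y else f z
  idem := by
    intro z w h
    by_cases hz : f z = some x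
    · simp only [hz, if_true, Option.some.injEq] at h
      subst h
      rw [hy, if_pos rfl]
    · simp only [hz, if_false] at h
      have hy := f.idem _ _ h
      rw [hy, if_neg]
      rwa [← h]

theorem kill_apply (x : X) (f : Retr X) (z : X) :
    kill x f z = if f z = some x then none else f z := rfl

theorem merge_apply (x y : X) (f : Retr X) (hx : f x = some x) (hxy : x ≠ y) (z : X) :
    merge x y f hx hxy z = if f z = some y then some x else f z := rfl

theorem changeRep_apply (x y : X) (f : Retr X) (hy : f y = some x) (z : X) :
    changeRep x y f hy z = if f z = some x then some y else f z := rfl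

theorem kill_of_not_fixed {x : X} {f : Retr X} (hx : f x ≠ some x) : kill x f = f := by
  refine ext_apply fun z => ?_
  rw [kill_apply, if_neg]
  exact fun hz => hx (f.idem _ _ hz)

end Retr

/-- The factor c is brought next to each a x, turns it into b x, and commutes back out. All
computations of R f times a generator use this device. -/
theorem noncommProd_mul_congr {X M : Type*} [DecidableEq X] [Monoid M] (T : Finset X) (a b : X → M)
    (ha : (T : Set X).Pairwise (Function.onFun Commute a))
    (hb : (T : Set X).Pairwise (Function.onFun Commute b)) (c : M)
    (h : ∀ x ∈ T, a x * c = b x * c) (hc : ∀ x ∈ T, b x * c = c * b x) :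
    T.noncommProd a ha * c = T.noncommProd b hb * c := by
  induction T using Finset.induction_on with
  | empty => simp
  | insert x T hx ih =>
    rw [Finset.noncommProd_insert_of_notMem' _ _ _ _ hx,
      Finset.noncommProd_insert_of_notMem' _ _ _ _ hx, mul_assoc, h x (by simp),
      hc x (by simp), ← mul_assoc, ih _ _ (fun z hz => h z (by simp [hz]))
        (fun z hz => hc z (by simp [hz])), mul_assoc, mul_assoc, hc x (by simp)]

/-! ### Commuting factors, and moving λ's to the right. -/

namespace Frame

variable {X M : Type*} [DecidableEq X] [Monoid M] (F : Frame X M)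

theorem ρ_swap (x y : X) (hxy : x ≠ y) : F.ρ x y * F.π (swap x y) = F.ρ y x := by
  have := F.π_ρ (swap x y) y x
  rw [swap_apply_left, swap_apply_right, swap_comm, F.swap_ρ y x hxy.symm, swap_comm] at this
  exact this.symm

/-- The factor of the product `R f` at `x`. -/
def factor (f : Retr X) (x : X) : M :=
  match f x with
  | none => F.e x
  | some y => if y = x then 1 else F.ρ y x

theorem factor_none {f : Retr X} {x : X} (h : f x = none) : F.factor f x = F.e x := by
  rw [factor, h]

theorem factor_fixed {f : Retr X} {x : X} (h : f x = some x) : F.factor f x = 1 := by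
  rw [factor, h]
  simp

theorem factor_some {f : Retr X} {x y : X} (h : f x = some y) (hy : y ≠ x) :
    F.factor f x = F.ρ y x := by
  rw [factor, h]
  simp [hy]

theorem factor_cases (f : Retr X) (x : X) : (f x = none ∧ F.factor f x = F.e x) ∨
    (f x = some x ∧ F.factor f x = 1) ∨
    ∃ y, f x = some y ∧ f y = some y ∧ y ≠ x ∧ F.factor f x = F.ρ y x := by
  rcases h : f x with _ | y
  · exact .inl ⟨rfl, F.factor_none h⟩
  · by_cases hy : y = x
    · subst hy
      exact .inr (.inl ⟨rfl, F.factor_fixed h⟩)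
    · exact .inr (.inr ⟨y, rfl, f.idem _ _ h, hy, F.factor_some h hy⟩)

/-- Representatives are fixed points of f, so a point merged or killed by one factor is never the
representative used by another; only commuting configurations of indices occur. -/
theorem factor_comm (f : Retr X) (x y : X) (hxy : x ≠ y) :
    F.factor f x * F.factor f y = F.factor f y * F.factor f x := by
  rcases F.factor_cases f x with ⟨h1, e1⟩ | ⟨h1, e1⟩ | ⟨a, h1, h1', h1'', e1⟩ <;>
  rcases F.factor_cases f y with ⟨h2, e2⟩ | ⟨h2, e2⟩ | ⟨b, h2, h2', h2'', e2⟩ <;> rw [e1, e2]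
  · exact F.e_comm x y
  · simp
  · exact F.e_ρ_comm b y x h2'' (by grind) hxy.symm
  · simp
  · simp
  · exact (F.e_ρ_comm a x y h1'' (by grind) hxy).symm
  · simp
  · by_cases hab : a = b
    · subst hab
      exact F.ρ_comm_same a x y h1'' h2'' hxy
    · exact F.ρ_comm a x b y h1'' hab (by grind) (by grind) hxy h2''

theorem factor_pairwise (f : Retr X) (T : Finset X) :
    (T : Set X).Pairwise (Function.onFun Commute (F.factor f)) :=
  fun x _ y _ hxy => F.factor_comm f x y hxy

/-- The product of the factors of `f` over a set. -/
def partialR (f : Retr X) (T : Finset X) : M := T.noncommProd (F.factor f) (F.factor_pairwise f T)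

theorem partialR_erase (f : Retr X) {T : Finset X} {x : X} (hx : x ∈ T) :
    F.partialR f T = F.partialR f (T.erase x) * F.factor f x :=
  (Finset.noncommProd_erase_mul T hx _ _).symm

/-- The submonoid generated by permutations, the `ρ x y` and the `e x`. -/
def right : Submonoid M :=
  Submonoid.closure ({a | ∃ g, a = F.π g} ∪ {a | ∃ x, a = F.e x} ∪
    {a | ∃ x y, x ≠ y ∧ a = F.ρ x y})

theorem π_mem_right (g : Perm X) : F.π g ∈ F.right :=
  Submonoid.subset_closure (.inl (.inl ⟨g, rfl⟩))

theorem e_mem_right (x : X) : F.e x ∈ F.right :=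
  Submonoid.subset_closure (.inl (.inr ⟨x, rfl⟩))

theorem ρ_mem_right {x y : X} (hxy : x ≠ y) : F.ρ x y ∈ F.right :=
  Submonoid.subset_closure (.inr ⟨x, y, hxy, rfl⟩)

/-- The element `λ x y` times `a` is in `right`, or an element of `right` times some `λ x' y'`. -/
def Absorbs (x y : X) (a : M) : Prop :=
  F.star (F.ρ x y) * a ∈ F.right ∨
    ∃ r ∈ F.right, ∃ x' y', x' ≠ y' ∧ F.star (F.ρ x y) * a = r * F.star (F.ρ x' y')

theorem star_ρ_mul_π (x y : X) (g : Perm X) :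
    F.star (F.ρ x y) * F.π g = F.π g * F.star (F.ρ (g⁻¹ x) (g⁻¹ y)) := by
  have := congrArg F.star (F.π_ρ g⁻¹ x y)
  rw [F.star_mul, F.star_mul, F.star_π, inv_inv] at this
  exact this

theorem star_ρ_mul_swap (x y : X) (hxy : x ≠ y) :
    F.star (F.ρ x y) * F.π (swap x y) = F.star (F.ρ x y) := by
  have := congrArg F.star (F.swap_ρ x y hxy)
  rwa [F.star_mul, F.star_π, swap_inv] at this

/-- After passing a, the λ has either vanished or acquired new indices, and in the latter case it
must still pass b; hence the hypothesis on b covers all pairs of indices. -/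
theorem absorbs_mul {x y : X} {a b : M} (ha : F.Absorbs x y a) (hb : b ∈ F.right)
    (h : ∀ x' y', x' ≠ y' → F.Absorbs x' y' b) : F.Absorbs x y (a * b) := by
  obtain ha | ⟨r, hr, x', y', hxy', e⟩ := ha
  · exact .inl (by rw [← mul_assoc]; exact mul_mem ha hb)
  · obtain h | ⟨r', hr', x'', y'', hxy'', e'⟩ := h x' y' hxy'
    · exact .inl (by rw [← mul_assoc, e, mul_assoc]; exact mul_mem hr h)
    · exact .inr ⟨r * r', mul_mem hr hr', x'', y'', hxy'', by
        rw [← mul_assoc, e, mul_assoc, e', mul_assoc]⟩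

theorem absorbs_π (x y : X) (hxy : x ≠ y) (g : Perm X) : F.Absorbs x y (F.π g) :=
  .inr ⟨_, F.π_mem_right g, _, _, g⁻¹.injective.ne hxy, F.star_ρ_mul_π x y g⟩

theorem absorbs_e (x y : X) (hxy : x ≠ y) (z : X) : F.Absorbs x y (F.e z) := by
  by_cases hx : x = z
  · subst hx
    refine .inl ?_
    have := congrArg F.star (F.e_ρ_left x y hxy)
    rw [F.star_mul, F.star_mul, F.star_e, F.star_e] at this
    rw [this]
    exact mul_mem (F.e_mem_right _) (F.e_mem_right _)
  by_cases hy : y = z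
  · subst hy
    refine .inl ?_
    have := congrArg F.star (F.e_ρ x y hxy)
    rw [F.star_mul, F.star_mul, F.star_e, F.star_e] at this
    rw [this]
    exact mul_mem (F.e_mem_right _) (F.e_mem_right _)
  · refine .inr ⟨_, F.e_mem_right z, x, y, hxy, ?_⟩
    have := congrArg F.star (F.e_ρ_comm x y z hxy hx hy)
    rwa [F.star_mul, F.star_mul, F.star_e] at this

/-- λ_{x,y} absorbs the transposition (x y) on its right, which allows y to be traded for x in the
following ρ. -/
theorem star_ρ_mul_ρ_left (x y w : X) (hxy : x ≠ y) (hxw : x ≠ w) (hyw : y ≠ w) :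
    F.star (F.ρ x y) * F.ρ y w = F.ρ x w * F.star (F.ρ x y) := by
  have := F.π_ρ (swap x y) y w
  rw [swap_apply_right, swap_apply_of_ne_of_ne hxw.symm hyw.symm] at this
  rw [← F.star_ρ_mul_swap x y hxy, mul_assoc, this, ← mul_assoc, F.lam_ρ_same x y w hxy hxw hyw,
    mul_assoc]

theorem absorbs_ρ (x y : X) (hxy : x ≠ y) (z w : X) (hzw : z ≠ w) : F.Absorbs x y (F.ρ z w) := by
  have base : ∀ z w, z ≠ w → z = x ∨ z = y → F.Absorbs x y (F.ρ z w) := by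
    rintro z w hzw (rfl | rfl)
    · by_cases hw : y = w
      · subst hw
        exact .inl (by rw [F.lam_ρ z y hxy]; exact F.e_mem_right y)
      · exact .inr ⟨_, F.ρ_mem_right hzw, z, y, hxy, F.lam_ρ_same z y w hxy hzw hw⟩
    · by_cases hw : x = w
      · subst hw
        refine .inl ?_
        rw [← F.ρ_swap x z hxy, ← mul_assoc, F.lam_ρ x z hxy]
        exact mul_mem (F.e_mem_right z) (F.π_mem_right _)
      · exact .inr ⟨_, F.ρ_mem_right hw, x, z, hxy, F.star_ρ_mul_ρ_left x z w hxy hw hzw⟩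
  by_cases hz : z = x ∨ z = y
  · exact base z w hzw hz
  -- If only the second index meets {x, y}, then ρ_{z,w} = ρ_{w,z} (w z) reduces to the case of the
  -- first index.
  by_cases hw : w = x ∨ w = y
  · rw [← F.ρ_swap w z hzw.symm]
    exact F.absorbs_mul (base w z hzw.symm hw) (F.π_mem_right _)
      (fun x' y' h' => F.absorbs_π x' y' h' _)
  · push Not at hz hw
    exact .inr ⟨_, F.ρ_mem_right hzw, x, y, hxy,
      F.lam_ρ_comm x y z w hxy hz.1.symm hw.1.symm hz.2.symm hw.2.symm hzw⟩

theorem absorbs_of_mem_right {a : M} (ha : a ∈ F.right) (x y : X) (hxy : x ≠ y) :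
    F.Absorbs x y a := by
  induction ha using Submonoid.closure_induction_left generalizing x y with
  | one => exact .inr ⟨1, one_mem _, x, y, hxy, by rw [mul_one, one_mul]⟩
  | mul_left a ha b hb ih =>
    refine F.absorbs_mul ?_ hb ih
    obtain (⟨k, rfl⟩ | ⟨z, rfl⟩) | ⟨z, w, hzw, rfl⟩ := ha
    · exact F.absorbs_π x y hxy k
    · exact F.absorbs_e x y hxy z
    · exact F.absorbs_ρ x y hxy z w hzw

/-- Being the product of an element of `right` and the image under the anti-automorphism of an
element of `right`. -/
def IsProduct (a : M) : Prop := ∃ r ∈ F.right, ∃ l ∈ F.right, a = r * F.star l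

theorem isProduct_one : F.IsProduct 1 := by
  have : F.star 1 = 1 := by rw [← map_one F.π, F.star_π, inv_one]
  exact ⟨1, one_mem _, 1, one_mem _, by rw [this, one_mul]⟩

theorem isProduct_mul_of_mem_right {r a : M} (hr : r ∈ F.right) (ha : F.IsProduct a) :
    F.IsProduct (r * a) := by
  obtain ⟨r', hr', l, hl, rfl⟩ := ha
  exact ⟨r * r', mul_mem hr hr', l, hl, (mul_assoc _ _ _).symm⟩

theorem isProduct_star_ρ_mul {x y : X} (hxy : x ≠ y) {a : M} (ha : F.IsProduct a) :
    F.IsProduct (F.star (F.ρ x y) * a) := by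
  obtain ⟨r, hr, l, hl, rfl⟩ := ha
  obtain h | ⟨r', hr', x', y', hxy', e⟩ := F.absorbs_of_mem_right hr x y hxy
  · exact ⟨_, h, l, hl, (mul_assoc _ _ _).symm⟩
  · exact ⟨r', hr', l * F.ρ x' y', mul_mem hl (F.ρ_mem_right hxy'), by
      rw [← mul_assoc, e, F.star_mul, mul_assoc]⟩

/-! ### The collapsing elements R f and the normal form. -/

variable [Fintype X]

/-- The element that collapses every class of `f` to its representative. -/
def R (f : Retr X) : M := F.partialR f Finset.univ

theorem R_erase (f : Retr X) (x : X) :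
    F.R f = F.partialR f (Finset.univ.erase x) * F.factor f x :=
  F.partialR_erase f (Finset.mem_univ x)

theorem R_mul_e_of_not_fixed {f : Retr X} {x : X} (hx : f x ≠ some x) :
    F.R f * F.e x = F.R f := by
  rw [R_erase F f x, mul_assoc]
  congr 1
  rcases F.factor_cases f x with ⟨h1, e1⟩ | ⟨h1, e1⟩ | ⟨a, h1, h1', h1'', e1⟩
  · rw [e1, F.e_mul_self]
  · exact absurd h1 hx
  · rw [e1, F.ρ_e a x h1'']

theorem R_mul_e (f : Retr X) (x : X) : F.R f * F.e x = F.R (Retr.kill x f) := by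
  by_cases hx : f x = some x
  · have hk : Retr.kill x f x = none := by rw [Retr.kill_apply, if_pos hx]
    -- A factor e_x, which R of the killed retraction absorbs, is added so that both sides end in
    -- the same c.
    rw [← F.R_mul_e_of_not_fixed (f := Retr.kill x f) (x := x) (by rw [hk]; simp)]
    refine noncommProd_mul_congr _ _ _ (F.factor_pairwise _ _) (F.factor_pairwise _ _) _
        (fun z _ => ?_) (fun z _ => ?_)
    · by_cases hz : f z = some x
      · have hkz : Retr.kill x f z = none := by rw [Retr.kill_apply, if_pos hz]
        rw [F.factor_none hkz]
        by_cases hxz : x = z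
        · subst hxz
          rw [F.factor_fixed hx, one_mul, F.e_mul_self]
        · rw [F.factor_some hz hxz, F.ρ_e_left x z hxz, F.e_comm]
      · have hkz : Retr.kill x f z = f z := by rw [Retr.kill_apply, if_neg hz]
        rw [factor, factor, hkz]
    · rcases F.factor_cases (Retr.kill x f) z with ⟨h1, e1⟩ | ⟨h1, e1⟩ | ⟨a, h1, h1', h1'', e1⟩ <;>
        rw [e1]
      · exact F.e_comm z x
      · simp
      · exact (F.e_ρ_comm a z x h1'' (by grind) (by grind)).symm
  · rw [F.R_mul_e_of_not_fixed hx, Retr.kill_of_not_fixed hx]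

/-- ρ_{x,y} becomes the factor at y, which was 1 before, and the chain relation redirects every
ρ_{y,z} to ρ_{x,z}. -/
theorem R_mul_ρ {f : Retr X} {x y : X} (hx : f x = some x) (hy : f y = some y) (hxy : x ≠ y) :
    F.R f * F.ρ x y = F.R (Retr.merge x y f hx hxy) := by
  have hm : Retr.merge x y f hx hxy y = some x := by rw [Retr.merge_apply, if_pos hy]
  rw [R_erase F f y, F.factor_fixed hy, mul_one, R_erase F _ y, F.factor_some hm hxy]
  refine noncommProd_mul_congr _ _ _ (F.factor_pairwise _ _) (F.factor_pairwise _ _) _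
      (fun z hz => ?_) (fun z hz => ?_)
  · have hzy : z ≠ y := Finset.ne_of_mem_erase hz
    by_cases hfz : f z = some y
    · have hmz : Retr.merge x y f hx hxy z = some x := by rw [Retr.merge_apply, if_pos hfz]
      have hxz : x ≠ z := by
        rintro rfl
        rw [hx] at hfz
        exact hzy (Option.some.inj hfz)
      rw [F.factor_some hfz hzy.symm, F.factor_some hmz hxz, F.ρ_chain x y z hxy hxz hzy.symm]
    · have hmz : Retr.merge x y f hx hxy z = f z := by rw [Retr.merge_apply, if_neg hfz]
      rw [factor, factor, hmz]
  · have hzy : z ≠ y := Finset.ne_of_mem_erase hz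
    rcases F.factor_cases (Retr.merge x y f hx hxy) z with
      ⟨h1, e1⟩ | ⟨h1, e1⟩ | ⟨a, h1, h1', h1'', e1⟩ <;> rw [e1]
    · exact F.e_ρ_comm x y z hxy (by grind [Retr.merge_apply]) hzy.symm
    · simp
    · by_cases hax : a = x
      · subst hax
        exact F.ρ_comm_same a z y h1'' hxy hzy
      · exact F.ρ_comm a z x y h1'' hax (by grind [Retr.merge_apply]) (by grind [Retr.merge_apply])
          hzy hxy

/-- The factor ρ_{x,y} at y equals ρ_{y,x} (x y), and in its presence the chain relation allows
either representative in the other factors of the class. -/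
theorem R_changeRep {f : Retr X} {x y : X} (hy : f y = some x) (hxy : x ≠ y) :
    F.R f = F.R (Retr.changeRep x y f hy) * F.π (swap x y) := by
  have hx := f.idem _ _ hy
  have hcx : Retr.changeRep x y f hy x = some y := by rw [Retr.changeRep_apply, if_pos hx]
  have hcy : Retr.changeRep x y f hy y = some y := by rw [Retr.changeRep_apply, if_pos hy]
  rw [R_erase F f y, F.partialR_erase f (T := Finset.univ.erase y) (x := x) (by simp [hxy]),
      F.factor_fixed hx, mul_one,
    F.factor_some hy hxy, R_erase F _ x, F.partialR_erase _ (T := Finset.univ.erase x) (x := y)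
        (by simp [hxy.symm]),
    F.factor_fixed hcy, mul_one, F.factor_some hcx hxy.symm, mul_assoc, swap_comm,
    F.ρ_swap y x hxy.symm, Finset.erase_right_comm]
  refine (noncommProd_mul_congr _ _ _ (F.factor_pairwise _ _) (F.factor_pairwise _ _) _
      (fun z hz => ?_) (fun z hz => ?_)).symm
  · simp only [Finset.mem_erase, Finset.mem_univ, and_true] at hz
    by_cases hfz : f z = some x
    · have hcz : Retr.changeRep x y f hy z = some y := by rw [Retr.changeRep_apply, if_pos hfz]
      rw [F.factor_some hfz hz.2.symm, F.factor_some hcz hz.1.symm,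
        F.ρ_chain x y z hxy hz.2.symm hz.1.symm]
    · have hcz : Retr.changeRep x y f hy z = f z := by rw [Retr.changeRep_apply, if_neg hfz]
      rw [factor, factor, hcz]
  · simp only [Finset.mem_erase, Finset.mem_univ, and_true] at hz
    rcases F.factor_cases f z with ⟨h1, e1⟩ | ⟨h1, e1⟩ | ⟨a, h1, h1', h1'', e1⟩ <;> rw [e1]
    · exact F.e_ρ_comm x y z hxy hz.2.symm hz.1.symm
    · simp
    · by_cases hax : a = x
      · subst hax
        exact F.ρ_comm_same a z y h1'' hxy hz.1
      · exact F.ρ_comm a z x y h1'' hax (by grind) hz.2 hz.1 hxy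

/-- R f absorbs e_x for every x that is not a representative, and e_x e_y absorbs the transposition
(x y). -/
theorem R_mul_π_of_fix {f : Retr X} (g : Perm X) (hg : ∀ x, f x = some x → g x = x) :
    F.R f * F.π g = F.R f := by
  have : g ∈ ({ carrier := {g | F.R f * F.π g = F.R f}
                one_mem' := by simp
                mul_mem' := fun {g h} hg hh => by
                  simp only [Set.mem_ofPred_eq] at *
                  rw [map_mul, ← mul_assoc, hg, hh] } : Submonoid (Perm X)) := by
    refine mem_of_forall_swap_mem _ (fun x => f x ≠ some x) (fun x y hx hy hxy => ?_) g
      (fun x hx => hg x (not_not.1 hx))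
    change F.R f * F.π _ = F.R f
    rw [← F.R_mul_e_of_not_fixed hx, ← F.R_mul_e_of_not_fixed hy, mul_assoc (F.R f), F.e_comm,
      mul_assoc, F.e_e_swap x y hxy]
  exact this

/-- Two retractions with the same domain and the same classes. -/
def SameKer (f f' : Retr X) : Prop :=
  (∀ z, f z = none ↔ f' z = none) ∧ ∀ z w, f z = f w ↔ f' z = f' w

/-- Only the representatives differ. Changing one of them at a time lowers the number of points
where f and f' disagree, and the transpositions collect into k. -/
theorem exists_R_eq (f f' : Retr X) (h : SameKer f f') : ∃ k : Perm X, F.R f = F.R f' * F.π k := by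
  induction hk : (Finset.univ.filter fun z => f z ≠ f' z).card using Nat.strong_induction_on
    generalizing f with
  | _ k ih =>
    by_cases hff : ∀ z, f z = f' z
    · rw [Retr.ext_apply hff]
      exact ⟨1, by simp⟩
    · push Not at hff
      obtain ⟨z, hz⟩ := hff
      obtain ⟨x, hx⟩ : ∃ x, f z = some x := by
        rcases hfz : f z with _ | x
        · exact absurd (hfz.trans ((h.1 z).1 hfz).symm) hz
        · exact ⟨x, rfl⟩
      obtain ⟨y, hy⟩ : ∃ y, f' z = some y := by
        rcases hfz : f' z with _ | y
        · rw [(h.1 z).2 hfz] at hx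
          cases hx
        · exact ⟨y, rfl⟩
      have hfy : f y = some x := by
        rw [← hx, h.2, hy]
        exact f'.idem _ _ hy
      have hxy : x ≠ y := by
        rintro rfl
        exact hz (hx.trans hy.symm)
      have agree : ∀ w, f w = some x → f' w = some y := fun w hw => by
        rw [← hy, ← h.2, hx, hw]
      -- The new representative y was not a value of f before, so changing representatives does not
      -- identify two classes.
      have hy' : ∀ w, f w ≠ some y := fun w hw => by
        have := f.idem _ _ hw
        rw [hfy] at this
        exact hxy (Option.some.inj this)
      have hs : SameKer (Retr.changeRep x y f hfy) f' := by
        refine ⟨fun w => ?_, fun w v => ?_⟩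
        · rw [← h.1, Retr.changeRep_apply]
          split_ifs with hw <;> simp [hw]
        · rw [← h.2, Retr.changeRep_apply, Retr.changeRep_apply]
          split_ifs with hw hv hv
          · simp [hw, hv]
          · simp [hw, (hy' v).symm, Ne.symm hv]
          · simp [hv, hy' w, hw]
          · rfl
      obtain ⟨k', hk'⟩ := ih _ (by
        rw [← hk]
        refine Finset.card_lt_card (Finset.ssubset_iff_of_subset ?_ |>.2 ⟨z, by simpa using hz, ?_⟩)
        · intro w hw
          rw [Finset.mem_filter, Retr.changeRep_apply] at hw
          rw [Finset.mem_filter]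
          refine ⟨Finset.mem_univ w, ?_⟩
          by_cases hwx : f w = some x
          · rw [if_pos hwx] at hw
            exact absurd (agree w hwx).symm hw.2
          · rw [if_neg hwx] at hw
            exact hw.2
        · exact fun hw => (Finset.mem_filter.1 hw).2
            (by rw [Retr.changeRep_apply, if_pos hx, hy])) _ hs rfl
      exact ⟨k' * swap x y, by rw [F.R_changeRep hfy hxy, hk', map_mul, mul_assoc]⟩

/-- The normal form attached to two retractions and a permutation. -/
def normalForm (f : Retr X) (g : Perm X) (h : Retr X) : M := F.R f * F.π g * F.star (F.R h)

/-- The permutation `g` takes the fixed points of `h` to those of `f`. -/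
def Matched (f : Retr X) (g : Perm X) (h : Retr X) : Prop :=
  ∀ y, f (g y) = some (g y) ↔ h y = some y

theorem e_mul_star_R (h : Retr X) (x : X) :
    F.e x * F.star (F.R h) = F.star (F.R (Retr.kill x h)) := by
  rw [← F.R_mul_e, F.star_mul, F.star_e]

/-- The idempotent that kills the class travels through π g, from e_{g y} on the left to e_y on the
right. -/
theorem normalForm_kill (f : Retr X) (g : Perm X) (h : Retr X) (y : X) :
    F.normalForm (Retr.kill (g y) f) g h = F.normalForm f g (Retr.kill y h) := by
  rw [normalForm, normalForm, ← F.e_mul_star_R, ← F.R_mul_e, mul_assoc (F.R f), ← F.π_e]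
  simp only [mul_assoc]

theorem card_fixed_kill_lt {f : Retr X} {x : X} (hx : f x = some x) :
    (Finset.univ.filter fun z => Retr.kill x f z = some z).card <
      (Finset.univ.filter fun z => f z = some z).card := by
  refine Finset.card_lt_card (Finset.ssubset_iff_of_subset ?_ |>.2 ⟨x, by simpa using hx, ?_⟩)
  · intro w hw
    rw [Finset.mem_filter, Retr.kill_apply] at hw
    rw [Finset.mem_filter]
    split_ifs at hw
    · cases hw.2
    · exact hw
  · intro hw
    rw [Finset.mem_filter, Retr.kill_apply, if_pos hx] at hw
    cases hw.2

/-- If exactly one of g y and y is a representative, killing does nothing on the side where it is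
not, so by `normalForm_kill` its class may be killed on the other side. Each such step lowers the
number of representatives. -/
theorem exists_matched (f : Retr X) (g : Perm X) (h : Retr X) :
    ∃ f' h', Matched f' g h' ∧ F.normalForm f g h = F.normalForm f' g h' := by
  induction hk : (Finset.univ.filter fun z => f z = some z).card +
    (Finset.univ.filter fun z => h z = some z).card using Nat.strong_induction_on
    generalizing f h with
  | _ k ih =>
    by_cases hm : Matched f g h
    · exact ⟨f, h, hm, rfl⟩
    · rw [Matched] at hm
      push Not at hm
      obtain ⟨y, ⟨h1, h2⟩ | ⟨h1, h2⟩⟩ := hm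
      · obtain ⟨f', h', hm', e⟩ := ih _ (by
          rw [← hk]
          exact Nat.add_lt_add_right (card_fixed_kill_lt h1) _) (Retr.kill (g y) f) h rfl
        exact ⟨f', h', hm', by rw [← e, F.normalForm_kill, Retr.kill_of_not_fixed h2]⟩
      · obtain ⟨f', h', hm', e⟩ := ih _ (by
          rw [← hk]
          exact Nat.add_lt_add_left (card_fixed_kill_lt h2) _) f (Retr.kill y h) rfl
        exact ⟨f', h', hm', by rw [← e, ← F.normalForm_kill, Retr.kill_of_not_fixed h1]⟩

/-- If x or y is not a representative, R f supplies the corresponding idempotent, which turns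
ρ_{x,y} into e_x e_y; otherwise two classes merge. -/
theorem exists_eq_R_mul_ρ (f : Retr X) {x y : X} (hxy : x ≠ y) :
    ∃ f', F.R f * F.ρ x y = F.R f' := by
  have kill_both : F.R f * (F.e x * F.e y) = F.R (Retr.kill y (Retr.kill x f)) := by
    rw [← mul_assoc, F.R_mul_e, F.R_mul_e]
  by_cases hx : f x = some x
  · by_cases hy : f y = some y
    · exact ⟨_, F.R_mul_ρ hx hy hxy⟩
    · refine ⟨_, Eq.trans ?_ kill_both⟩
      rw [← F.e_ρ x y hxy, ← mul_assoc, F.R_mul_e_of_not_fixed hy]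
  · refine ⟨_, Eq.trans ?_ kill_both⟩
    rw [← F.e_ρ_left x y hxy, ← mul_assoc, F.R_mul_e_of_not_fixed hx]

theorem R_some : F.R ⟨some, fun _ _ _ => rfl⟩ = 1 :=
  Eq.trans (Finset.noncommProd_eq_pow_card _ _ (F.factor_pairwise _ _) 1
    fun _ _ => F.factor_fixed rfl) (one_pow _)

theorem exists_eq_of_mem_right {a : M} (ha : a ∈ F.right) : ∃ f g, a = F.R f * F.π g := by
  induction ha using Submonoid.closure_induction_right with
  | one => exact ⟨_, 1, by rw [R_some, map_one, one_mul]⟩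
  | mul_right a _ b hb ih =>
    obtain ⟨f, g, rfl⟩ := ih
    obtain (⟨k, rfl⟩ | ⟨x, rfl⟩) | ⟨x, y, hxy, rfl⟩ := hb
    · exact ⟨f, g * k, by rw [map_mul, mul_assoc]⟩
    · exact ⟨_, g, by rw [mul_assoc, F.π_e, ← mul_assoc, F.R_mul_e]⟩
    · obtain ⟨f', hf'⟩ := F.exists_eq_R_mul_ρ f (g.injective.ne hxy)
      exact ⟨f', g, by rw [mul_assoc, F.π_ρ, ← mul_assoc, hf']⟩

theorem exists_normalForm {a : M} (ha : F.IsProduct a) :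
    ∃ f g h, Matched f g h ∧ a = F.normalForm f g h := by
  obtain ⟨r, hr, l, hl, rfl⟩ := ha
  obtain ⟨f, g, rfl⟩ := F.exists_eq_of_mem_right hr
  obtain ⟨h, k, rfl⟩ := F.exists_eq_of_mem_right hl
  obtain ⟨f', h', hm, e⟩ := F.exists_matched f (g * k⁻¹) h
  refine ⟨f', _, h', hm, ?_⟩
  rw [← e, normalForm, F.star_mul, F.star_π, map_mul]
  simp only [mul_assoc]

end Frame


/-! ### The diagrams of normal forms, and injectivity. -/

section Semantics

variable (hn : 3 ≤ n)

/-- The anti-automorphism corresponds to reflecting diagrams, that is, to taking converse relations.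
-/
theorem sat_star (a : S n) (u v : Fin n → Bool) :
    (toPIP n (star a)).Sat u v ↔ (toPIP n a).Sat v u := by
  induction a using induction_gen generalizing u v with
  | one => rw [star_one, map_one, PIP.sat_one, PIP.sat_one, eq_comm]
  | mul g a ih =>
    have hg : ∀ u v, (toPIP n (star (gen g))).Sat u v ↔ (toPIP n (gen g)).Sat v u := by
      intro u v
      cases g with
      | sigma i h =>
        change (PIP.s _ _).Sat _ _ ↔ (PIP.s _ _).Sat _ _
        rw [PIP.sat_s, PIP.sat_s]
        constructor <;> rintro rfl <;> funext t <;> simp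
      | lam i h =>
        change (PIP.r _ _).Sat _ _ ↔ (PIP.l _ _).Sat _ _
        rw [PIP.sat_r (by simp), PIP.sat_l (by simp)]
        constructor
        · rintro ⟨h, rfl⟩
          simp [h]
        · rintro ⟨h, rfl⟩
          simp [← h]
      | rho i h =>
        change (PIP.l _ _).Sat _ _ ↔ (PIP.r _ _).Sat _ _
        rw [PIP.sat_r (by simp), PIP.sat_l (by simp)]
        constructor
        · rintro ⟨h, rfl⟩
          simp [← h]
        · rintro ⟨h, rfl⟩
          simp [h]
      | e i h =>
        change (PIP.eps _).Sat _ _ ↔ (PIP.eps _).Sat _ _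
        rw [PIP.sat_eps, PIP.sat_eps]
        constructor <;> rintro ⟨h, rfl⟩ <;> exact ⟨h, rfl⟩
    rw [star_mul, map_mul, map_mul, PIP.sat_mul, PIP.sat_mul]
    exact exists_congr fun w => by rw [ih, hg, and_comm]

theorem sat_perm (g : Perm (Fin n)) (u v : Fin n → Bool) :
    (toPIP n (perm hn g)).Sat u v ↔ v = fun t => u (g t) := by
  have : g ∈ ({ carrier := {g | ∀ u v, (toPIP n (perm hn g)).Sat u v ↔ v = fun t => u (g t)}
                one_mem' := fun u v => by
                  rw [map_one, map_one, PIP.sat_one]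
                  rfl
                mul_mem' := fun {g h} hg hh u v => by
                  simp only [Set.mem_ofPred_eq] at *
                  simp only [map_mul, PIP.sat_mul, hg, hh, exists_eq_left, Perm.mul_apply] } :
      Submonoid (Perm (Fin n))) := by
    refine mem_of_forall_swap_mem _ (fun _ => True) (fun x y _ _ hxy =>
      swap_mem_of_adjacent _ 0 (fun i hi _ => ?_) x y (Nat.zero_le _) (Nat.zero_le _) hxy) g
      (fun x hx => absurd trivial hx)
    intro u v
    rw [perm_swap]
    exact PIP.sat_s _ _ u v
  exact this u v

theorem sat_eAt (x : Fin n) (u v : Fin n → Bool) :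
    (toPIP n (eAt hn x)).Sat u v ↔ u x = false ∧ v = u := by
  rw [eAt_eq]
  exact PIP.sat_eps x u v

theorem sat_rhoAt {x y : Fin n} (hxy : x ≠ y) (u v : Fin n → Bool) :
    (toPIP n (rhoAt hn x y)).Sat u v ↔ u x = u y ∧ v = Function.update u y false := by
  obtain ⟨g, rfl, rfl⟩ := exists_perm_two hn x y hxy
  have e : rhoAt hn (g ⟨0, by omega⟩) (g ⟨1, by omega⟩) =
      perm hn g * gen (.rho 0 (by omega)) * perm hn g⁻¹ := by
    rw [← conj_rhoAt, rhoAt_zero_one]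
    rfl
  have r : ∀ u v, (toPIP n (gen (.rho 0 (by omega)))).Sat u v ↔ _ :=
    PIP.sat_r (x := (⟨0, by omega⟩ : Fin n)) (y := ⟨0 + 1, by omega⟩) (by simp)
  simp only [e, map_mul, PIP.sat_mul, sat_perm, r, exists_eq_left, and_assoc, exists_and_left]
  have e' : (fun t => Function.update (fun t => u (g t)) ⟨0 + 1, by omega⟩ false (g⁻¹ t)) =
      Function.update u (g ⟨1, by omega⟩) false := by
    funext t
    obtain ⟨t, rfl⟩ := g.surjective t
    have : g⁻¹ (g t) = t := g.symm_apply_apply t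
    simp [this, Function.update_apply]
  rw [e']

/-- The function `u` is constant on the classes of `f` and vanishes outside its domain. -/
def Fits {X : Type*} (f : Retr X) (u : X → Bool) : Prop := ∀ x, u x = (f x).elim false u

/-- The indicator function of the class represented by `a`. -/
def classIndicator {X : Type*} [DecidableEq X] (f : Retr X) (a : X) : X → Bool :=
  fun z => decide (f z = some a)

theorem fits_classIndicator {X : Type*} [DecidableEq X] (f : Retr X) (a : X) :
    Fits f (classIndicator f a) := by
  intro x
  rcases h : f x with _ | b
  · simp [classIndicator, h]
  · simp [classIndicator, h, f.idem _ _ h]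

/-- A factor e_x requires u x = `false`; a factor ρ_{y,x} requires u y = u x and then clears x.
Earlier factors change neither representatives nor points not yet treated, so all conditions can be
read off the original u. -/
theorem sat_partialR (f : Retr (Fin n)) (T : Finset (Fin n)) (u v : Fin n → Bool) :
    (toPIP n ((frame hn).partialR f T)).Sat u v ↔ (∀ x ∈ T, u x = (f x).elim false u) ∧
      v = fun x => if x ∈ T ∧ f x ≠ some x then false else u x := by
  induction T using Finset.induction_on generalizing v with
  | empty =>
    rw [Frame.partialR, Finset.noncommProd_empty, map_one, PIP.sat_one]
    simp
  | insert x T hx ih =>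
    rw [Frame.partialR_erase _ f (Finset.mem_insert_self x T), Finset.erase_insert hx, map_mul,
      PIP.sat_mul]
    simp only [ih, and_assoc, exists_and_left, exists_eq_left]
    rcases (frame hn).factor_cases f x with ⟨h1, e1⟩ | ⟨h1, e1⟩ | ⟨y, h1, h1', h1'', e1⟩ <;> rw [e1]
    · change _ ∧ (toPIP n (eAt hn x)).Sat _ _ ↔ _
      rw [sat_eAt, ← and_assoc]
      apply and_eq_iff_and_eq
      · simp [h1, hx, and_comm]
      · grind
    · rw [map_one, PIP.sat_one]
      apply and_eq_iff_and_eq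
      · simp [h1]
      · grind
    · change _ ∧ (toPIP n (rhoAt hn y x)).Sat _ _ ↔ _
      rw [sat_rhoAt hn h1'', ← and_assoc]
      apply and_eq_iff_and_eq
      · simp only [Finset.forall_mem_insert, h1, h1', hx, Option.elim_some, ne_eq, not_true,
          and_false, false_and, if_false]
        rw [and_comm, eq_comm]
      · simp only [Function.update_apply]
        grind

theorem sat_R (f : Retr (Fin n)) (u v : Fin n → Bool) :
    (toPIP n ((frame hn).R f)).Sat u v ↔ Fits f u ∧
      v = fun x => if f x = some x then u x else false := by
  rw [Frame.R, sat_partialR]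
  have : (fun x => if x ∈ Finset.univ ∧ f x ≠ some x then false else u x) =
      fun x => if f x = some x then u x else false := by
    funext x
    by_cases h : f x = some x <;> simp [h]
  rw [this]
  simp [Fits]

theorem sat_normalForm (f : Retr (Fin n)) (g : Perm (Fin n)) (h : Retr (Fin n))
    (u w : Fin n → Bool) : (toPIP n ((frame hn).normalForm f g h)).Sat u w ↔
      Fits f u ∧ Fits h w ∧ ∀ y, (if f (g y) = some (g y) then u (g y) else false) =
        if h y = some y then w y else false := by
  rw [Frame.normalForm]
  change (toPIP n (_ * perm hn g * star _)).Sat u w ↔ _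
  simp only [map_mul, PIP.sat_mul, sat_R, sat_perm, sat_star, and_assoc, exists_and_left,
    exists_eq_left]
  rw [funext_iff]

/-- The indicator of each class of f fits f, hence fits f'; so each point of the class has an
f'-representative in that same class. -/
theorem sameKer_of_fits {X : Type*} [DecidableEq X] {f f' : Retr X}
    (h : ∀ u, Fits f u ↔ Fits f' u) : Frame.SameKer f f' := by
  have key : ∀ {f f' : Retr X}, (∀ u, Fits f u ↔ Fits f' u) → ∀ z a, f z = some a →
      ∃ b, f' z = some b ∧ f b = some a := by
    intro f f' h z a hz
    have := (h _).1 (fits_classIndicator f a) z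
    rcases hb : f' z with _ | b
    · rw [hb] at this
      simp [classIndicator, hz] at this
    · rw [hb] at this
      exact ⟨b, rfl, by simpa [classIndicator, hz] using this⟩
  have key2 : ∀ {f f' : Retr X}, (∀ u, Fits f u ↔ Fits f' u) → ∀ z w, f z = f w → f' z = f' w := by
    intro f f' h z w hzw
    rcases ha : f z with _ | a
    · rcases hb : f' z with _ | b <;> rcases hc : f' w with _ | c
      · rfl
      · obtain ⟨d, hd, _⟩ := key (fun u => (h u).symm) w c hc
        rw [← hzw, ha] at hd
        cases hd
      · obtain ⟨d, hd, _⟩ := key (fun u => (h u).symm) z b hb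
        rw [ha] at hd
        cases hd
      · obtain ⟨d, hd, _⟩ := key (fun u => (h u).symm) z b hb
        rw [ha] at hd
        cases hd
    · obtain ⟨b, hb, hb'⟩ := key h z a ha
      obtain ⟨d, hd, hd'⟩ := key (fun u => (h u).symm) z b hb
      obtain ⟨b', hb2, _⟩ := key h w a (hzw ▸ ha)
      obtain ⟨c, hc, hc'⟩ := key (fun u => (h u).symm) w b' hb2
      rw [ha] at hd
      rw [← hzw, ha] at hc
      cases hd
      cases hc
      rw [hb, ← hd', hc', hb2]
  refine ⟨fun z => ?_, fun z w => ⟨key2 h z w, key2 (fun u => (h u).symm) z w⟩⟩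
  rcases ha : f z with _ | a <;> rcases hb : f' z with _ | b
  · simp
  · obtain ⟨d, hd, _⟩ := key (fun u => (h u).symm) z b hb
    rw [ha] at hd
    cases hd
  · obtain ⟨d, hd, _⟩ := key h z a ha
    rw [hb] at hd
    cases hd
  · simp

/-- The function on the right column determined by a function on the left column. -/
theorem exists_fits {X : Type*} [DecidableEq X] {f h : Retr X} {g : Perm X}
    (hm : Frame.Matched f g h) (u : X → Bool) : ∃ w, Fits h w ∧
      ∀ y, (if f (g y) = some (g y) then u (g y) else false) =
          if h y = some y then w y else false := by
  refine ⟨fun z => (h z).elim false fun y => u (g y), fun z => ?_, fun y => ?_⟩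
  · rcases hz : h z with _ | y
    · simp only [hz, Option.elim_none]
    · simp only [hz, h.idem _ _ hz, Option.elim_some]
  · have := hm y
    by_cases hy : h y = some y
    · rw [if_pos (this.2 hy), if_pos hy]
      simp only [hy, Option.elim_some]
    · rw [if_neg (mt this.1 hy), if_neg hy]

/-- The matching condition is symmetric under exchanging f with h and g with its inverse. -/
theorem exists_fits' {X : Type*} [DecidableEq X] {f h : Retr X} {g : Perm X}
    (hm : Frame.Matched f g h) (w : X → Bool) : ∃ u, Fits f u ∧
      ∀ y, (if f (g y) = some (g y) then u (g y) else false) =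
          if h y = some y then w y else false := by
  have hm' : Frame.Matched h g⁻¹ f := by
    intro y
    obtain ⟨y, rfl⟩ := g.surjective y
    have : g⁻¹ (g y) = y := g.symm_apply_apply y
    rw [this]
    exact (hm y).symm
  obtain ⟨u, hu, e⟩ := exists_fits hm' w
  refine ⟨u, hu, fun y => ?_⟩
  have := e (g y)
  rw [show g⁻¹ (g y) = y from g.symm_apply_apply y] at this
  exact this.symm

/-- Test functions show that g and g' have the same preimage of each representative of f. Then g
g'⁻¹ fixes these representatives, so R f absorbs it. -/
theorem normalForm_eq_of_perm {f h : Retr (Fin n)} {g g' : Perm (Fin n)}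
    (hm : Frame.Matched f g' h)
    (e : toPIP n ((frame hn).normalForm f g h) = toPIP n ((frame hn).normalForm f g' h)) :
    (frame hn).normalForm f g h = (frame hn).normalForm f g' h := by
  have hfix : ∀ a, f a = some a → g (g'⁻¹ a) = a := by
    intro a ha
    obtain ⟨b, rfl⟩ := g'.surjective a
    rw [show g'⁻¹ (g' b) = b from g'.symm_apply_apply b]
    have hb := (hm b).1 ha
    have hs : (toPIP n ((frame hn).normalForm f g' h)).Sat (classIndicator f (g' b))
        (classIndicator h b) := by
      rw [sat_normalForm]
      refine ⟨fits_classIndicator _ _, fits_classIndicator _ _, fun y => ?_⟩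
      have hy := hm y
      by_cases h1 : h y = some y
      · rw [if_pos h1, if_pos (hy.2 h1)]
        simp only [classIndicator, h1, hy.2 h1, Option.some.injEq, g'.injective.eq_iff]
      · rw [if_neg h1, if_neg (mt hy.1 h1)]
    rw [← e, sat_normalForm] at hs
    -- At this point the left side is `true`, so g⁻¹ (g' b) is a representative of h in the class of
    -- b, hence equals b.
    have := hs.2.2 (g⁻¹ (g' b))
    rw [show g (g⁻¹ (g' b)) = g' b from g.apply_symm_apply _, if_pos ha] at this
    have h1 : classIndicator f (g' b) (g' b) = true := by simp [classIndicator, ha]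
    rw [h1] at this
    split_ifs at this with h2
    simp only [classIndicator, h2, Option.some.injEq] at this
    have h3 : g⁻¹ (g' b) = b := of_decide_eq_true this.symm
    calc g b = g (g⁻¹ (g' b)) := by rw [h3]
      _ = g' b := g.apply_symm_apply _
  have : (frame hn).R f * (frame hn).π (g * g'⁻¹) = (frame hn).R f :=
    (frame hn).R_mul_π_of_fix _ hfix
  have h4 : (frame hn).R f * (frame hn).π g = (frame hn).R f * (frame hn).π g' := by
    conv_rhs => rw [← this, mul_assoc, ← map_mul, inv_mul_cancel_right]
  rw [Frame.normalForm, Frame.normalForm, h4]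

/-- By matching, every function that fits f extends to a compatible pair, and likewise for h. The
diagram thus determines the classes on both sides, and both forms can be written with the same
retractions. -/
theorem normalForm_eq {f h f' h' : Retr (Fin n)} {g g' : Perm (Fin n)}
    (hm : Frame.Matched f g h) (hm' : Frame.Matched f' g' h')
    (e : toPIP n ((frame hn).normalForm f g h) = toPIP n ((frame hn).normalForm f' g' h')) :
    (frame hn).normalForm f g h = (frame hn).normalForm f' g' h' := by
  have hs : ∀ u w, (Fits f' u ∧ Fits h' w ∧ ∀ y, (if f' (g' y) = some (g' y) then u (g' y) else
      false) = if h' y = some y then w y else false) ↔ (Fits f u ∧ Fits h w ∧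
      ∀ y, (if f (g y) = some (g y) then u (g y) else false) =
        if h y = some y then w y else false) := fun u w => by
    rw [← sat_normalForm hn, ← sat_normalForm hn, e]
  have hl : Frame.SameKer f f' := by
    refine sameKer_of_fits fun u => ⟨fun hu => ?_, fun hu => ?_⟩
    · obtain ⟨w, hw, hw'⟩ := exists_fits hm u
      exact ((hs u w).2 ⟨hu, hw, hw'⟩).1
    · obtain ⟨w, hw, hw'⟩ := exists_fits hm' u
      exact ((hs u w).1 ⟨hu, hw, hw'⟩).1
  have hr : Frame.SameKer h h' := by
    refine sameKer_of_fits fun w => ⟨fun hw => ?_, fun hw => ?_⟩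
    · obtain ⟨u, hu, hu'⟩ := exists_fits' hm w
      exact ((hs u w).2 ⟨hu, hw, hu'⟩).2.1
    · obtain ⟨u, hu, hu'⟩ := exists_fits' hm' w
      exact ((hs u w).1 ⟨hu, hw, hu'⟩).2.1
  obtain ⟨k, hk⟩ := (frame hn).exists_R_eq f f' hl
  obtain ⟨k', hk'⟩ := (frame hn).exists_R_eq h h' hr
  -- Both changes of representatives are pushed into the middle permutation; only g' has to be
  -- matched for `normalForm_eq_of_perm`.
  have e1 : (frame hn).normalForm f g h = (frame hn).normalForm f' (k * g * k'⁻¹) h' := by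
    rw [Frame.normalForm, Frame.normalForm, hk, hk', Frame.star_mul, Frame.star_π, map_mul, map_mul]
    simp only [mul_assoc]
  rw [e1] at e ⊢
  exact normalForm_eq_of_perm hn hm' e

theorem isProduct (a : S n) : (frame hn).IsProduct a := by
  induction a using induction_gen with
  | one => exact (frame hn).isProduct_one
  | mul g a ih =>
    cases g with
    | sigma i h =>
      rw [← perm_swap hn]
      exact (frame hn).isProduct_mul_of_mem_right ((frame hn).π_mem_right _) ih
    | lam i h =>
      rw [← star_rho, ← rhoAt_succ hn]
      exact (frame hn).isProduct_star_ρ_mul (by simp) ih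
    | rho i h =>
      rw [← rhoAt_succ hn]
      exact (frame hn).isProduct_mul_of_mem_right ((frame hn).ρ_mem_right (by simp)) ih
    | e i h =>
      rw [← eAt_eq hn]
      exact (frame hn).isProduct_mul_of_mem_right ((frame hn).e_mem_right _) ih

end Semantics

theorem toPIP_injective {n : ℕ} (hn : 3 ≤ n) : Function.Injective (toPIP n) := by
  intro a b hab
  obtain ⟨f, g, h, hm, rfl⟩ := (frame hn).exists_normalForm (isProduct hn a)
  obtain ⟨f', g', h', hm', rfl⟩ := (frame hn).exists_normalForm (isProduct hn b)
  exact normalForm_eq hn hm hm' hab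


/-! ### Reading a normal form off a diagram: surjectivity. -/

section Sides

variable {X : Type*} (a : PIP X)

theorem not_isPoint_of_rel {p q : X ⊕ X} (hp : ¬ a.IsPoint p) (h : a.rel p q) : ¬ a.IsPoint q :=
  fun hq => hp (by rwa [hq p h])

/-- A representative of a class on the side parametrized by `i`, if there is one. -/
noncomputable def sideRep [Nonempty X] (i : X → X ⊕ X) : Quotient a.rel → X :=
  Function.invFun fun x => Quotient.mk a.rel (i x)

/-- `sideRep` returns an arbitrary point for a class that misses the side; the hypothesis excludes
that case. -/
theorem mk_sideRep [Nonempty X] (i : X → X ⊕ X) {u : X ⊕ X} {x : X} (h : a.rel u (i x)) :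
    Quotient.mk a.rel (i (sideRep a i (Quotient.mk a.rel u))) = Quotient.mk a.rel u :=
  Function.invFun_eq (f := fun x => Quotient.mk a.rel (i x))
    ⟨x, Quotient.sound (a.rel.symm' h)⟩

open Classical in
/-- The retraction whose classes are the parts of the lines on the side parametrized by `i`. -/
noncomputable def sideRetr [Nonempty X] (i : X → X ⊕ X) : Retr X where
  toFun x := if a.IsPoint (i x) then none else some (sideRep a i (Quotient.mk a.rel (i x)))
  idem := by
    intro x y h
    split_ifs at h with hx
    cases h
    have e := mk_sideRep a i (a.rel.refl' (i x))
    rw [e, if_neg (not_isPoint_of_rel a hx (a.rel.symm' (Quotient.exact e)))]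

theorem sideRetr_of_isPoint [Nonempty X] (i : X → X ⊕ X) {x : X} (hx : a.IsPoint (i x)) :
    sideRetr a i x = none := if_pos hx

theorem sideRetr_of_not_isPoint [Nonempty X] (i : X → X ⊕ X) {x : X} (hx : ¬ a.IsPoint (i x)) :
    sideRetr a i x = some (sideRep a i (Quotient.mk a.rel (i x))) := if_neg hx

theorem sideRetr_fixed_iff [Nonempty X] (i : X → X ⊕ X) (x : X) : sideRetr a i x = some x ↔
    ¬ a.IsPoint (i x) ∧ sideRep a i (Quotient.mk a.rel (i x)) = x := by
  by_cases hx : a.IsPoint (i x)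
  · simp [sideRetr_of_isPoint a i hx, hx]
  · simp [sideRetr_of_not_isPoint a i hx, hx]

theorem line_of_not_isPoint {p : X ⊕ X} (hp : ¬ a.IsPoint p) :
    (∃ x, a.rel p (Sum.inl x)) ∧ ∃ y, a.rel p (Sum.inr y) :=
  (a.point_or_line p).resolve_left hp

theorem sideRetr_sideRep [Nonempty X] (i j : X → X ⊕ X)
    (hj : ∀ p, ¬ a.IsPoint p → ∃ x, a.rel p (j x)) {y : X} (hy : ¬ a.IsPoint (i y)) :
    sideRetr a j (sideRep a j (Quotient.mk a.rel (i y))) =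
      some (sideRep a j (Quotient.mk a.rel (i y))) := by
  obtain ⟨x, hx⟩ := hj _ hy
  have e := mk_sideRep a j hx
  rw [sideRetr_fixed_iff, e]
  exact ⟨not_isPoint_of_rel a hy (a.rel.symm' (Quotient.exact e)), rfl⟩

theorem sideRep_sideRep [Nonempty X] (i j : X → X ⊕ X)
    (hj : ∀ p, ¬ a.IsPoint p → ∃ x, a.rel p (j x)) {y : X} (hy : sideRetr a i y = some y) :
    sideRep a i (Quotient.mk a.rel (j (sideRep a j (Quotient.mk a.rel (i y))))) = y := by
  rw [sideRetr_fixed_iff] at hy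
  obtain ⟨x, hx⟩ := hj _ hy.1
  rw [mk_sideRep a j hx, hy.2]

/-- The lines give a bijection between the representatives on the two sides. -/
noncomputable def sideEquiv [Nonempty X] : {y // sideRetr a Sum.inr y = some y} ≃
    {x // sideRetr a Sum.inl x = some x} where
  toFun y := ⟨sideRep a Sum.inl (Quotient.mk a.rel (Sum.inr y.1)), sideRetr_sideRep a _ _
    (fun _ hp => (line_of_not_isPoint a hp).1) ((sideRetr_fixed_iff a _ _).1 y.2).1⟩
  invFun x := ⟨sideRep a Sum.inr (Quotient.mk a.rel (Sum.inl x.1)), sideRetr_sideRep a _ _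
    (fun _ hp => (line_of_not_isPoint a hp).2) ((sideRetr_fixed_iff a _ _).1 x.2).1⟩
  left_inv y := Subtype.ext (sideRep_sideRep a _ _
    (fun _ hp => (line_of_not_isPoint a hp).1) y.2)
  right_inv x := Subtype.ext (sideRep_sideRep a _ _
    (fun _ hp => (line_of_not_isPoint a hp).2) x.2)

theorem fits_sideRetr [Nonempty X] (i : X → X ⊕ X) {u v : X → Bool} (h : a.Sat u v) :
    Fits (sideRetr a i) (fun x => Sum.elim u v (i x)) := by
  intro x
  by_cases hx : a.IsPoint (i x)
  · rw [sideRetr_of_isPoint a i hx]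
    exact h.2 _ hx
  · rw [sideRetr_of_not_isPoint a i hx]
    exact (h.1 _ _ (Quotient.exact (mk_sideRep a i (a.rel.refl' (i x))))).symm

/-- A line consists of one class on each side, joined through their representatives by g; constancy
on the two classes and agreement across g amount to constancy on the line. -/
theorem sat_iff_fits [Nonempty X] [DecidableEq X] (g : Perm X)
    (hg : ∀ y (hy : sideRetr a Sum.inr y = some y), g y = sideEquiv a ⟨y, hy⟩)
    (hm : Frame.Matched (sideRetr a Sum.inl) g (sideRetr a Sum.inr)) (u w : X → Bool) :
    (Fits (sideRetr a Sum.inl) u ∧ Fits (sideRetr a Sum.inr) w ∧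
      ∀ y, (if sideRetr a Sum.inl (g y) = some (g y) then u (g y) else false) =
        if sideRetr a Sum.inr y = some y then w y else false) ↔ a.Sat u w := by
  constructor
  · rintro ⟨h1, h2, h3⟩
    -- The value at any vertex of a line is the value at its left representative; for a right vertex
    -- the passage goes through the right representative and g.
    have label : ∀ p, ¬ a.IsPoint p →
        Sum.elim u w p = u (sideRep a Sum.inl (Quotient.mk a.rel p)) := by
      rintro (x | y) hp
      · have := h1 x
        rwa [sideRetr_of_not_isPoint a Sum.inl hp] at this
      · have e := h2 y
        rw [sideRetr_of_not_isPoint a Sum.inr hp, Option.elim_some] at e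
        have hf := sideRetr_sideRep a Sum.inr Sum.inr
          (fun _ hp => (line_of_not_isPoint a hp).2) hp
        have e3 := h3 (sideRep a Sum.inr (Quotient.mk a.rel (Sum.inr y)))
        rw [if_pos hf, if_pos ((hm _).2 hf), ← e, hg _ hf] at e3
        change u (sideRep a Sum.inl (Quotient.mk a.rel (Sum.inr _))) = _ at e3
        rw [mk_sideRep a Sum.inr (a.rel.refl' (Sum.inr y))] at e3
        exact e3.symm
    refine ⟨fun p q hpq => ?_, fun p hp => ?_⟩
    · by_cases hp : a.IsPoint p
      · rw [hp q (a.rel.symm' hpq)]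
      · rw [label p hp, label q (not_isPoint_of_rel a hp hpq), Quotient.sound hpq]
    · rcases p with x | y
      · have := h1 x
        rwa [sideRetr_of_isPoint a Sum.inl hp] at this
      · have := h2 y
        rwa [sideRetr_of_isPoint a Sum.inr hp] at this
  · intro h
    refine ⟨fits_sideRetr a Sum.inl h, fits_sideRetr a Sum.inr h, fun y => ?_⟩
    by_cases hy : sideRetr a Sum.inr y = some y
    · rw [if_pos hy, if_pos ((hm y).2 hy), hg y hy]
      have hp := ((sideRetr_fixed_iff a _ _).1 hy).1
      obtain ⟨x, hx⟩ := (line_of_not_isPoint a hp).1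
      exact h.1 (Sum.inl _) (Sum.inr y) (Quotient.exact (mk_sideRep a Sum.inl hx))
    · rw [if_neg hy, if_neg (mt (hm y).1 hy)]

end Sides

theorem toPIP_surjective {n : ℕ} (hn : 3 ≤ n) : Function.Surjective (toPIP n) := by
  intro a
  have : Nonempty (Fin n) := ⟨⟨0, by omega⟩⟩
  classical
  -- Any extension of the bijection of representatives serves. It maps non-representatives to
  -- non-representatives, which gives the matching condition.
  let g : Perm (Fin n) := (sideEquiv a).extendSubtype
  have hg : ∀ y (hy : sideRetr a Sum.inr y = some y), g y = sideEquiv a ⟨y, hy⟩ :=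
    fun y hy => Equiv.extendSubtype_apply_of_mem _ y hy
  have hm : Frame.Matched (sideRetr a Sum.inl) g (sideRetr a Sum.inr) := by
    intro y
    constructor
    · intro h
      by_contra hy
      exact Equiv.extendSubtype_not_mem (sideEquiv a) y hy h
    · exact fun hy => Equiv.extendSubtype_mem (sideEquiv a) y hy
  refine ⟨(frame hn).normalForm (sideRetr a Sum.inl) g (sideRetr a Sum.inr),
    PIP.ext_sat fun u w => ?_⟩
  rw [sat_normalForm]
  exact sat_iff_fits a g hg hm u w

/-! ### Uniqueness of the homomorphism. -/

/-- The idempotents are words in the other generators: e_{i+1} = λ_i ρ_i, and e_0 = σ_0 e_1 σ_0. -/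
theorem hom_ext {n : ℕ} (hn : 3 ≤ n) {M : Type*} [Monoid M] (φ ψ : S n →* M)
    (hs : ∀ i h, φ (gen (.sigma i h)) = ψ (gen (.sigma i h)))
    (hl : ∀ i h, φ (gen (.lam i h)) = ψ (gen (.lam i h)))
    (hr : ∀ i h, φ (gen (.rho i h)) = ψ (gen (.rho i h))) : φ = ψ := by
  have he : ∀ (i : ℕ) (h : i + 1 < n), φ (gen (.e (i + 1) h)) = ψ (gen (.e (i + 1) h)) := by
    intro i h
    have r : (gen (.e (i + 1) h) : S n) = gen (.lam i h) * gen (.rho i h) := rel (.e_succ i h)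
    rw [r, map_mul, map_mul, hl, hr]
  refine PresentedMonoid.ext _ fun g => ?_
  cases g with
  | sigma i h => exact hs i h
  | lam i h => exact hl i h
  | rho i h => exact hr i h
  | e i h =>
    cases i with
    | zero =>
      have r : (gen (.e 0 h) : S n) = gen (.sigma 0 (by omega)) * gen (.e 1 (by omega)) *
          gen (.sigma 0 (by omega)) := rel (.e_zero (by omega))
      change φ (gen (.e 0 h)) = ψ (gen (.e 0 h))
      rw [r, map_mul, map_mul, map_mul, map_mul, hs, he 0 (by omega)]
    | succ i => exact he i h

end PIPPresentation

theorem mainTheorem1 (n : ℕ) (hn : 3 ≤ n) :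
    ∃ φ : PIPPresentation.S n ≃* PIP (Fin n),
      (∀ (i : ℕ) (hi : i + 1 < n), φ (PIPPresentation.gen (PIPPresentation.Gen.sigma i hi)) =
        PIP.s ⟨i, by omega⟩ ⟨i + 1, hi⟩) ∧
      (∀ (i : ℕ) (hi : i + 1 < n), φ (PIPPresentation.gen (PIPPresentation.Gen.lam i hi)) =
        PIP.l ⟨i, by omega⟩ ⟨i + 1, hi⟩) ∧
      (∀ (i : ℕ) (hi : i + 1 < n), φ (PIPPresentation.gen (PIPPresentation.Gen.rho i hi)) =
        PIP.r ⟨i, by omega⟩ ⟨i + 1, hi⟩) ∧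
      (∀ (i : ℕ) (hi : i < n), φ (PIPPresentation.gen (PIPPresentation.Gen.e i hi)) =
        PIP.eps ⟨i, hi⟩) ∧
      -- `φ` is the only homomorphism with the prescribed values on `σ_i`, `λ_i`, `ρ_i`
      ∀ ψ : PIPPresentation.S n →* PIP (Fin n),
        (∀ (i : ℕ) (hi : i + 1 < n), ψ (PIPPresentation.gen (PIPPresentation.Gen.sigma i hi)) =
          PIP.s ⟨i, by omega⟩ ⟨i + 1, hi⟩) →
        (∀ (i : ℕ) (hi : i + 1 < n), ψ (PIPPresentation.gen (PIPPresentation.Gen.lam i hi)) =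
          PIP.l ⟨i, by omega⟩ ⟨i + 1, hi⟩) →
        (∀ (i : ℕ) (hi : i + 1 < n), ψ (PIPPresentation.gen (PIPPresentation.Gen.rho i hi)) =
          PIP.r ⟨i, by omega⟩ ⟨i + 1, hi⟩) →
        ψ = φ.toMonoidHom :=
  ⟨MulEquiv.ofBijective (PIPPresentation.toPIP n)
      ⟨PIPPresentation.toPIP_injective hn, PIPPresentation.toPIP_surjective hn⟩,
    fun _ _ => rfl, fun _ _ => rfl, fun _ _ => rfl, fun _ _ => rfl,
    fun ψ hs hl hr => PIPPresentation.hom_ext hn ψ _ hs hl hr⟩
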